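/- **Setting.** Let $J_0,J_1$ be the Bessel functions of the first kind, $c_0$ the first positive zero of $J_0$, and $x_c=\frac{c_0}{2\pi^2}J_1(c_0)$. Let $\mathsf{Bin}_n$ ($n\ge2$) be the set of plane trees with $n$ leaves and $n-2$ cubic vertices, rooted on a leaf. All leaves are called red. An angle assignment of $\tau\in\mathsf{Bin}_n$ gives each cubic vertex $u$ two angles $\alpha_u,\beta_u\in(0,\pi)$ with $\alpha_u+\beta_u>\pi$: $\alpha_u$ sits at the corner between the edge to the parent and the left edge, $\beta_u$ at the corner between the right edge and the edge to the parent, and the third corner has the angle $2\pi-\alpha_u-\beta_u$. Hence at $u$ the angle opposite to the left edge is $\beta_u$, to the right edge $\alpha_u$, to the parent edge $2\pi-\alpha_u-\beta_u$; a leaf has the angle $\pi$, opposite to its edge. The assignment is allowed if at each edge the two opposite angles have sum $>\pi$. For $\theta\in[0,\pi]$ let $A_{\theta,\tau}\subset\mathbb R^{2n-4}$ be the set of allowed assignments with $\alpha_u+\beta_u+\theta<2\pi$ at the neighbour $u$ of the root leaf (no condition, and measure $1$, if $n=2$), and $$F(x;\theta)=\sum_{n\ge2}x^{n-1}\sum_{\tau\in\mathsf{Bin}_n}\mathrm{Leb}(A_{\theta,\tau}),\qquad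 \mathbb P_0=\frac1{F(x_c;0)}\sum_{n\ge2}x_c^{n-1}\sum_{\tau\in\mathsf{Bin}_n}\mathrm{Leb}|_{A_{0,\tau}},\qquad q=F(x_c;\tfrac\pi2).$$ **Blobs.** An edge is a cut-edge if both opposite angles are at least $\pi/2$. A blob rooted on a cut-edge is a binary tree with an allowed angle assignment in which no edge joining two cubic vertices is a cut-edge and the angle opposite to the root edge is at least $\pi/2$; its leaf edges (other than the root edge) whose opposite angle is at least $\pi/2$ are its further cut-edges, the other ones are its red leaves; the root edge is a cut-edge. The degree of a blob is its number of cut-edges, root included. In addition there is the trivial blob, of degree $1$ and weight $1$, made of a single red leaf. For $k\ge1$ let $\mathfrak B_k$ (resp. $\mathfrak B_k^{\bullet}$) be the total Lebesgue measure of the blobs of degree $k$ rooted on a cut-edge with no (resp. one) red leaf; so $\mathfrak B_1=0$ and $\mathfrak B^\bullet_1=1$. Put, for $k\ge1$, $$p_{k-1}=(\mathfrak B_k+x_c\mathfrak B_k^\bullet)q^{k-2},\qquad r_{k-1}=\frac{x_c\mathfrak B_k^\bullet q^{k-2}}{p_{k-1}},\qquad p^\bullet_k=\frac{\frac1k p_{k-1}r_{k-1}}{\sum_{j\ge1}\frac1j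 p_{j-1}r_{j-1}},\qquad p_0^\bullet=0.$$ **Blob tree.** Cutting a binary tree $\boldsymbol\tau$ with an allowed angle assignment at its cut-edges gives the bicolored plane tree $\pi(\boldsymbol\tau)$: one black vertex for each blob (a leaf whose edge is a cut-edge gives a trivial blob), two black vertices being joined if their blobs share a cut-edge, and each leaf of $\boldsymbol\tau$ (the root leaf included) being a red leaf attached to the black vertex of its blob; the planar order and the red root are inherited from $\boldsymbol\tau$. **Adding red leaves.** For a finite plane tree $\mathsf t$ of black vertices, $\mathrm{Red}^\bullet(\mathsf t)$ is the random bicolored tree obtained as follows: independently for each vertex other than the root, with $k$ children say, attach with probability $r_k$ a red leaf at a uniform place among the children ($k+1$ choices); attach a red leaf to the root vertex at its root corner, and root the tree on this red leaf. **Theorem.** (i) $p=(p_k)_{k\ge0}$ is a probability measure on $\{0,1,2,\dots\}$, it has mean $1$ and finite variance $$\sigma^2=\frac{2\,J_1(c_0/2)\,J_1(c_0)}{J_0(c_0/2)^3},$$ and it has small exponential moments: $\sum_k e^{tk}p_k<\infty$ for some $t>0$. More precisely $p_k=\big(q/(4x_c)\big)^{k+o(k)}$ as $k\to\infty$, where $0<q/(4x_c)<1$.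 (ii) $r_k\in[0,1]$ for all $k$, and $p^\bullet$ is a probability measure. Let $\mathfrak T$ be the Galton–Watson tree whose ancestor has offspring law $p^\bullet$ and whose other vertices have offspring law $p$. Then $\mathfrak T$ is almost surely finite, and $$\mathrm{Red}^\bullet(\mathfrak T)\ \overset{(d)}{=}\ \pi(\boldsymbol\tau)\quad\text{under }\mathbb P_0 .$$ -/

import Mathlib

open MeasureTheory

namespace BlobTree

noncomputable section

/-! ### Bessel functions and the critical weight -/

/-- The Bessel function of the first kind of integer order `n`,
`J_n(x) = ∑_m (-1)^m / (m! (m+n)!) (x/2)^(2m+n)`. -/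
def besselJ (n : ℕ) (x : ℝ) : ℝ :=
  ∑' m : ℕ, (-1 : ℝ) ^ m / ((m.factorial : ℝ) * ((m + n).factorial : ℝ)) * (x / 2) ^ (2 * m + n)

/-- The first positive zero `c₀ = 2.404…` of `J₀`. -/
def c0 : ℝ := sInf {x : ℝ | 0 < x ∧ besselJ 0 x = 0}

/-- The critical weight `x_c = c₀ J₁(c₀) / (2π²)`. -/
def xc : ℝ := c0 / (2 * Real.pi ^ 2) * besselJ 1 c0

/-! ### Red labeled trees: binary trees with allowed angle assignments -/

/-- A full plane binary tree rooted on a leaf, as seen from its root leaf (which is implicit):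
`leaf` is the tree reduced to one edge joining the root leaf to another leaf; in `node l r` the
neighbour of the root leaf is a cubic vertex with left subtree `l` and right subtree `r`. -/
inductive BinTree : Type
  | leaf : BinTree
  | node : BinTree → BinTree → BinTree

/-- The number of leaves other than the root leaf (`n - 1` for a tree with `n` leaves). -/
def BinTree.numLeaves : BinTree → ℕ
  | .leaf => 1
  | .node l r => l.numLeaves + r.numLeaves

/-- A pair of real numbers `(α, β)` for each cubic vertex: `α` is the angle of its first corner
(between the edge to the parent and the left edge), `β` the angle of its last corner (between the
right edge and the edge to the parent). The third angle, opposite to the edge to the parent, is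
`2π - α - β`. -/
def Ang : BinTree → Type
  | .leaf => Unit
  | .node l r => (ℝ × ℝ) × (Ang l × Ang r)

/-- Lebesgue measure on `Ang τ`; the one-point space (no cubic vertex) has mass one. -/
instance angMeasureSpace : (τ : BinTree) → MeasureSpace (Ang τ)
  | .leaf => inferInstanceAs (MeasureSpace Unit)
  | .node l r =>
    @Measure.prod.measureSpace (ℝ × ℝ) (Ang l × Ang r) inferInstance
      (@Measure.prod.measureSpace (Ang l) (Ang r) (angMeasureSpace l) (angMeasureSpace r))

/-- `Allowed φ τ a`: the angles `a` on `τ` lie in `(0, π)` and satisfy the Delaunay condition (the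
two angles opposite to an edge have sum larger than `π`) at every edge, where `φ` is the angle
opposite to the root edge on the outer side of `τ`. The angle opposite to the left edge of a vertex
is `β`, the one opposite to its right edge is `α`. Leaf corners carry the angle `π`, so that edges
ending at a leaf impose no condition. -/
def Allowed : ℝ → (τ : BinTree) → Ang τ → Prop
  | _, .leaf, _ => True
  | φ, .node l r, ((α, β), (a, b)) =>
    0 < α ∧ α < Real.pi ∧ 0 < β ∧ β < Real.pi ∧ Real.pi < α + β ∧ α + β < φ + Real.pi ∧
      Allowed β l a ∧ Allowed α r b

/-- `A_{θ,τ}`: the allowed angle assignments of `τ` such that `α₁ + β₁ + θ < 2π` at the first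
cubic vertex. For `θ = 0` these are all the allowed angle assignments. -/
def angleSet (θ : ℝ) (τ : BinTree) : Set (Ang τ) :=
  {a | Allowed (Real.pi - θ) τ a}

/-- `F(x; θ) = ∑_τ x^(n-1) Leb(A_{θ,τ})`, where `n` is the number of leaves of `τ`. -/
def genF (x θ : ℝ) : ENNReal :=
  ∑' τ : BinTree, ENNReal.ofReal x ^ τ.numLeaves * volume (angleSet θ τ)

/-- Red labeled trees. -/
abbrev LabTree : Type := Σ τ : BinTree, Ang τ

/-- The Boltzmann law `ℙ_{x,θ} = F(x;θ)⁻¹ ∑_τ x^(n-1) Leb_{A_{θ,τ}}` on red labeled trees. -/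
def boltzmann (x θ : ℝ) : Measure LabTree :=
  (genF x θ)⁻¹ • Measure.sum fun τ : BinTree =>
    ENNReal.ofReal x ^ τ.numLeaves • (volume.restrict (angleSet θ τ)).map (Sigma.mk τ)

/-! ### Blobs -/

/-- An edge is a cut-edge if the two opposite angles are both at least `π/2` (both adjacent
triangles have an angle at most `π/2` opposite to the common side). -/
def IsCut (φ ψ : ℝ) : Prop := Real.pi / 2 ≤ φ ∧ Real.pi / 2 ≤ ψ

/-- No edge of `τ` between two cubic vertices is a cut-edge, the root edge included, when the root
edge is attached to a cubic vertex with opposite angle `φ`. -/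
def NoCut : ℝ → (τ : BinTree) → Ang τ → Prop
  | _, .leaf, _ => True
  | φ, .node l r, ((α, β), (a, b)) =>
    ¬ IsCut φ (2 * Real.pi - α - β) ∧ NoCut β l a ∧ NoCut α r b

open Classical in
/-- The number of leaves whose edge has its opposite angle at least `π/2`. In a blob these are the
non-root cut-edges. -/
def cutCount : ℝ → (τ : BinTree) → Ang τ → ℕ
  | φ, .leaf, _ => if Real.pi / 2 ≤ φ then 1 else 0
  | _, .node l r, ((α, β), (a, b)) => cutCount β l a + cutCount α r b

open Classical in
/-- The number of leaves whose edge has its opposite angle smaller than `π/2`. Such an edge is not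
a cut-edge: in a blob these are the red leaves. -/
def redCount : ℝ → (τ : BinTree) → Ang τ → ℕ
  | φ, .leaf, _ => if Real.pi / 2 ≤ φ then 0 else 1
  | _, .node l r, ((α, β), (a, b)) => redCount β l a + redCount α r b

/-- The set of angle assignments on `τ` that define a blob rooted on a cut-edge, with `k` cut-edges
besides the root and `j` red leaves. For the one-edge tree this is the trivial blob: a single red
leaf, with no cut-edge besides the root. -/
def blobSet (j k : ℕ) : (τ : BinTree) → Set (Ang τ)
  | .leaf => {_a | j = 1 ∧ k = 0}
  | .node l r =>
    {((α, β), (a, b)) : (ℝ × ℝ) × (Ang l × Ang r) |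
      Allowed Real.pi (.node l r) ((α, β), (a, b)) ∧
      Real.pi / 2 ≤ 2 * Real.pi - α - β ∧ NoCut β l a ∧ NoCut α r b ∧
      redCount β l a + redCount α r b = j ∧ cutCount β l a + cutCount α r b = k}

/-- The total weight `[z^k][x^j] B_x(z)` of the blobs with `j` red leaves and degree `k + 1`, rooted
on a cut-edge. -/
def blobWeight (j k : ℕ) : ℝ := (∑' τ : BinTree, volume (blobSet j k τ)).toReal

/-! ### The offspring laws -/

/-- `q = F(x_c; π/2)`. -/
def qc : ℝ := (genF xc (Real.pi / 2)).toReal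

/-- `p_k = (𝔅_{k+1} + x_c 𝔅_{k+1}^red) q^(k-1)`. -/
def offspring (k : ℕ) : ℝ := (blobWeight 0 k + xc * blobWeight 1 k) * qc ^ ((k : ℤ) - 1)

/-- `r_k = x_c 𝔅_{k+1}^red q^(k-1) / p_k`. -/
def redProb (k : ℕ) : ℝ := xc * blobWeight 1 k * qc ^ ((k : ℤ) - 1) / offspring k

/-- The root offspring law: proportional to `p_{k-1} r_{k-1} / k` for `k ≥ 1`. -/
def rootOffspring : ℕ → ℝ
  | 0 => 0
  | k + 1 => (offspring k * redProb k / ((k : ℝ) + 1)) /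
      ∑' j : ℕ, offspring j * redProb j / ((j : ℝ) + 1)

/-! ### Plane trees, bicolored trees and the blob tree -/

/-- Finite plane (black) trees, rooted at a vertex. -/
inductive PlaneTree : Type
  | node : List PlaneTree → PlaneTree

/-- Finite bicolored plane trees: `red` is a red leaf and `black cs` a black vertex with ordered
list of children `cs`. -/
inductive BiTree : Type
  | red : BiTree
  | black : List BiTree → BiTree

instance : MeasurableSpace BiTree := ⊤

open Classical in
/-- The ordered list of children which a labeled subtree contributes to the blob lying on the other
side of its root edge, `φ` being the angle opposite to this edge on that other side. If the root
edge is a cut-edge the contribution is one black child (the next blob); a leaf behind a cut-edge is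
a trivial blob, that is a black vertex carrying a red leaf. If the root edge is not a cut-edge, the
subtree continues the same blob. -/
def kids : ℝ → (τ : BinTree) → Ang τ → List BiTree
  | φ, .leaf, _ => if IsCut φ Real.pi then [.black [.red]] else [.red]
  | φ, .node l r, ((α, β), (a, b)) =>
    if IsCut φ (2 * Real.pi - α - β) then [.black (kids β l a ++ kids α r b)]
    else kids β l a ++ kids α r b

/-- The blob tree `π(τ)` of a red labeled tree. It is rooted on the red root leaf, which is implicit:
the value is the bicolored tree seen from that leaf. The root leaf has angle `π`; if its edge is a
cut-edge then the root blob is trivial. -/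
def blobTree (t : LabTree) : BiTree := .black (kids Real.pi t.1 t.2)

/-! ### Galton--Watson trees -/

mutual
/-- `Codes κ t`: the tree generated by the offspring numbers `κ` (indexed by the words of the
Ulam tree, letters starting at `0`) is the finite plane tree `t`. -/
def Codes (κ : List ℕ → ℕ) : PlaneTree → Prop
  | .node cs => κ [] = cs.length ∧ CodesFrom κ 0 cs
/-- The trees generated by `κ` above the words `i`, `i + 1`, … of length one are the elements of
the list. -/
def CodesFrom (κ : List ℕ → ℕ) (i : ℕ) : List PlaneTree → Prop
  | [] => True
  | c :: cs => Codes (fun w => κ (i :: w)) c ∧ CodesFrom κ (i + 1) cs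
end

/-- Independent offspring numbers, with law `ν₀` at the ancestor and `ν` elsewhere. -/
def offspringLaw (ν₀ ν : PMF ℕ) : Measure (List ℕ → ℕ) :=
  Measure.infinitePi fun w : List ℕ => (if w = [] then ν₀ else ν).toMeasure

/-! ### Adding red leaves -/

/-- For a vertex with `k` children: no red leaf with probability `1 - ρ`, and a red leaf at each
of the `k + 1` possible places with probability `ρ / (k + 1)`. -/
def markLaw (k : ℕ) (ρ : unitInterval) : PMF (Option (Fin (k + 1))) :=
  PMF.ofFintype
    (fun m => match m with
      | none => ENNReal.ofReal (1 - (ρ : ℝ))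
      | some _ => ENNReal.ofReal ((ρ : ℝ) / ((k : ℝ) + 1)))
    (by
      have h0 := ρ.2.1
      have h1 := ρ.2.2
      have hk : (0 : ℝ) < (k : ℝ) + 1 := by positivity
      have h2 : (0 : ℝ) ≤ (ρ : ℝ) / ((k : ℝ) + 1) := by positivity
      rw [Fintype.sum_option, Finset.sum_const, Finset.card_univ, Fintype.card_fin, nsmul_eq_mul,
        ← ENNReal.ofReal_natCast, ← ENNReal.ofReal_mul (by positivity),
        ← ENNReal.ofReal_add (by linarith) (by positivity)]
      have : 1 - (ρ : ℝ) + ((k + 1 : ℕ) : ℝ) * ((ρ : ℝ) / ((k : ℝ) + 1)) = 1 := by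
        push_cast
        field_simp
        ring
      rw [this, ENNReal.ofReal_one])

/-- Insert a red leaf at the given place (if any) in the list of children. -/
def insertRed (ds : List BiTree) {n : ℕ} : Option (Fin n) → List BiTree
  | none => ds
  | some i => ds.insertIdx i .red

mutual
/-- `Red(t)`: independently for each vertex with `k` children, a red leaf is attached to it with
probability `ρ k`, at a uniform place among its children. -/
def redLaw (ρ : ℕ → unitInterval) : PlaneTree → PMF BiTree
  | .node cs => (redListLaw ρ cs).bind fun ds =>
      (markLaw cs.length (ρ cs.length)).map fun m => .black (insertRed ds m)
/-- `Red` applied independently to the trees of a list. -/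
def redListLaw (ρ : ℕ → unitInterval) : List PlaneTree → PMF (List BiTree)
  | [] => PMF.pure []
  | c :: cs => (redLaw ρ c).bind fun d => (redListLaw ρ cs).map fun ds => d :: ds
end

/-- The variant of `Red` where the root vertex gets a red leaf on its root corner and the bicolored
tree is rooted on this red leaf (implicit, as in `blobTree`). -/
def redRootLaw (ρ : ℕ → unitInterval) : PlaneTree → PMF BiTree
  | .node cs => (redListLaw ρ cs).map .black

end

end BlobTree

open BlobTree

/-!
In the coordinates `s = π - β`, `t = π - α` at each cubic vertex, an allowed angle assignment is a
recursive choice of points in strips `θ < s + t < π` of the quadrant, `s` and `t` becoming the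
parameters `θ` of the two subtrees. The volumes of the trees with `n` leaves are therefore given by
the convolution recursion `coef π n θ` (`total_leaves`), and the generating function satisfies
`f θ = x + ∫∫_{θ < s + t < π} f s f t` (`gf_eq_add`). The function `s ↦ √A J₁(2 √A s) / s`
(`besselSol`) solves `f θ + ∫∫_{s + t < θ} f s f t = A`: on power series this is the Catalan
convolution (`integral_besselSol_mul`). The generating function is the smallest solution and finite
solutions of the convolution equation are unique, so it is the Bessel solution up to a critical
weight (`gf_le_besselSol`, `gf_eq_besselSol`), and its value at `θ = 0` inverts, up to scaling, the
function `ψ w = √w J₁(2 √w)`, whose derivative is `J₀(2 √w)` (`ampl_spec`). The critical weight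
corresponds to the first zero `w0 = c0² / 4` of `ψ'`; this gives `x_c = ψ(w0) / π²` and
`q = 4 ψ(w0 / 4) / π²`.

Blobs obey the same recursion on the interval `[0, L]` with `L = π / 2`, whose critical weight is
`4 x_c`, except that for `θ > L` the strip is `θ < s + t < 2 L`. A red leaf, which
requires an angle parameter larger than `L`, has the only effect of lowering that parameter by `L`,
wherever the leaf sits, and two red leaves are impossible since two coordinates of sum less than
`2 L` are not both larger than `L` (`lintegral_coefRed_mul`). So the blobs with a red leaf are
counted by the derivative of the generating function, and those without red leaf by the solution of
a linear integral equation, which is explicit by uniqueness (`gfUp_zero_eq`). Expanding the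
resulting blob generating function (`hasSum_blobCoef`) at `q`, where `4 y = w0` and `ψ'` vanishes,
gives mass one, mean one and the variance. The exponential rate is the inverse of the radius of
convergence `4 x_c`: the generating function diverges above the critical weight because its inverse
function has a critical point there (`gf_zero_eq_top`), and the coefficients are supermultiplicative
up to constants, so that Fekete's lemma applies (`eventually_one_le_coef_mul_pow`).

For the blob tree, the same recursion at the root vertex is applied to the event that the list of
children equals a given list. The weight of a bicolored tree is then the product over its black
vertices of a weight depending only on the number of children and the number of red leaves among
them (`total_kids`). The Galton–Watson tree with added red leaves has a product law of the same form
(`vertexLaw_eq`), and the factors agree by the definition of `p`, `r` and `p^•`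
(`matches_offspring`). The Boltzmann law has total mass one, hence so have the weights of the finite
Galton–Watson trees (`tsum_gwRoot`), which gives the almost sure finiteness (`ae_exists_codes`)
together with the equality of the laws.
-/


namespace BlobTree

open MeasureTheory Finset.HasAntidiagonal
open scoped ENNReal

noncomputable section

/-! ### Power series on the real line -/

/-- A power series may be differentiated termwise inside its interval of absolute convergence. -/
theorem hasDerivAt_powerSeries {c : ℕ → ℝ} {r : ℝ} (hc : Summable fun n => |c n| * r ^ n)
    {z : ℝ} (hz : |z| < r) :
    HasDerivAt (fun z : ℝ => ∑' n, c n * z ^ n) (∑' n : ℕ, ((n : ℝ) + 1) * c (n + 1) * z ^ n) z ∧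
      Summable fun n : ℕ => |((n : ℝ) + 1) * c (n + 1)| * |z| ^ n := by
  obtain ⟨ρ, hzρ, hρr⟩ := exists_between hz
  have hρ0 : 0 < ρ := (abs_nonneg z).trans_lt hzρ
  have hr0 : 0 < r := hρ0.trans hρr
  have hgeo : Summable fun n : ℕ => (n : ℝ) * (ρ / r) ^ n := by
    have := summable_pow_mul_geometric_of_norm_lt_one 1 (r := ρ / r)
      (by rw [Real.norm_of_nonneg (by positivity)]; exact (div_lt_one hr0).2 hρr)
    simpa using this
  obtain ⟨C, hC⟩ := hgeo.tendsto_atTop_zero.bddAbove_range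
  -- the factor `n` of the derivative is absorbed by passing from `ρ` to `r`
  have hCn : ∀ n : ℕ, (n : ℝ) * ρ ^ n ≤ C * r ^ n := fun n => by
    have h := hC ⟨n, rfl⟩
    simp only [div_pow] at h
    rw [← mul_div_assoc, div_le_iff₀ (by positivity)] at h
    exact h
  have hu : Summable fun n : ℕ => |c n| * (n * ρ ^ (n - 1)) := by
    refine Summable.of_nonneg_of_le (fun n => by positivity) (fun n => ?_) (hc.mul_left (C / ρ))
    have h1 : (n : ℝ) * ρ ^ (n - 1) = n * ρ ^ n / ρ := by
      rcases n with _ | n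
      · simp
      · simp only [Nat.add_sub_cancel, pow_succ]; field_simp
    rw [h1, show C / ρ * (|c n| * r ^ n) = |c n| * (C * r ^ n / ρ) by ring]
    exact mul_le_mul_of_nonneg_left (div_le_div_of_nonneg_right (hCn n) hρ0.le) (abs_nonneg _)
  have hg' : ∀ (n : ℕ) (y : ℝ), y ∈ Metric.ball (0 : ℝ) ρ →
      ‖c n * (n * y ^ (n - 1))‖ ≤ |c n| * (n * ρ ^ (n - 1)) := fun n y hy => by
    rw [mem_ball_zero_iff, Real.norm_eq_abs] at hy
    rw [norm_mul, norm_mul, norm_pow, Real.norm_eq_abs, Real.norm_eq_abs, Real.norm_eq_abs,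
      abs_of_nonneg (Nat.cast_nonneg n : (0 : ℝ) ≤ n)]
    gcongr
  have hzb : z ∈ Metric.ball (0 : ℝ) ρ := by rwa [mem_ball_zero_iff, Real.norm_eq_abs]
  have key := hasDerivAt_tsum_of_isPreconnected (g := fun n (y : ℝ) => c n * y ^ n) hu
    Metric.isOpen_ball (convex_ball (0 : ℝ) ρ).isPreconnected
    (fun n y _ => (hasDerivAt_pow n y).const_mul (c n)) hg' (Metric.mem_ball_self hρ0)
    (summable_of_ne_finset_zero (s := {0}) (by intro n hn; simp at hn; simp [hn])) hzb
  have hs : Summable fun n : ℕ => c n * (n * z ^ (n - 1)) :=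
    Summable.of_norm_bounded hu (fun n => hg' n z hzb)
  have hsa : Summable fun n : ℕ => |c n * (n * z ^ (n - 1))| :=
    Summable.of_nonneg_of_le (fun n => abs_nonneg _) (fun n => hg' n z hzb) hu
  refine ⟨?_, ?_⟩
  · rw [hs.tsum_eq_zero_add] at key
    refine key.congr_deriv ?_
    simp only [Nat.cast_zero, zero_mul, mul_zero, zero_add]
    exact tsum_congr fun n => by push_cast; ring
  · refine ((summable_nat_add_iff 1).2 hsa).congr fun n => ?_
    rw [← abs_pow, ← abs_mul]
    push_cast
    congr 1; ring

/-! ### Bessel functions in the squared variable -/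

/-- The entire function with `J₀(y) = j0 (y² / 4)`. -/
def j0 (w : ℝ) : ℝ := ∑' m : ℕ, (-1 : ℝ) ^ m / ((m.factorial : ℝ) * m.factorial) * w ^ m

/-- The entire function with `J₁(y) = (y / 2) * j1 (y² / 4)`. -/
def j1 (w : ℝ) : ℝ := ∑' m : ℕ, (-1 : ℝ) ^ m / ((m.factorial : ℝ) * (m + 1).factorial) * w ^ m

/-- The primitive `w ↦ w * j1 w` of `j0`. The critical weight and the value `q` are multiples of
values of this function. -/
def psi (w : ℝ) : ℝ := w * j1 w

theorem besselJ_zero_eq (y : ℝ) : besselJ 0 y = j0 (y ^ 2 / 4) := by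
  unfold besselJ j0
  refine tsum_congr fun m => ?_
  rw [show y ^ 2 / 4 = (y / 2) ^ 2 by ring, ← pow_mul]
  simp

theorem besselJ_one_eq (y : ℝ) : besselJ 1 y = y / 2 * j1 (y ^ 2 / 4) := by
  unfold besselJ j1
  rw [← tsum_mul_left]
  refine tsum_congr fun m => ?_
  rw [show y ^ 2 / 4 = (y / 2) ^ 2 by ring, ← pow_mul, pow_succ]
  ring

theorem summable_j0_abs (r : ℝ) (hr : 0 ≤ r) :
    Summable fun m : ℕ => |(-1 : ℝ) ^ m / ((m.factorial : ℝ) * m.factorial)| * r ^ m := by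
  refine Summable.of_nonneg_of_le (fun m => by positivity) (fun m => ?_)
    (Real.summable_pow_div_factorial r)
  have h1 : (1 : ℝ) ≤ m.factorial := by exact_mod_cast m.factorial_pos
  rw [abs_div, abs_pow, abs_neg, abs_one, one_pow, abs_of_pos (by positivity), div_mul_eq_mul_div,
    one_mul]
  gcongr
  nlinarith

theorem summable_j1_abs (r : ℝ) (hr : 0 ≤ r) :
    Summable fun m : ℕ => |(-1 : ℝ) ^ m / ((m.factorial : ℝ) * (m + 1).factorial)| * r ^ m := by
  refine Summable.of_nonneg_of_le (fun m => by positivity) (fun m => ?_)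
    (Real.summable_pow_div_factorial r)
  have h1 : (1 : ℝ) ≤ (m + 1).factorial := by exact_mod_cast (m + 1).factorial_pos
  have h2 : (1 : ℝ) ≤ m.factorial := by exact_mod_cast m.factorial_pos
  rw [abs_div, abs_pow, abs_neg, abs_one, one_pow, abs_of_pos (by positivity), div_mul_eq_mul_div,
    one_mul]
  gcongr
  nlinarith

theorem hasDerivAt_j0 (w : ℝ) : HasDerivAt j0 (-j1 w) w := by
  have h := (hasDerivAt_powerSeries (summable_j0_abs (|w| + 1) (by positivity))
    (lt_add_one |w|)).1
  refine h.congr_deriv ?_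
  unfold j1
  rw [← tsum_neg]
  refine tsum_congr fun m => ?_
  have := m.factorial_pos
  rw [Nat.factorial_succ]
  push_cast
  field_simp
  ring

theorem continuous_j0 : Continuous j0 :=
  continuous_iff_continuousAt.2 fun w => (hasDerivAt_j0 w).continuousAt

theorem differentiable_j1 : Differentiable ℝ j1 := fun w =>
  (hasDerivAt_powerSeries (summable_j1_abs (|w| + 1) (by positivity))
    (lt_add_one |w|)).1.differentiableAt

theorem hasDerivAt_psi (w : ℝ) : HasDerivAt psi (j0 w) w := by
  -- the power series of `psi`: the coefficients of `j1`, shifted by one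
  let d : ℕ → ℝ := fun n => if n = 0 then 0 else
    (-1 : ℝ) ^ (n - 1) / (((n - 1).factorial : ℝ) * n.factorial)
  have hpsi : ∀ w, psi w = ∑' n, d n * w ^ n := fun w => by
    have hs : Summable fun n => d n * w ^ n := by
      refine (summable_nat_add_iff 1).1 ?_
      refine Summable.of_norm_bounded ((summable_j1_abs |w| (abs_nonneg w)).mul_left |w|)
        fun n => ?_
      simp only [d, Nat.succ_ne_zero, if_false, Nat.add_sub_cancel, Real.norm_eq_abs, abs_mul,
        abs_pow, pow_succ]
      exact le_of_eq (by ring)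
    rw [hs.tsum_eq_zero_add]
    unfold psi j1
    rw [← tsum_mul_left]
    simp only [d, if_true, zero_mul, zero_add]
    refine tsum_congr fun n => ?_
    simp only [Nat.succ_ne_zero, if_false, Nat.add_sub_cancel, pow_succ]
    ring
  have hd : Summable fun n => |d n| * (|w| + 1) ^ n := by
    refine (summable_nat_add_iff 1).1 ?_
    refine ((summable_j1_abs (|w| + 1) (by positivity)).mul_left (|w| + 1)).congr fun n => ?_
    simp only [d, Nat.succ_ne_zero, if_false, Nat.add_sub_cancel, pow_succ]
    ring
  have h := (hasDerivAt_powerSeries hd (lt_add_one |w|)).1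
  rw [show psi = fun w => ∑' n, d n * w ^ n from funext hpsi]
  refine h.congr_deriv ?_
  unfold j0
  refine tsum_congr fun m => ?_
  have := m.factorial_pos
  simp only [d, Nat.succ_ne_zero, if_false, Nat.add_sub_cancel, Nat.factorial_succ]
  push_cast
  field_simp

/-! ### The first zero of `J₀` -/

/-- The first positive zero of `j0`. -/
def w0 : ℝ := c0 ^ 2 / 4

theorem j0_zero : j0 0 = 1 := by
  unfold j0
  rw [tsum_eq_single 0 (by intro n hn; simp [hn])]
  simp

/-- The first four terms of the series at `2` sum to `-2/9`, and the others are dominated by a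
geometric series of sum `1/18`. Hence `J₀` has a positive zero. -/
theorem j0_two_neg : j0 2 < 0 := by
  have hs : Summable fun m : ℕ => (-1 : ℝ) ^ m / ((m.factorial : ℝ) * m.factorial) * 2 ^ m := by
    refine Summable.of_norm_bounded (summable_j0_abs 2 (by norm_num)) fun n => ?_
    rw [norm_mul, norm_pow, Real.norm_eq_abs, Real.norm_of_nonneg zero_le_two]
  have hb : ∀ m : ℕ, ‖(-1 : ℝ) ^ (m + 4) / (((m + 4).factorial : ℝ) * (m + 4).factorial) *
      2 ^ (m + 4)‖ ≤ (1 / 36) * (1 / 2) ^ m := fun m => by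
    rw [norm_mul, norm_div, norm_pow, norm_pow, norm_neg, norm_one, one_pow, norm_mul,
      Real.norm_of_nonneg (Nat.cast_nonneg _), Real.norm_of_nonneg (by norm_num : (0 : ℝ) ≤ 2)]
    have h1 : (24 : ℝ) * 5 ^ m ≤ (m + 4).factorial := by
      have := @Nat.factorial_mul_pow_le_factorial 4 m
      rw [add_comm]
      exact_mod_cast this
    have h2 : (24 * 24 : ℝ) * 4 ^ m ≤ (m + 4).factorial * (m + 4).factorial := by
      have h5 : (4 : ℝ) ^ m ≤ 5 ^ m * 5 ^ m := by
        rw [← mul_pow]; gcongr; norm_num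
      calc (24 * 24 : ℝ) * 4 ^ m ≤ (24 * 5 ^ m) * (24 * 5 ^ m) := by nlinarith
        _ ≤ _ := by gcongr
    rw [div_mul_eq_mul_div, one_mul, div_le_iff₀ (by positivity)]
    calc (2 : ℝ) ^ (m + 4) = (1 / 36) * (1 / 2) ^ m * ((24 * 24) * 4 ^ m) := by
          rw [show (4 : ℝ) = 2 * 2 by norm_num, mul_pow, one_div_pow]; field_simp; ring
      _ ≤ _ := by gcongr
  have htail : ∑' m : ℕ, (-1 : ℝ) ^ (m + 4) / (((m + 4).factorial : ℝ) * (m + 4).factorial) *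
      2 ^ (m + 4) ≤ 1 / 18 := by
    have := tsum_of_norm_bounded ((hasSum_geometric_two).mul_left (1 / 36)) hb
    refine (le_abs_self _).trans (this.trans ?_)
    norm_num
  have h := hs.sum_add_tsum_nat_add 4
  have hj : j0 2 = ∑' m : ℕ, (-1 : ℝ) ^ m / ((m.factorial : ℝ) * m.factorial) * 2 ^ m := rfl
  rw [hj, ← h]
  have : ∑ m ∈ Finset.range 4, (-1 : ℝ) ^ m / ((m.factorial : ℝ) * m.factorial) * 2 ^ m
      = - 2 / 9 := by
    simp [Finset.sum_range_succ, Nat.factorial]; norm_num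
  rw [this]
  linarith

theorem besselZero_nonempty : {x : ℝ | 0 < x ∧ besselJ 0 x = 0}.Nonempty := by
  have h := intermediate_value_Icc' (show (0 : ℝ) ≤ 2 by norm_num) continuous_j0.continuousOn
  obtain ⟨w, hw, hw0⟩ := h ⟨j0_two_neg.le, by rw [j0_zero]; exact zero_le_one⟩
  have hwpos : 0 < w := by
    rcases hw.1.lt_or_eq with h | h
    · exact h
    · rw [← h, j0_zero] at hw0; exact absurd hw0 one_ne_zero
  refine ⟨2 * Real.sqrt w, by positivity, ?_⟩
  rw [besselJ_zero_eq, mul_pow, Real.sq_sqrt hwpos.le]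
  rw [show (2 : ℝ) ^ 2 * w / 4 = w by ring, hw0]

/-- The infimum defining `c0` is attained: the zero set is closed, and `J₀ 0 = 1` keeps it away
from `0`. -/
theorem c0_mem : 0 < c0 ∧ besselJ 0 c0 = 0 := by
  have hbdd : BddBelow {x : ℝ | 0 < x ∧ besselJ 0 x = 0} := ⟨0, fun x hx => hx.1.le⟩
  have hcont : Continuous fun x => besselJ 0 x := by
    simp_rw [besselJ_zero_eq]
    exact continuous_j0.comp (by fun_prop)
  have hzero : ∀ x ∈ closure {x : ℝ | 0 < x ∧ besselJ 0 x = 0}, besselJ 0 x = 0 :=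
    closure_minimal (fun x hx => hx.2) (isClosed_eq hcont continuous_const)
  have h0 := hzero c0 (csInf_mem_closure besselZero_nonempty hbdd)
  refine ⟨lt_of_le_of_ne (le_csInf besselZero_nonempty fun x hx => hx.1.le) ?_, h0⟩
  intro h
  rw [← h, besselJ_zero_eq] at h0
  norm_num [j0_zero] at h0

theorem c0_pos : 0 < c0 := c0_mem.1

theorem w0_pos : 0 < w0 := by have := c0_pos; unfold w0; positivity

theorem j0_w0 : j0 w0 = 0 := by
  rw [w0, ← besselJ_zero_eq]; exact c0_mem.2

theorem j0_pos {w : ℝ} (h0 : 0 ≤ w) (h1 : w < w0) : 0 < j0 w := by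
  by_contra! hneg
  have h := intermediate_value_Icc' h0 continuous_j0.continuousOn
  obtain ⟨v, hv, hv0⟩ := h ⟨hneg, by rw [j0_zero]; exact zero_le_one⟩
  have hvpos : 0 < v := by
    rcases hv.1.lt_or_eq with h | h
    · exact h
    · rw [← h, j0_zero] at hv0; exact absurd hv0 one_ne_zero
  have hle : c0 ≤ 2 * Real.sqrt v := by
    refine csInf_le ⟨0, fun x hx => hx.1.le⟩ ⟨by positivity, ?_⟩
    rw [besselJ_zero_eq, mul_pow, Real.sq_sqrt hvpos.le,
      show (2 : ℝ) ^ 2 * v / 4 = v by ring, hv0]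
  have hvw : v < w0 := hv.2.trans_lt h1
  have : c0 ^ 2 ≤ (2 * Real.sqrt v) ^ 2 := by
    have := c0_pos; gcongr
  rw [mul_pow, Real.sq_sqrt hvpos.le] at this
  unfold w0 at hvw
  linarith

theorem continuous_psi : Continuous psi :=
  continuous_iff_continuousAt.2 fun w => (hasDerivAt_psi w).continuousAt

theorem psi_zero : psi 0 = 0 := by simp [psi]

theorem psi_strictMonoOn : StrictMonoOn psi (Set.Icc 0 w0) := by
  refine strictMonoOn_of_deriv_pos (convex_Icc _ _) continuous_psi.continuousOn fun w hw => ?_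
  rw [interior_Icc] at hw
  rw [(hasDerivAt_psi w).deriv]
  exact j0_pos hw.1.le hw.2

theorem psi_pos {w : ℝ} (h0 : 0 < w) (h1 : w ≤ w0) : 0 < psi w := by
  have := psi_strictMonoOn ⟨le_rfl, w0_pos.le⟩ ⟨h0.le, h1⟩ h0
  rwa [psi_zero] at this

theorem j1_nonneg {w : ℝ} (h0 : 0 ≤ w) (h1 : w ≤ w0) : 0 ≤ j1 w := by
  rcases h0.lt_or_eq with h | h
  · have := psi_pos h h1
    unfold psi at this
    exact (pos_of_mul_pos_right this h.le).le
  · rw [← h]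
    unfold j1
    rw [tsum_eq_single 0 (by intro n hn; simp [hn])]
    simp

/-- Every value in `[0, ψ(w₀)]` is attained by `ψ` on `[0, w₀]`. -/
theorem exists_psi_eq {v : ℝ} (h0 : 0 ≤ v) (h1 : v ≤ psi w0) :
    ∃ w, 0 ≤ w ∧ w ≤ w0 ∧ psi w = v := by
  obtain ⟨w, hw, h⟩ := intermediate_value_Icc w0_pos.le continuous_psi.continuousOn
    ⟨by rwa [psi_zero], h1⟩
  exact ⟨w, hw.1, hw.2, h⟩

theorem xc_eq : xc = psi w0 / Real.pi ^ 2 := by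
  unfold xc psi
  rw [besselJ_one_eq]
  have := Real.pi_pos
  unfold w0
  field_simp
  ring

theorem xc_pos : 0 < xc := by
  rw [xc_eq]
  have := psi_pos w0_pos le_rfl
  have := Real.pi_pos
  positivity

/-! ### Integration over strips of the quadrant -/

/-- The strip `a < s + t < b` of the open positive quadrant. In the coordinates `s = π - β`,
`t = π - α`, the conditions on the angles `(α, β)` of a cubic vertex define such strips. -/
def tri (a b : ℝ) : Set (ℝ × ℝ) := {p | 0 < p.1 ∧ 0 < p.2 ∧ a < p.1 + p.2 ∧ p.1 + p.2 < b}

theorem measurableSet_tri (a b : ℝ) : MeasurableSet (tri a b) := by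
  unfold tri; measurability

theorem tri_subset (a b : ℝ) : tri a b ⊆ Set.Icc 0 b ×ˢ Set.Icc 0 b := by
  rintro ⟨s, t⟩ ⟨h1, h2, h3, h4⟩
  simp only at h1 h2 h3 h4
  exact ⟨⟨h1.le, by simp only; linarith⟩, ⟨h2.le, by simp only; linarith⟩⟩

theorem volume_tri_lt_top (a b : ℝ) : volume (tri a b) < ⊤ :=
  (measure_mono (tri_subset a b)).trans_lt (isCompact_Icc.prod isCompact_Icc).measure_lt_top

theorem tri_self (a : ℝ) : tri a a = ∅ := by
  ext p
  simp only [tri, Set.mem_ofPred_eq, Set.mem_empty_iff_false, iff_false]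
  rintro ⟨-, -, h1, h2⟩
  exact lt_asymm h1 h2

theorem volume_line (c : ℝ) : volume {p : ℝ × ℝ | p.1 + p.2 = c} = 0 := by
  have hm : MeasurableSet {p : ℝ × ℝ | p.1 + p.2 = c} :=
    measurableSet_eq_fun (by fun_prop) measurable_const
  rw [Measure.volume_eq_prod, Measure.measure_prod_null hm]
  refine Filter.Eventually.of_forall fun s => ?_
  have : Prod.mk s ⁻¹' {p : ℝ × ℝ | p.1 + p.2 = c} = {c - s} := by
    ext t
    simp only [Set.mem_preimage, Set.mem_ofPred_eq, Set.mem_singleton_iff]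
    constructor <;> intro h <;> linarith
  simp [this]

/-- The lower edge of a strip is negligible. -/
theorem restrict_tri_closed (a b : ℝ) :
    volume.restrict {p : ℝ × ℝ | 0 < p.1 ∧ 0 < p.2 ∧ a ≤ p.1 + p.2 ∧ p.1 + p.2 < b} =
      volume.restrict (tri a b) := by
  refine Measure.restrict_congr_set ?_
  have h : ∀ᵐ p : ℝ × ℝ, p.1 + p.2 ≠ a := by
    rw [ae_iff]; simpa using volume_line a
  filter_upwards [h] with p hp
  refine propext ⟨fun ⟨h1, h2, h3, h4⟩ => ⟨h1, h2, lt_of_le_of_ne h3 hp.symm, h4⟩,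
    fun ⟨h1, h2, h3, h4⟩ => ⟨h1, h2, h3.le, h4⟩⟩

theorem restrict_tri_add {a b c : ℝ} (hab : a ≤ b) (hbc : b ≤ c) :
    volume.restrict (tri a c) = volume.restrict (tri a b) + volume.restrict (tri b c) := by
  rcases hab.lt_or_eq with hab | rfl
  swap
  · rw [tri_self, Measure.restrict_empty, zero_add]
  rw [← restrict_tri_closed b c, ← Measure.restrict_union]
  · refine congrArg _ (Set.ext fun p => ?_)
    simp only [tri, Set.mem_union, Set.mem_ofPred_eq]
    constructor
    · rintro ⟨h1, h2, h3, h4⟩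
      rcases lt_or_ge (p.1 + p.2) b with h | h
      · exact Or.inl ⟨h1, h2, h3, h⟩
      · exact Or.inr ⟨h1, h2, h, h4⟩
    · rintro (⟨h1, h2, h3, h4⟩ | ⟨h1, h2, h3, h4⟩)
      · exact ⟨h1, h2, h3, h4.trans_le hbc⟩
      · exact ⟨h1, h2, hab.trans_le h3, h4⟩
  · rw [Set.disjoint_left]
    rintro p ⟨-, -, -, h1⟩ ⟨-, -, h2, -⟩
    exact absurd h1 (not_lt.2 h2)
  · measurability

/-- The part of the strip `a + L < s + t < 2 L` in which neither coordinate exceeds `L`. -/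
def core (L a : ℝ) : Set (ℝ × ℝ) := tri (a + L) (2 * L) ∩ {p | p.1 ≤ L ∧ p.2 ≤ L}

theorem measurableSet_core (L a : ℝ) : MeasurableSet (core L a) :=
  (measurableSet_tri _ _).inter (by measurability)

/-- In the strip `a + L < s + t < 2 L` at most one of the coordinates exceeds `L`. The two parts
where one of them does are translates of the strip `a < s + t < L`. -/
theorem restrict_tri_shift (L a : ℝ) :
    volume.restrict (tri (a + L) (2 * L)) = volume.restrict (core L a) +
      ((volume.restrict (tri a L)).map (fun p => (p.1, p.2 + L)) +
        (volume.restrict (tri a L)).map (fun p => (p.1 + L, p.2))) := by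
  have hm1 : MeasurableSet (tri (a + L) (2 * L) ∩ {p | L < p.2}) :=
    (measurableSet_tri _ _).inter (by measurability)
  have hm2 : MeasurableSet (tri (a + L) (2 * L) ∩ {p | L < p.1}) :=
    (measurableSet_tri _ _).inter (by measurability)
  have hp1 : MeasurePreserving (fun p : ℝ × ℝ => (p.1, p.2 + L)) volume volume :=
    (MeasurePreserving.id volume).prod (measurePreserving_add_right volume L)
  have hp2 : MeasurePreserving (fun p : ℝ × ℝ => (p.1 + L, p.2)) volume volume :=
    (measurePreserving_add_right volume L).prod (MeasurePreserving.id volume)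
  have e1 := (hp1.restrict_preimage hm1).map_eq
  have e2 := (hp2.restrict_preimage hm2).map_eq
  have s1 : (fun p : ℝ × ℝ => (p.1, p.2 + L)) ⁻¹' (tri (a + L) (2 * L) ∩ {p | L < p.2})
      = tri a L := by
    ext p
    simp only [tri, Set.mem_preimage, Set.mem_inter_iff, Set.mem_ofPred_eq]
    constructor
    · rintro ⟨⟨h1, h2, h3, h4⟩, h5⟩
      exact ⟨h1, by linarith, by linarith, by linarith⟩
    · rintro ⟨h1, h2, h3, h4⟩
      exact ⟨⟨h1, by linarith, by linarith, by linarith⟩, by linarith⟩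
  have s2 : (fun p : ℝ × ℝ => (p.1 + L, p.2)) ⁻¹' (tri (a + L) (2 * L) ∩ {p | L < p.1})
      = tri a L := by
    ext p
    simp only [tri, Set.mem_preimage, Set.mem_inter_iff, Set.mem_ofPred_eq]
    constructor
    · rintro ⟨⟨h1, h2, h3, h4⟩, h5⟩
      exact ⟨by linarith, h2, by linarith, by linarith⟩
    · rintro ⟨h1, h2, h3, h4⟩
      exact ⟨⟨by linarith, h2, by linarith, by linarith⟩, by linarith⟩
  rw [s1] at e1
  rw [s2] at e2
  rw [e1, e2, ← Measure.restrict_union _ hm2, ← Measure.restrict_union _ (hm1.union hm2)]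
  · refine congrArg _ (Set.ext fun p => ?_)
    simp only [core, Set.mem_union, Set.mem_inter_iff, Set.mem_ofPred_eq]
    constructor
    · intro h
      by_cases h2 : L < p.2
      · exact Or.inr (Or.inl ⟨h, h2⟩)
      · by_cases h1 : L < p.1
        · exact Or.inr (Or.inr ⟨h, h1⟩)
        · exact Or.inl ⟨h, not_lt.1 h1, not_lt.1 h2⟩
    · rintro (h | h | h) <;> exact h.1
  · rw [Set.disjoint_left]
    rintro p ⟨-, h1, h2⟩ (⟨-, h3⟩ | ⟨-, h3⟩)
    · exact absurd h3 (not_lt.2 h2)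
    · exact absurd h3 (not_lt.2 h1)
  · rw [Set.disjoint_left]
    rintro p ⟨⟨-, -, -, h4⟩, h1⟩ ⟨-, h2⟩
    simp only [Set.mem_ofPred_eq] at h1 h2
    linarith

theorem integral_pow_mul_sub_pow (θ : ℝ) (a b : ℕ) :
    ∫ s in (0 : ℝ)..θ, s ^ a * (θ - s) ^ b =
      (a.factorial * b.factorial : ℝ) / (a + b + 1).factorial * θ ^ (a + b + 1) := by
  induction a generalizing b with
  | zero =>
    simp only [pow_zero, one_mul, zero_add]
    rw [intervalIntegral.integral_comp_sub_left (fun x => x ^ b) θ, integral_pow]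
    have := b.factorial_pos
    rw [Nat.factorial_succ]
    push_cast
    simp
    field_simp
  | succ a ih =>
    have hibp := intervalIntegral.integral_mul_deriv_eq_deriv_mul (a := 0) (b := θ)
      (u := fun s => s ^ (a + 1)) (u' := fun s => (a + 1 : ℝ) * s ^ a)
      (v := fun s => -((θ - s) ^ (b + 1) / (b + 1))) (v' := fun s => (θ - s) ^ b)
      (fun s _ => by
        have := hasDerivAt_pow (a + 1) s
        simpa using this)
      (fun s _ => by
        have h1 : HasDerivAt (fun s => θ - s) (-1) s := by
          simpa using (hasDerivAt_id s).const_sub θ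
        have h2 := ((h1.pow (b + 1)).div_const ((b : ℝ) + 1)).neg
        refine h2.congr_deriv ?_
        have : (b : ℝ) + 1 ≠ 0 := by positivity
        push_cast
        simp
        field_simp)
      (Continuous.intervalIntegrable (by fun_prop) _ _)
      (Continuous.intervalIntegrable (by fun_prop) _ _)
    rw [hibp]
    have e : ∀ s : ℝ, (a + 1 : ℝ) * s ^ a * -((θ - s) ^ (b + 1) / (b + 1)) =
        (-((a + 1 : ℝ) / (b + 1))) * (s ^ a * (θ - s) ^ (b + 1)) := fun s => by ring
    simp_rw [e]
    rw [intervalIntegral.integral_const_mul, ih (b + 1)]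
    rw [show a + 1 + b + 1 = a + (b + 1) + 1 by ring, Nat.factorial_succ a, Nat.factorial_succ b]
    have := (a + (b + 1) + 1).factorial_pos
    push_cast
    simp
    field_simp

/-- Dirichlet's integral over a triangle. -/
theorem integral_tri_monomial {θ : ℝ} (hθ : 0 ≤ θ) (a b : ℕ) :
    ∫ p in tri 0 θ, p.1 ^ a * p.2 ^ b =
      (a.factorial * b.factorial : ℝ) / (a + b + 2).factorial * θ ^ (a + b + 2) := by
  have hint : Integrable ((tri 0 θ).indicator fun p : ℝ × ℝ => p.1 ^ a * p.2 ^ b) := by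
    rw [integrable_indicator_iff (measurableSet_tri _ _)]
    exact ((Continuous.continuousOn (by fun_prop)).integrableOn_compact
      (isCompact_Icc.prod isCompact_Icc)).mono_set (tri_subset 0 θ)
  rw [← integral_indicator (measurableSet_tri _ _), Measure.volume_eq_prod,
    integral_prod _ hint]
  have inner : ∀ s : ℝ, ∫ t, (tri 0 θ).indicator (fun p : ℝ × ℝ => p.1 ^ a * p.2 ^ b) (s, t) =
      (Set.Ioc 0 θ).indicator (fun s => s ^ a * (θ - s) ^ (b + 1) / (b + 1)) s := fun s => by
    by_cases hs : s ∈ Set.Ioc 0 θ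
    · rw [Set.indicator_of_mem hs]
      have : ∀ t, (tri 0 θ).indicator (fun p : ℝ × ℝ => p.1 ^ a * p.2 ^ b) (s, t) =
          (Set.Ioo 0 (θ - s)).indicator (fun t => s ^ a * t ^ b) t := fun t => by
        by_cases ht : t ∈ Set.Ioo 0 (θ - s)
        · rw [Set.indicator_of_mem ht, Set.indicator_of_mem]
          have := ht.1; have := ht.2; have := hs.1
          exact ⟨hs.1, ht.1, by simp only; linarith, by simp only; linarith⟩
        · rw [Set.indicator_of_notMem ht, Set.indicator_of_notMem]
          rintro ⟨h1, h2, h3, h4⟩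
          exact ht ⟨h2, by simp only at h4; linarith⟩
      simp_rw [this]
      rw [integral_indicator measurableSet_Ioo, ← integral_Ioc_eq_integral_Ioo,
        ← intervalIntegral.integral_of_le (by linarith [hs.2]),
        intervalIntegral.integral_const_mul, integral_pow]
      simp
      ring
    · rw [Set.indicator_of_notMem hs]
      have : ∀ t, (tri 0 θ).indicator (fun p : ℝ × ℝ => p.1 ^ a * p.2 ^ b) (s, t) = 0 := by
        intro t
        rw [Set.indicator_of_notMem]
        rintro ⟨h1, h2, h3, h4⟩
        simp only at h1 h2 h3 h4
        exact hs ⟨h1, by linarith⟩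
      simp [this]
  simp_rw [inner]
  rw [integral_indicator measurableSet_Ioc, ← intervalIntegral.integral_of_le hθ,
    intervalIntegral.integral_div, integral_pow_mul_sub_pow]
  have := (a + (b + 1) + 1).factorial_pos
  rw [Nat.factorial_succ b, show a + b + 2 = a + (b + 1) + 1 by ring]
  push_cast
  field_simp

/-! ### The Bessel solution of the convolution equation -/

/-- `besselSol A θ = A * j1 (A θ²)`: the candidate for the generating function at angle `θ`,
parametrised by its value `A` at `θ = 0`. -/
def besselSol (A θ : ℝ) : ℝ := A * j1 (A * θ ^ 2)

theorem continuous_besselSol (A : ℝ) : Continuous (besselSol A) := by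
  unfold besselSol
  have := differentiable_j1.continuous
  fun_prop

theorem besselSol_zero (A : ℝ) : besselSol A 0 = A := by
  unfold besselSol j1
  rw [tsum_eq_single 0 (by intro n hn; simp [hn])]
  simp

theorem besselSol_mul_sq (A θ : ℝ) : besselSol A θ * θ ^ 2 = psi (A * θ ^ 2) := by
  unfold besselSol psi; ring

theorem besselSol_nonneg {A θ L : ℝ} (hA : 0 ≤ A) (hθ : 0 ≤ θ) (hL : θ ≤ L) (h : A * L ^ 2 ≤ w0) :
    0 ≤ besselSol A θ := by
  refine mul_nonneg hA (j1_nonneg (by positivity) (le_trans ?_ h))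
  gcongr

/-- The Taylor coefficients of `besselSol A` are signed Catalan numbers over factorials. -/
theorem hasSum_besselSol (A θ : ℝ) :
    HasSum (fun m : ℕ => (-1 : ℝ) ^ m * A ^ (m + 1) * catalan m / (2 * m).factorial * θ ^ (2 * m))
      (besselSol A θ) := by
  have hs : Summable fun m : ℕ => (-1 : ℝ) ^ m / ((m.factorial : ℝ) * (m + 1).factorial) *
      (A * θ ^ 2) ^ m := by
    refine Summable.of_norm_bounded (summable_j1_abs |A * θ ^ 2| (abs_nonneg _)) fun n => ?_
    rw [norm_mul, norm_pow, Real.norm_eq_abs, Real.norm_eq_abs]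
  have h := hs.hasSum.mul_left A
  have e : ∀ m : ℕ, A * ((-1 : ℝ) ^ m / ((m.factorial : ℝ) * (m + 1).factorial) *
      (A * θ ^ 2) ^ m) =
      (-1 : ℝ) ^ m * A ^ (m + 1) * catalan m / (2 * m).factorial * θ ^ (2 * m) := fun m => by
    have h1 : ((m : ℝ) + 1) * catalan m * (m.factorial * m.factorial) = (2 * m).factorial := by
      have h2 := succ_mul_catalan_eq_centralBinom m
      have h3 := Nat.choose_mul_factorial_mul_factorial (show m ≤ 2 * m by omega)
      rw [← Nat.centralBinom_eq_two_mul_choose, ← h2, show 2 * m - m = m by omega] at h3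
      rw [← h3]; push_cast; ring
    have := m.factorial_pos
    have hc : (catalan m : ℝ) ≠ 0 := by
      intro h0
      rw [h0] at h1
      have := (2 * m).factorial_pos
      simp at h1
      exact absurd h1.symm (by positivity)
    rw [← h1, Nat.factorial_succ]
    push_cast
    field_simp
    ring
  simp_rw [e] at h
  exact h

theorem integrableOn_tri_of_continuous {g : ℝ × ℝ → ℝ} (hg : Continuous g) (a b : ℝ) :
    IntegrableOn g (tri a b) :=
  (hg.continuousOn.integrableOn_compact (isCompact_Icc.prod isCompact_Icc)).mono_set
    (tri_subset a b)

/-- The convolution equation `f(θ) + ∫∫_{s+t<θ} f(s) f(t) = A` for `f = besselSol A`. Comparing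
Taylor coefficients, it is the recursion of the Catalan numbers. -/
theorem integral_besselSol_mul (A : ℝ) {θ : ℝ} (hθ : 0 ≤ θ) :
    ∫ p in tri 0 θ, besselSol A p.1 * besselSol A p.2 = A - besselSol A θ := by
  let a : ℕ → ℝ := fun m => (-1 : ℝ) ^ m * A ^ (m + 1) * catalan m / (2 * m).factorial
  have ha : ∀ s, HasSum (fun m => a m * s ^ (2 * m)) (besselSol A s) := hasSum_besselSol A
  have hsn : ∀ s, Summable fun m => ‖a m * s ^ (2 * m)‖ := fun s => (ha s).summable.norm
  let F : ℕ × ℕ → ℝ × ℝ → ℝ := fun ij p => (a ij.1 * a ij.2) * (p.1 ^ (2 * ij.1) * p.2 ^ (2 * ij.2))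
  have hFc : ∀ ij, Continuous (F ij) := fun ij => by simp only [F]; fun_prop
  have hFi : ∀ ij, IntegrableOn (F ij) (tri 0 θ) := fun ij =>
    integrableOn_tri_of_continuous (hFc ij) 0 θ
  have hFsum : Summable fun ij => ∫ p in tri 0 θ, ‖F ij p‖ := by
    have hprod := ((hsn θ).mul_of_nonneg (hsn θ) (fun _ => norm_nonneg _)
      (fun _ => norm_nonneg _)).mul_right (volume.real (tri 0 θ))
    refine Summable.of_nonneg_of_le (fun ij => integral_nonneg fun _ => norm_nonneg _)
      (fun ij => ?_) hprod
    have hb : ∀ p ∈ tri 0 θ, ‖(‖F ij p‖)‖ ≤ ‖a ij.1 * θ ^ (2 * ij.1)‖ * ‖a ij.2 * θ ^ (2 * ij.2)‖ := by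
      intro p hp
      have hp' := tri_subset _ _ hp
      have h1 : |p.1| ≤ |θ| := abs_le_abs_of_nonneg hp'.1.1 hp'.1.2
      have h2 : |p.2| ≤ |θ| := abs_le_abs_of_nonneg hp'.2.1 hp'.2.2
      simp only [F, norm_mul, norm_pow, Real.norm_eq_abs, abs_abs]
      calc |a ij.1| * |a ij.2| * (|p.1| ^ (2 * ij.1) * |p.2| ^ (2 * ij.2))
          ≤ |a ij.1| * |a ij.2| * (|θ| ^ (2 * ij.1) * |θ| ^ (2 * ij.2)) := by gcongr
        _ = _ := by ring
    have := norm_setIntegral_le_of_norm_le_const (volume_tri_lt_top 0 θ) hb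
    exact (le_abs_self _).trans this
  have key := hasSum_integral_of_summable_integral_norm hFi hFsum
  have hFtsum : ∀ p : ℝ × ℝ, ∑' ij, F ij p = besselSol A p.1 * besselSol A p.2 := fun p => by
    rw [← (ha p.1).tsum_eq, ← (ha p.2).tsum_eq,
      tsum_mul_tsum_of_summable_norm (hsn p.1) (hsn p.2)]
    exact tsum_congr fun ij => by simp only [F]; ring
  simp_rw [hFtsum] at key
  have hanti := ((Equiv.hasSum_iff (sigmaAntidiagonalEquivProd (A := ℕ))).2 key).sigma
    (fun n => hasSum_fintype _)
  have hser := (hasSum_nat_add_iff' 1).2 (ha θ)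
  simp only [Finset.range_one, Finset.sum_singleton] at hser
  have hterm : ∀ n, -(a (n + 1) * θ ^ (2 * (n + 1))) =
      ∑ c : antidiagonal n, ((fun ij => ∫ p in tri 0 θ, F ij p) ∘
        sigmaAntidiagonalEquivProd) ⟨n, c⟩ := fun n => by
    have e1 : ∀ ij : ℕ × ℕ, ∫ p in tri 0 θ, F ij p = a ij.1 * a ij.2 *
        (((2 * ij.1).factorial * (2 * ij.2).factorial : ℝ) /
          (2 * ij.1 + 2 * ij.2 + 2).factorial * θ ^ (2 * ij.1 + 2 * ij.2 + 2)) := fun ij => by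
      simp only [F]
      rw [integral_const_mul, integral_tri_monomial hθ]
    simp only [Function.comp, sigmaAntidiagonalEquivProd_apply, e1]
    rw [Finset.sum_coe_sort (antidiagonal n) (fun ij : ℕ × ℕ => a ij.1 * a ij.2 *
        (((2 * ij.1).factorial * (2 * ij.2).factorial : ℝ) /
          (2 * ij.1 + 2 * ij.2 + 2).factorial * θ ^ (2 * ij.1 + 2 * ij.2 + 2)))]
    -- the beta integrals cancel the factorials, and the Catalan convolution remains
    have e2 : ∀ ij ∈ antidiagonal n, a ij.1 * a ij.2 *
        (((2 * ij.1).factorial * (2 * ij.2).factorial : ℝ) /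
          (2 * ij.1 + 2 * ij.2 + 2).factorial * θ ^ (2 * ij.1 + 2 * ij.2 + 2)) =
        (-1) ^ n * A ^ (n + 2) / (2 * n + 2).factorial * θ ^ (2 * n + 2) *
          ((catalan ij.1 * catalan ij.2 : ℕ) : ℝ) := fun ij hij => by
      rw [mem_antidiagonal] at hij
      have h1 := (2 * ij.1).factorial_pos
      have h2 := (2 * ij.2).factorial_pos
      rw [← hij, show 2 * ij.1 + 2 * ij.2 + 2 = 2 * (ij.1 + ij.2) + 2 by ring]
      have h3 := (2 * (ij.1 + ij.2) + 2).factorial_pos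
      simp only [a]
      push_cast
      field_simp
      ring
    rw [Finset.sum_congr rfl e2, ← Finset.mul_sum, ← Nat.cast_sum, ← catalan_succ']
    simp only [a]
    rw [show 2 * (n + 1) = 2 * n + 2 by ring]
    ring
  simp_rw [← hterm] at hanti
  have := hanti.unique hser.neg
  rw [this]
  simp [a]

/-- The convolution equation of `besselSol A` between two angles. -/
theorem integral_besselSol_mul_strip (A : ℝ) {a b : ℝ} (ha : 0 ≤ a) (hab : a ≤ b) :
    ∫ p in tri a b, besselSol A p.1 * besselSol A p.2 = besselSol A a - besselSol A b := by
  have hc : Continuous fun p : ℝ × ℝ => besselSol A p.1 * besselSol A p.2 := by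
    have := continuous_besselSol A
    fun_prop
  have h := integral_besselSol_mul A (ha.trans hab)
  rw [restrict_tri_add ha hab, integral_add_measure (integrableOn_tri_of_continuous hc _ _)
    (integrableOn_tri_of_continuous hc _ _), integral_besselSol_mul A ha] at h
  linarith

/-! ### The coefficients of the generating functions -/

/-- `coef L n θ` is the total volume of the trees with `n` leaves (besides the root leaf) at angle
`θ`, for the convolution recursion on the interval `[0, L]`. For `θ ≤ L` the recursion runs over
the strip `θ < s + t < L`. For `L < θ` it runs over `θ < s + t < 2 L` and there is no initial leaf;
with `L = π / 2` this describes the blobs without red leaf. -/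
def coef (L : ℝ) : ℕ → ℝ → ℝ≥0∞
  | 0, _ => 0
  | 1, θ => if θ ≤ L then 1 else 0
  | n + 2, θ => ∫⁻ p in tri θ (if θ ≤ L then L else 2 * L),
      ∑ i : Fin (n + 1), coef L (i + 1) p.1 * coef L (n + 1 - i) p.2
  decreasing_by all_goals omega

/-- The coefficients of the square of the generating function. -/
def coefConv (L : ℝ) (n : ℕ) (p : ℝ × ℝ) : ℝ≥0∞ :=
  ∑ ij ∈ antidiagonal n, coef L ij.1 p.1 * coef L ij.2 p.2

theorem coef_zero (L θ : ℝ) : coef L 0 θ = 0 := by rw [coef]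

theorem coef_one (L θ : ℝ) : coef L 1 θ = if θ ≤ L then 1 else 0 := by rw [coef]

theorem coefConv_zero (L : ℝ) (p : ℝ × ℝ) : coefConv L 0 p = 0 := by
  simp [coefConv, coef_zero]

theorem coefConv_one (L : ℝ) (p : ℝ × ℝ) : coefConv L 1 p = 0 := by
  simp [coefConv, coef_zero, Finset.Nat.antidiagonal_succ]

theorem coef_add_two (L : ℝ) (n : ℕ) (θ : ℝ) : coef L (n + 2) θ =
    ∫⁻ p in tri θ (if θ ≤ L then L else 2 * L), coefConv L (n + 2) p := by
  rw [coef]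
  refine lintegral_congr fun p => ?_
  rw [coefConv, Finset.Nat.sum_antidiagonal_succ, Finset.Nat.sum_antidiagonal_succ']
  rw [coef_zero, coef_zero, zero_mul, mul_zero, zero_add, zero_add,
    Finset.Nat.sum_antidiagonal_eq_sum_range_succ_mk, Finset.sum_range]
  refine Finset.sum_congr rfl fun i _ => ?_
  have : n + 1 - (i : ℕ) = n - i + 1 := by have := i.2; omega
  rw [this]

theorem measurable_coef (L : ℝ) (n : ℕ) : Measurable (coef L n) := by
  induction n using Nat.strong_induction_on with
  | _ n ih =>
    match n, ih with
    | 0, _ => simp_rw [funext (coef_zero L)]; exact measurable_const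
    | 1, _ =>
      rw [show coef L 1 = fun θ => if θ ≤ L then 1 else 0 from funext (coef_one L)]
      exact Measurable.ite measurableSet_Iic measurable_const measurable_const
    | n + 2, ih =>
      have hU : Measurable fun θ : ℝ => if θ ≤ L then L else 2 * L :=
        Measurable.ite measurableSet_Iic measurable_const measurable_const
      have hm : Measurable fun q : ℝ × (ℝ × ℝ) =>
          {q : ℝ × (ℝ × ℝ) | 0 < q.2.1 ∧ 0 < q.2.2 ∧ q.1 < q.2.1 + q.2.2 ∧
            q.2.1 + q.2.2 < if q.1 ≤ L then L else 2 * L}.indicator (fun q =>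
          ∑ i : Fin (n + 1), coef L (i + 1) q.2.1 * coef L (n + 1 - i) q.2.2) q := by
        refine Measurable.indicator ?_ ?_
        · refine Finset.measurable_sum _ fun i _ => ?_
          have h1 := ih (i + 1) (by omega)
          have h2 := ih (n + 1 - i) (by omega)
          fun_prop
        · have m1 : Measurable fun q : ℝ × (ℝ × ℝ) => q.2.1 := by fun_prop
          have m2 : Measurable fun q : ℝ × (ℝ × ℝ) => q.2.2 := by fun_prop
          exact (measurableSet_lt measurable_const m1).inter
            ((measurableSet_lt measurable_const m2).inter
            ((measurableSet_lt measurable_fst (m1.add m2)).inter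
              (measurableSet_lt (m1.add m2) (hU.comp measurable_fst))))
      have := hm.lintegral_prod_right' (ν := volume)
      convert this using 2 with θ
      rw [coef, ← lintegral_indicator (measurableSet_tri _ _)]
      rfl

theorem measurable_coefConv (L : ℝ) (n : ℕ) : Measurable (coefConv L n) := by
  unfold coefConv
  refine Finset.measurable_sum _ fun ij _ => ?_
  have h1 := measurable_coef L ij.1
  have h2 := measurable_coef L ij.2
  fun_prop

/-- The coefficients decrease in the angle. -/
theorem coef_antitone {L : ℝ} (n : ℕ) {a b : ℝ} (hab : a ≤ b) (hb : b ≤ L) :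
    coef L n b ≤ coef L n a := by
  match n with
  | 0 => simp [coef_zero]
  | 1 => simp [coef_one, hb, hab.trans hb]
  | n + 2 =>
    rw [coef_add_two, coef_add_two, if_pos hb, if_pos (hab.trans hb)]
    exact lintegral_mono_set fun p ⟨h1, h2, h3, h4⟩ => ⟨h1, h2, hab.trans_lt h3, h4⟩

/-! ### The generating functions -/

/-- The generating function `∑ₙ coef L n θ zⁿ`. -/
def gf (L : ℝ) (z : ℝ≥0∞) (θ : ℝ) : ℝ≥0∞ := ∑' n, coef L n θ * z ^ n

theorem measurable_gf (L : ℝ) (z : ℝ≥0∞) : Measurable (gf L z) :=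
  Measurable.tsum fun n => (measurable_coef L n).mul_const _

theorem gf_antitone {L : ℝ} (z : ℝ≥0∞) {a b : ℝ} (hab : a ≤ b) (hb : b ≤ L) :
    gf L z b ≤ gf L z a :=
  ENNReal.tsum_le_tsum fun n => by gcongr; exact coef_antitone n hab hb

/-- The Cauchy product formula in `ℝ≥0∞`. -/
theorem ennreal_tsum_mul_tsum (f g : ℕ → ℝ≥0∞) :
    (∑' n, f n) * ∑' n, g n = ∑' n, ∑ ij ∈ antidiagonal n, f ij.1 * g ij.2 := by
  rw [← ENNReal.tsum_mul_right]
  simp_rw [← ENNReal.tsum_mul_left]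
  rw [← ENNReal.tsum_prod (f := fun i j => f i * g j),
    ← (sigmaAntidiagonalEquivProd (A := ℕ)).tsum_eq (fun ij : ℕ × ℕ => f ij.1 * g ij.2),
    ENNReal.tsum_sigma']
  refine tsum_congr fun n => ?_
  rw [tsum_fintype]
  exact Finset.sum_coe_sort (antidiagonal n) fun ij : ℕ × ℕ => f ij.1 * g ij.2

theorem tsum_coefConv (L : ℝ) (z : ℝ≥0∞) (p : ℝ × ℝ) :
    ∑' n, coefConv L n p * z ^ n = gf L z p.1 * gf L z p.2 := by
  rw [gf, gf, ennreal_tsum_mul_tsum]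
  refine tsum_congr fun n => ?_
  rw [coefConv, Finset.sum_mul]
  refine Finset.sum_congr rfl fun ij hij => ?_
  rw [mem_antidiagonal] at hij
  rw [← hij, pow_add]; ring

/-- The partial sums of `gf`. -/
def gfPartial (L : ℝ) (z : ℝ≥0∞) (N : ℕ) (θ : ℝ) : ℝ≥0∞ :=
  ∑ n ∈ Finset.range N, coef L n θ * z ^ n

theorem measurable_gfPartial (L : ℝ) (z : ℝ≥0∞) (N : ℕ) : Measurable (gfPartial L z N) :=
  Finset.measurable_sum _ fun n _ => (measurable_coef L n).mul_const _

theorem gf_le_of_partial {L : ℝ} {z : ℝ≥0∞} {θ : ℝ} {b : ℝ≥0∞}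
    (h : ∀ N, gfPartial L z N θ ≤ b) : gf L z θ ≤ b := by
  rw [gf, ENNReal.tsum_eq_iSup_nat]
  exact iSup_le h

/-- Since `coef L 0 = 0`, the terms of total degree at most `N` of the square only involve the
coefficients of index less than `N`. -/
theorem sum_coefConv_le (L : ℝ) (z : ℝ≥0∞) (N : ℕ) (p : ℝ × ℝ) :
    ∑ n ∈ Finset.range (N + 1), coefConv L n p * z ^ n ≤
      gfPartial L z N p.1 * gfPartial L z N p.2 := by
  let F : ℕ × ℕ → ℝ≥0∞ := fun ij => (coef L ij.1 p.1 * z ^ ij.1) * (coef L ij.2 p.2 * z ^ ij.2)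
  let S := ((Finset.range N ×ˢ Finset.range N).filter fun ij => ij.1 + ij.2 ∈ Finset.range (N + 1))
  calc ∑ n ∈ Finset.range (N + 1), coefConv L n p * z ^ n
      ≤ ∑ n ∈ Finset.range (N + 1), ∑ ij ∈ S with ij.1 + ij.2 = n, F ij := by
        refine Finset.sum_le_sum fun n hn => ?_
        have e : coefConv L n p * z ^ n = ∑ ij ∈ antidiagonal n, F ij := by
          rw [coefConv, Finset.sum_mul]
          refine Finset.sum_congr rfl fun ij hij => ?_
          rw [mem_antidiagonal] at hij
          simp only [F]
          rw [← hij, pow_add]; ring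
        rw [e]
        refine Finset.sum_le_sum_of_ne_zero fun ij hij hne => ?_
        rw [mem_antidiagonal] at hij
        have h1 : ij.1 ≠ 0 := fun h => hne (by simp only [F]; rw [h, coef_zero]; simp)
        have h2 : ij.2 ≠ 0 := fun h => hne (by simp only [F]; rw [h, coef_zero]; simp)
        simp only [S, Finset.mem_filter, Finset.mem_product, Finset.mem_range] at hn ⊢
        omega
    _ = ∑ ij ∈ S, F ij :=
        Finset.sum_fiberwise_of_maps_to (fun ij hij => (Finset.mem_filter.1 hij).2) F
    _ ≤ ∑ ij ∈ Finset.range N ×ˢ Finset.range N, F ij :=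
        Finset.sum_le_sum_of_subset (Finset.filter_subset _ _)
    _ = _ := by
        rw [gfPartial, gfPartial, Finset.sum_mul_sum, Finset.sum_product]

/-- The upper end of the strip in the recursion of `coef`. -/
def stripEnd (L θ : ℝ) : ℝ := if θ ≤ L then L else 2 * L

theorem coef_eq (L : ℝ) (n : ℕ) (θ : ℝ) : coef L n θ = (if n = 1 ∧ θ ≤ L then 1 else 0) +
    ∫⁻ p in tri θ (stripEnd L θ), coefConv L n p := by
  match n with
  | 0 => simp [coef_zero, coefConv_zero]
  | 1 => simp [coef_one, coefConv_one]
  | n + 2 => rw [coef_add_two]; simp [stripEnd]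

theorem gfPartial_succ_le (L : ℝ) (z : ℝ≥0∞) (N : ℕ) (θ : ℝ) : gfPartial L z (N + 1) θ ≤
    (if θ ≤ L then z else 0) +
      ∫⁻ p in tri θ (stripEnd L θ), gfPartial L z N p.1 * gfPartial L z N p.2 := by
  rw [gfPartial]
  simp_rw [coef_eq L _ θ, add_mul]
  rw [Finset.sum_add_distrib]
  refine add_le_add ?_ ?_
  · calc ∑ n ∈ Finset.range (N + 1), (if n = 1 ∧ θ ≤ L then 1 else 0 : ℝ≥0∞) * z ^ n
        ≤ ∑ n ∈ {1}, (if n = 1 ∧ θ ≤ L then 1 else 0 : ℝ≥0∞) * z ^ n := by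
          refine Finset.sum_le_sum_of_ne_zero fun n _ hne => ?_
          by_contra h
          rw [Finset.mem_singleton] at h
          simp [h] at hne
      _ = _ := by simp
  · simp_rw [← lintegral_mul_const _ (measurable_coefConv L _)]
    rw [← lintegral_finsetSum _ (fun n _ => (measurable_coefConv L n).mul_const _)]
    exact lintegral_mono fun p => sum_coefConv_le L z N p

theorem gf_eq_add (L : ℝ) (z : ℝ≥0∞) (θ : ℝ) : gf L z θ = (if θ ≤ L then z else 0) +
    ∫⁻ p in tri θ (stripEnd L θ), gf L z p.1 * gf L z p.2 := by
  rw [gf]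
  simp_rw [coef_eq L _ θ, add_mul]
  rw [ENNReal.tsum_add]
  congr 1
  · rw [tsum_eq_single 1 (by intro n hn; simp [hn])]
    simp
  · simp_rw [← lintegral_mul_const _ (measurable_coefConv L _)]
    rw [← lintegral_tsum (fun n => ((measurable_coefConv L n).mul_const _).aemeasurable)]
    exact lintegral_congr fun p => tsum_coefConv L z p

/-! ### The generating function below the critical weight -/

theorem setLIntegral_besselSol_mul {A : ℝ} {a b : ℝ} (ha : 0 ≤ a) (hab : a ≤ b)
    (hpos : ∀ s, 0 ≤ s → s ≤ b → 0 ≤ besselSol A s) :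
    ∫⁻ p in tri a b, ENNReal.ofReal (besselSol A p.1) * ENNReal.ofReal (besselSol A p.2) =
      ENNReal.ofReal (besselSol A a - besselSol A b) := by
  have hc : Continuous fun p : ℝ × ℝ => besselSol A p.1 * besselSol A p.2 := by
    have := continuous_besselSol A
    fun_prop
  rw [← integral_besselSol_mul_strip A ha hab, ofReal_integral_eq_lintegral_ofReal
    (integrableOn_tri_of_continuous hc _ _)]
  · refine setLIntegral_congr_fun (measurableSet_tri _ _) fun p hp => ?_
    have hp' := tri_subset _ _ hp
    exact (ENNReal.ofReal_mul (hpos _ hp'.1.1 hp'.1.2)).symm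
  · refine (ae_restrict_iff' (measurableSet_tri _ _)).2 (Filter.Eventually.of_forall fun p hp => ?_)
    have hp' := tri_subset _ _ hp
    exact mul_nonneg (hpos _ hp'.1.1 hp'.1.2) (hpos _ hp'.2.1 hp'.2.2)

/-- The Bessel solution dominates the generating function, which is the minimal solution. -/
theorem gf_le_besselSol {L w : ℝ} (hL : 0 < L) (hw : 0 ≤ w) (hw0 : w ≤ w0) {θ : ℝ} (h0 : 0 ≤ θ)
    (h1 : θ ≤ L) :
    gf L (ENNReal.ofReal (psi w / L ^ 2)) θ ≤ ENNReal.ofReal (besselSol (w / L ^ 2) θ) := by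
  have hA : 0 ≤ w / L ^ 2 := by positivity
  have hAL : w / L ^ 2 * L ^ 2 = w := by field_simp
  have hpos : ∀ s, 0 ≤ s → s ≤ L → 0 ≤ besselSol (w / L ^ 2) s := fun s hs hs' =>
    besselSol_nonneg hA hs hs' (by rw [hAL]; exact hw0)
  have hbL : besselSol (w / L ^ 2) L = psi w / L ^ 2 := by
    rw [eq_div_iff (by positivity), besselSol_mul_sq, hAL]
  have hle : ∀ s, 0 ≤ s → s ≤ L → besselSol (w / L ^ 2) L ≤ besselSol (w / L ^ 2) s :=
    fun s hs hs' => by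
      have h := integral_besselSol_mul_strip (w / L ^ 2) hs hs'
      have : 0 ≤ ∫ p in tri s L, besselSol (w / L ^ 2) p.1 * besselSol (w / L ^ 2) p.2 :=
        setIntegral_nonneg (measurableSet_tri _ _) fun p hp => by
          have hp' := tri_subset _ _ hp
          exact mul_nonneg (hpos _ hp'.1.1 hp'.1.2) (hpos _ hp'.2.1 hp'.2.2)
      linarith
  refine gf_le_of_partial fun N => ?_
  induction N generalizing θ with
  | zero => simp [gfPartial]
  | succ N ih =>
    refine (gfPartial_succ_le _ _ _ _).trans ?_
    rw [if_pos h1, stripEnd, if_pos h1]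
    have : ∫⁻ p in tri θ L, gfPartial L (ENNReal.ofReal (psi w / L ^ 2)) N p.1 *
        gfPartial L (ENNReal.ofReal (psi w / L ^ 2)) N p.2 ≤
        ENNReal.ofReal (besselSol (w / L ^ 2) θ - besselSol (w / L ^ 2) L) := by
      rw [← setLIntegral_besselSol_mul h0 h1 hpos]
      refine setLIntegral_mono' (measurableSet_tri _ _) fun p hp => ?_
      have hp' := tri_subset _ _ hp
      exact mul_le_mul' (ih hp'.1.1 hp'.1.2) (ih hp'.2.1 hp'.2.2)
    refine (add_le_add le_rfl this).trans ?_
    rw [← hbL, ← ENNReal.ofReal_add (hpos L hL.le le_rfl) (by linarith [hle θ h0 h1])]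
    simp

theorem gf_zero_eq_add {L : ℝ} (z : ℝ≥0∞) {θ : ℝ} (h0 : 0 ≤ θ) (h1 : θ ≤ L) :
    gf L z 0 = gf L z θ + ∫⁻ p in tri 0 θ, gf L z p.1 * gf L z p.2 := by
  rw [gf_eq_add L z 0, gf_eq_add L z θ, if_pos h1, if_pos (h0.trans h1), stripEnd, stripEnd,
    if_pos h1, if_pos (h0.trans h1), restrict_tri_add h0 h1, lintegral_add_measure]
  ring

/-- Uniqueness for the convolution equation: a finite generating function is the Bessel solution
with the same value at angle `0`. The difference is `O(θ²ⁿ / (2n)!)` for every `n`. -/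
theorem gf_eq_besselSol_of_zero {L : ℝ} {z : ℝ≥0∞} {A : ℝ} (hA : 0 ≤ A)
    (hgf : gf L z 0 = ENNReal.ofReal A) (hAL : A * L ^ 2 ≤ w0) {θ : ℝ} (h0 : 0 ≤ θ) (h1 : θ ≤ L) :
    gf L z θ = ENNReal.ofReal (besselSol A θ) := by
  have hpos : ∀ s, 0 ≤ s → s ≤ L → 0 ≤ besselSol A s := fun s hs hs' =>
    besselSol_nonneg hA hs hs' hAL
  have hfin : ∀ s, 0 ≤ s → s ≤ L → gf L z s ≤ ENNReal.ofReal A := fun s hs hs' =>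
    (gf_antitone z hs hs').trans hgf.le
  let k : ℝ → ℝ := fun s => (gf L z s).toReal
  have hkm : Measurable k := (measurable_gf L z).ennreal_toReal
  have hk0 : ∀ s, 0 ≤ k s := fun s => ENNReal.toReal_nonneg
  have hkA : ∀ s, 0 ≤ s → s ≤ L → k s ≤ A := fun s hs hs' =>
    ENNReal.toReal_le_of_le_ofReal hA (hfin s hs hs')
  have hfA : ∀ s, 0 ≤ s → s ≤ L → besselSol A s ≤ A := fun s hs hs' => by
    have h := integral_besselSol_mul A hs
    have : 0 ≤ ∫ p in tri 0 s, besselSol A p.1 * besselSol A p.2 :=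
      setIntegral_nonneg (measurableSet_tri _ _) fun p hp => by
        have hp' := tri_subset _ _ hp
        exact mul_nonneg (hpos _ hp'.1.1 (hp'.1.2.trans hs')) (hpos _ hp'.2.1 (hp'.2.2.trans hs'))
    linarith
  have hkint : ∀ s, 0 ≤ s → s ≤ L → IntegrableOn (fun p : ℝ × ℝ => k p.1 * k p.2) (tri 0 s) :=
    fun s hs hs' => by
      refine Measure.integrableOn_of_bounded (M := A * A) (volume_tri_lt_top _ _).ne
        (by fun_prop) ?_
      refine (ae_restrict_iff' (measurableSet_tri _ _)).2
        (Filter.Eventually.of_forall fun p hp => ?_)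
      have hp' := tri_subset _ _ hp
      rw [Real.norm_of_nonneg (mul_nonneg (hk0 _) (hk0 _))]
      exact mul_le_mul (hkA _ hp'.1.1 (hp'.1.2.trans hs')) (hkA _ hp'.2.1 (hp'.2.2.trans hs'))
        (hk0 _) hA
  have hkeq : ∀ s, 0 ≤ s → s ≤ L → k s = A - ∫ p in tri 0 s, k p.1 * k p.2 := fun s hs hs' => by
    have h := gf_zero_eq_add z hs hs'
    have hne : ∫⁻ p in tri 0 s, gf L z p.1 * gf L z p.2 ≠ ⊤ := by
      intro ht
      rw [ht, add_top, hgf] at h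
      exact ENNReal.ofReal_ne_top h
    have hlt : ∀ᵐ p ∂(volume.restrict (tri 0 s)), gf L z p.1 * gf L z p.2 < ⊤ := by
      refine (ae_restrict_iff' (measurableSet_tri _ _)).2
        (Filter.Eventually.of_forall fun p hp => ?_)
      have hp' := tri_subset _ _ hp
      exact ENNReal.mul_lt_top ((hfin _ hp'.1.1 (hp'.1.2.trans hs')).trans_lt ENNReal.ofReal_lt_top)
        ((hfin _ hp'.2.1 (hp'.2.2.trans hs')).trans_lt ENNReal.ofReal_lt_top)
    have hi : ∫ p in tri 0 s, k p.1 * k p.2 =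
        (∫⁻ p in tri 0 s, gf L z p.1 * gf L z p.2).toReal := by
      rw [← integral_toReal _ hlt]
      · simp only [k, ENNReal.toReal_mul]
      · have := measurable_gf L z
        fun_prop
    have h2 := congrArg ENNReal.toReal h
    rw [hgf, ENNReal.toReal_ofReal hA, ENNReal.toReal_add
      ((hfin s hs hs').trans_lt ENNReal.ofReal_lt_top).ne hne, ← hi] at h2
    simp only [k] at h2 ⊢
    linarith
  have hbc : Continuous fun p : ℝ × ℝ => besselSol A p.1 * besselSol A p.2 := by
    have := continuous_besselSol A
    fun_prop
  -- iterating the difference of the two convolution equations, both solutions being at most `A`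
  have hD : ∀ n : ℕ, ∀ s, 0 ≤ s → s ≤ L →
      |k s - besselSol A s| ≤ A * (2 * A) ^ n / (2 * n).factorial * s ^ (2 * n) := by
    intro n
    induction n with
    | zero =>
      intro s hs hs'
      have := hk0 s; have := hkA s hs hs'; have := hpos s hs hs'; have := hfA s hs hs'
      simp only [pow_zero, mul_one, mul_zero, Nat.factorial_zero, Nat.cast_one, div_one]
      rw [abs_le]
      constructor <;> linarith
    | succ n ih =>
      intro s hs hs'
      have e : k s - besselSol A s =
          -∫ p in tri 0 s, (k p.1 * k p.2 - besselSol A p.1 * besselSol A p.2) := by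
        rw [integral_sub (hkint s hs hs') (integrableOn_tri_of_continuous hbc _ _),
          integral_besselSol_mul A hs, hkeq s hs hs']
        ring
      set C := A * (2 * A) ^ n / (2 * n).factorial with hC
      have hbi : ∀ a b : ℕ, IntegrableOn (fun p : ℝ × ℝ => p.1 ^ a * p.2 ^ b) (tri 0 s) :=
        fun a b => integrableOn_tri_of_continuous (by fun_prop) _ _
      have hb : ‖∫ p in tri 0 s, (k p.1 * k p.2 - besselSol A p.1 * besselSol A p.2)‖ ≤
          ∫ p in tri 0 s, A * C * (p.1 ^ (2 * n) * p.2 ^ 0 + p.1 ^ 0 * p.2 ^ (2 * n)) := by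
        refine norm_integral_le_of_norm_le (((hbi _ _).add (hbi _ _)).const_mul _) ?_
        refine (ae_restrict_iff' (measurableSet_tri _ _)).2
          (Filter.Eventually.of_forall fun p hp => ?_)
        have hp' := tri_subset _ _ hp
        have i1 := ih _ hp'.1.1 (hp'.1.2.trans hs')
        have i2 := ih _ hp'.2.1 (hp'.2.2.trans hs')
        rw [show k p.1 * k p.2 - besselSol A p.1 * besselSol A p.2 =
          k p.1 * (k p.2 - besselSol A p.2) + (k p.1 - besselSol A p.1) * besselSol A p.2 by ring]
        refine (norm_add_le _ _).trans ?_
        rw [norm_mul, norm_mul, Real.norm_of_nonneg (hk0 _),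
          Real.norm_of_nonneg (hpos _ hp'.2.1 (hp'.2.2.trans hs'))]
        have j1 : k p.1 * ‖k p.2 - besselSol A p.2‖ ≤ A * (C * p.2 ^ (2 * n)) :=
          mul_le_mul (hkA _ hp'.1.1 (hp'.1.2.trans hs')) i2 (norm_nonneg _) hA
        have j2 : ‖k p.1 - besselSol A p.1‖ * besselSol A p.2 ≤ (C * p.1 ^ (2 * n)) * A :=
          mul_le_mul i1 (hfA _ hp'.2.1 (hp'.2.2.trans hs'))
            (hpos _ hp'.2.1 (hp'.2.2.trans hs')) ((abs_nonneg _).trans i1)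
        calc _ ≤ A * (C * p.2 ^ (2 * n)) + (C * p.1 ^ (2 * n)) * A := add_le_add j1 j2
          _ = _ := by simp only [pow_zero]; ring
      rw [e, abs_neg]
      refine hb.trans (le_of_eq ?_)
      rw [integral_const_mul, integral_add (hbi _ _) (hbi _ _), integral_tri_monomial hs,
        integral_tri_monomial hs, hC, show 2 * (n + 1) = 2 * n + 2 by ring]
      have := (2 * n).factorial_pos
      simp only [add_zero, zero_add, Nat.factorial_zero, Nat.cast_one, mul_one, one_mul]
      field_simp
      ring
  have hlim : Filter.Tendsto (fun n : ℕ => A * ((2 * A * θ ^ 2) ^ n / n.factorial)) Filter.atTop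
      (nhds 0) := by
    simpa using (FloorSemiring.tendsto_pow_div_factorial_atTop (2 * A * θ ^ 2)).const_mul A
  have hzero : |k θ - besselSol A θ| ≤ 0 := by
    refine ge_of_tendsto' hlim fun n => (hD n θ h0 h1).trans ?_
    have hf : (n.factorial : ℝ) ≤ (2 * n).factorial := by
      exact_mod_cast Nat.factorial_le (by omega)
    have := n.factorial_pos
    calc A * (2 * A) ^ n / (2 * n).factorial * θ ^ (2 * n)
        ≤ A * (2 * A) ^ n / n.factorial * θ ^ (2 * n) := by gcongr
      _ = _ := by rw [mul_pow _ (θ ^ 2), ← pow_mul]; ring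
  have hk : k θ = besselSol A θ := sub_eq_zero.1 (abs_eq_zero.1 (le_antisymm hzero (abs_nonneg _)))
  rw [← hk, ENNReal.ofReal_toReal ((hfin θ h0 h1).trans_lt ENNReal.ofReal_lt_top).ne]

/-- At weight `ψ(w) / L²` with `0 ≤ w ≤ w₀` the generating function is the Bessel solution. -/
theorem gf_eq_besselSol {L w : ℝ} (hL : 0 < L) (hw : 0 ≤ w) (hw0 : w ≤ w0) {θ : ℝ} (h0 : 0 ≤ θ)
    (h1 : θ ≤ L) :
    gf L (ENNReal.ofReal (psi w / L ^ 2)) θ = ENNReal.ofReal (besselSol (w / L ^ 2) θ) := by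
  set z := ENNReal.ofReal (psi w / L ^ 2) with hz
  have hb := gf_le_besselSol hL hw hw0 le_rfl hL.le
  rw [besselSol_zero, ← hz] at hb
  set A := (gf L z 0).toReal
  have hA0 : 0 ≤ A := ENNReal.toReal_nonneg
  have hAw : A ≤ w / L ^ 2 := ENNReal.toReal_le_of_le_ofReal (by positivity) hb
  have hgf : gf L z 0 = ENNReal.ofReal A :=
    (ENNReal.ofReal_toReal (hb.trans_lt ENNReal.ofReal_lt_top).ne).symm
  have hAL' : A * L ^ 2 ≤ w := by rwa [le_div_iff₀ (by positivity)] at hAw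
  have hAL : A * L ^ 2 ≤ w0 := hAL'.trans hw0
  have hL' := gf_eq_besselSol_of_zero hA0 hgf hAL hL.le le_rfl
  have hψ : 0 ≤ psi w := by
    rw [← psi_zero]
    exact psi_strictMonoOn.monotoneOn ⟨le_rfl, w0_pos.le⟩ ⟨hw, hw0⟩ hw
  have hgL : gf L z L = z := by
    rw [gf_eq_add, if_pos le_rfl, stripEnd, if_pos le_rfl, tri_self]
    simp
  rw [hgL, hz, ENNReal.ofReal_eq_ofReal_iff (by positivity)
    (besselSol_nonneg hA0 hL.le le_rfl hAL), div_eq_iff (by positivity), besselSol_mul_sq] at hL'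
  have hwA := psi_strictMonoOn.injOn ⟨hw, hw0⟩ ⟨by positivity, hAL⟩ hL'
  have : A = w / L ^ 2 := by rw [hwA]; field_simp
  rw [← this]
  exact gf_eq_besselSol_of_zero hA0 hgf hAL h0 h1

/-! ### The value at angle zero and the critical weight -/

/-- The critical weight of the recursion on `[0, L]`. -/
def critWeight (L : ℝ) : ℝ := psi w0 / L ^ 2

theorem critWeight_pos {L : ℝ} (hL : 0 < L) : 0 < critWeight L := by
  have := psi_pos w0_pos le_rfl
  unfold critWeight; positivity

theorem coef_zero_lt_top {L : ℝ} (hL : 0 < L) (n : ℕ) : coef L n 0 < ⊤ := by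
  have h := gf_eq_besselSol hL w0_pos.le le_rfl le_rfl hL.le
  have hz : 0 < ENNReal.ofReal (psi w0 / L ^ 2) := ENNReal.ofReal_pos.2 (critWeight_pos hL)
  have hle : coef L n 0 * ENNReal.ofReal (psi w0 / L ^ 2) ^ n < ⊤ :=
    ((ENNReal.le_tsum n).trans h.le).trans_lt ENNReal.ofReal_lt_top
  by_contra htop
  rw [not_lt, top_le_iff] at htop
  rw [htop, ENNReal.top_mul (pow_ne_zero n hz.ne')] at hle
  exact lt_irrefl _ hle

theorem coef_lt_top {L : ℝ} (hL : 0 < L) (n : ℕ) {θ : ℝ} (h0 : 0 ≤ θ) (h1 : θ ≤ L) :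
    coef L n θ < ⊤ :=
  (coef_antitone n h0 h1).trans_lt (coef_zero_lt_top hL n)

/-- The real generating function `∑ₙ coef L n 0 zⁿ` at angle `0`. -/
def ampl (L z : ℝ) : ℝ := ∑' n, (coef L n 0).toReal * z ^ n

theorem gf_zero_eq_tsum {L : ℝ} (hL : 0 < L) {z : ℝ} (hz : 0 ≤ z) :
    gf L (ENNReal.ofReal z) 0 = ∑' n, ENNReal.ofReal ((coef L n 0).toReal * z ^ n) := by
  rw [gf]
  refine tsum_congr fun n => ?_
  rw [ENNReal.ofReal_mul ENNReal.toReal_nonneg, ENNReal.ofReal_toReal (coef_zero_lt_top hL n).ne,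
    ENNReal.ofReal_pow hz]

theorem summable_of_gf_zero_ne_top {L : ℝ} (hL : 0 < L) {z : ℝ} (hz : 0 ≤ z)
    (h : gf L (ENNReal.ofReal z) 0 ≠ ⊤) : Summable fun n => (coef L n 0).toReal * z ^ n := by
  rw [gf_zero_eq_tsum hL hz] at h
  have := ENNReal.summable_toReal h
  refine this.congr fun n => ENNReal.toReal_ofReal (by positivity)

theorem ampl_eq_toReal {L : ℝ} (hL : 0 < L) {z : ℝ} (hz : 0 ≤ z) :
    ampl L z = (gf L (ENNReal.ofReal z) 0).toReal := by
  rw [gf_zero_eq_tsum hL hz, ENNReal.tsum_toReal_eq fun n => ENNReal.ofReal_ne_top]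
  exact tsum_congr fun n => (ENNReal.toReal_ofReal (by positivity)).symm

/-- Up to the critical weight, `z ↦ L² ampl L z` inverts `ψ` up to the factor `L²`, and the
generating function is the Bessel solution. -/
theorem ampl_spec {L : ℝ} (hL : 0 < L) {z : ℝ} (h0 : 0 ≤ z) (h1 : z ≤ critWeight L) :
    0 ≤ ampl L z ∧ L ^ 2 * ampl L z ≤ w0 ∧ psi (L ^ 2 * ampl L z) = L ^ 2 * z ∧
      ∀ θ, 0 ≤ θ → θ ≤ L →
        gf L (ENNReal.ofReal z) θ = ENNReal.ofReal (besselSol (ampl L z) θ) := by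
  have h1' : L ^ 2 * z ≤ psi w0 := by
    unfold critWeight at h1
    rw [le_div_iff₀ (by positivity)] at h1
    linarith
  obtain ⟨w, hw, hw0, hψ⟩ := exists_psi_eq (v := L ^ 2 * z) (by positivity) h1'
  have hz : psi w / L ^ 2 = z := by rw [hψ]; field_simp
  have hgf := fun θ (h : 0 ≤ θ) (h' : θ ≤ L) => gf_eq_besselSol hL hw hw0 h h'
  rw [hz] at hgf
  have hA : ampl L z = w / L ^ 2 := by
    rw [ampl_eq_toReal hL h0, hgf 0 le_rfl hL.le, besselSol_zero,
      ENNReal.toReal_ofReal (by positivity)]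
  have hLw : L ^ 2 * (w / L ^ 2) = w := by field_simp
  rw [hA, hLw]
  exact ⟨by positivity, hw0, hψ, hgf⟩

theorem summable_ampl {L : ℝ} (hL : 0 < L) {z : ℝ} (h0 : 0 ≤ z) (h1 : z ≤ critWeight L) :
    Summable fun n => (coef L n 0).toReal * z ^ n := by
  refine summable_of_gf_zero_ne_top hL h0 ?_
  rw [(ampl_spec hL h0 h1).2.2.2 0 le_rfl hL.le]
  exact ENNReal.ofReal_ne_top

theorem ampl_lt {L : ℝ} (hL : 0 < L) {z : ℝ} (h0 : 0 ≤ z) (h1 : z < critWeight L) :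
    L ^ 2 * ampl L z < w0 := by
  obtain ⟨-, h, hψ, -⟩ := ampl_spec hL h0 h1.le
  refine lt_of_le_of_ne h fun he => ?_
  rw [he] at hψ
  unfold critWeight at h1
  rw [lt_div_iff₀ (by positivity)] at h1
  linarith

/-- The derivative of `ampl`, as a power series and through `ψ' = j0`. -/
theorem hasDerivAt_ampl {L : ℝ} (hL : 0 < L) {z : ℝ} (h0 : 0 < z) (h1 : z < critWeight L) :
    HasDerivAt (ampl L) (∑' n : ℕ, ((n : ℝ) + 1) * (coef L (n + 1) 0).toReal * z ^ n) z ∧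
    (Summable fun n : ℕ => ((n : ℝ) + 1) * (coef L (n + 1) 0).toReal * z ^ n) ∧
    ∑' n : ℕ, ((n : ℝ) + 1) * (coef L (n + 1) 0).toReal * z ^ n = (j0 (L ^ 2 * ampl L z))⁻¹ := by
  have hs := summable_ampl hL (critWeight_pos hL).le le_rfl
  have hd := hasDerivAt_powerSeries (c := fun n => (coef L n 0).toReal) (r := critWeight L)
    (hs.congr fun n => by rw [abs_of_nonneg ENNReal.toReal_nonneg]) (z := z)
    (by rwa [abs_of_pos h0])
  refine ⟨hd.1, hd.2.congr fun n => ?_, ?_⟩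
  · rw [abs_of_pos h0, abs_of_nonneg (by positivity)]
  · set d := ∑' n : ℕ, ((n : ℝ) + 1) * (coef L (n + 1) 0).toReal * z ^ n
    have hc : HasDerivAt (fun z => psi (L ^ 2 * ampl L z)) (j0 (L ^ 2 * ampl L z) * (L ^ 2 * d)) z :=
      (hasDerivAt_psi _).comp z (HasDerivAt.const_mul (L ^ 2) (show HasDerivAt (ampl L) d z from hd.1))
    have hl : HasDerivAt (fun z => L ^ 2 * z) (L ^ 2 * 1) z := (hasDerivAt_id z).const_mul _
    have hev : (fun z => L ^ 2 * z) =ᶠ[nhds z] fun z => psi (L ^ 2 * ampl L z) := by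
      filter_upwards [Ioo_mem_nhds h0 h1] with x hx
      exact (ampl_spec hL hx.1.le hx.2.le).2.2.1.symm
    have he := (hc.congr_of_eventuallyEq hev).unique hl
    refine eq_inv_of_mul_eq_one_left ?_
    have : L ^ 2 * (d * j0 (L ^ 2 * ampl L z)) = L ^ 2 * 1 := by rw [← he]; ring
    exact mul_left_cancel₀ (by positivity) this

/-- Above the critical weight the generating function at angle `0` is infinite: otherwise `ampl`
would be differentiable at the critical weight, where its inverse function has derivative zero. -/
theorem gf_zero_eq_top {L : ℝ} (hL : 0 < L) {z : ℝ} (hz : critWeight L < z) :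
    gf L (ENNReal.ofReal z) 0 = ⊤ := by
  by_contra hne
  have hc0 := critWeight_pos hL
  have hs := summable_of_gf_zero_ne_top hL (hc0.trans hz).le hne
  have hd := (hasDerivAt_powerSeries (c := fun n => (coef L n 0).toReal) (r := z)
    (hs.congr fun n => by rw [abs_of_nonneg ENNReal.toReal_nonneg]) (z := critWeight L)
    (by rwa [abs_of_pos hc0])).1
  set d := ∑' n : ℕ, ((n : ℝ) + 1) * (coef L (n + 1) 0).toReal * critWeight L ^ n
  have hc : HasDerivAt (fun z => psi (L ^ 2 * ampl L z))
      (j0 (L ^ 2 * ampl L (critWeight L)) * (L ^ 2 * d)) (critWeight L) :=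
    (hasDerivAt_psi _).comp _
      (HasDerivAt.const_mul (L ^ 2) (show HasDerivAt (ampl L) d (critWeight L) from hd))
  have hl : HasDerivAt (fun z => L ^ 2 * z) (L ^ 2 * 1) (critWeight L) :=
    (hasDerivAt_id _).const_mul _
  have hmem : critWeight L ∈ Set.Icc 0 (critWeight L) := ⟨hc0.le, le_rfl⟩
  have he := (uniqueDiffOn_Icc hc0 _ hmem).eq_deriv _
    (hc.hasDerivWithinAt.congr (fun x hx => (ampl_spec hL hx.1 hx.2).2.2.1.symm)
      (ampl_spec hL hc0.le le_rfl).2.2.1.symm) hl.hasDerivWithinAt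
  obtain ⟨hA, hA', hψ, -⟩ := ampl_spec hL hc0.le le_rfl
  have : L ^ 2 * ampl L (critWeight L) = w0 := by
    refine psi_strictMonoOn.injOn ⟨by positivity, hA'⟩ ⟨w0_pos.le, le_rfl⟩ ?_
    rw [hψ, critWeight]; field_simp
  rw [this, j0_w0, zero_mul] at he
  have : 0 < L ^ 2 := by positivity
  linarith

/-! ### Supermultiplicativity of the coefficients -/

/-- The convolution over a box contained in the strip bounds the coefficient from below. -/
theorem box_le_coef {L θ : ℝ} (hθ : θ ≤ L) {I J : Set ℝ} (hIJ : I ×ˢ J ⊆ tri θ L) (i j : ℕ) :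
    (∫⁻ s in I, coef L i s) * ∫⁻ t in J, coef L j t ≤ coef L (i + j) θ := by
  have hle : (∫⁻ s in I, coef L i s) * ∫⁻ t in J, coef L j t ≤
      ∫⁻ p in tri θ L, coefConv L (i + j) p := by
    rw [← lintegral_prod_mul (measurable_coef L i).aemeasurable (measurable_coef L j).aemeasurable,
      Measure.prod_restrict, ← Measure.volume_eq_prod]
    refine (lintegral_mono_set hIJ).trans (lintegral_mono fun p => ?_)
    exact Finset.single_le_sum (f := fun ij : ℕ × ℕ => coef L ij.1 p.1 * coef L ij.2 p.2)
      (fun _ _ => zero_le) (mem_antidiagonal.2 (rfl : (i, j).1 + (i, j).2 = i + j))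
  refine hle.trans ?_
  rw [coef_eq L (i + j), stripEnd, if_pos hθ]
  exact le_add_self

theorem mul_coef_le_setLIntegral {L a b : ℝ} (n : ℕ) (hb : b ≤ L) :
    ENNReal.ofReal (b - a) * coef L n b ≤ ∫⁻ s in Set.Ioo a b, coef L n s := by
  calc ENNReal.ofReal (b - a) * coef L n b = ∫⁻ _ in Set.Ioo a b, coef L n b := by
        rw [setLIntegral_const, Real.volume_Ioo, mul_comm]
    _ ≤ _ := setLIntegral_mono' measurableSet_Ioo fun s hs => coef_antitone n hs.2.le hb

theorem setLIntegral_coef_one {L a b : ℝ} (hb : b ≤ L) :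
    ∫⁻ s in Set.Ioo a b, coef L 1 s = ENNReal.ofReal (b - a) := by
  rw [← Real.volume_Ioo, ← setLIntegral_one]
  refine setLIntegral_congr_fun measurableSet_Ioo fun s hs => ?_
  rw [coef_one, if_pos (hs.2.le.trans hb)]

/-- Finiteness at angle `L / 2` implies finiteness at angle `0`, at the same weight. -/
theorem gf_zero_ne_top_of_half {L : ℝ} (hL : 0 < L) {z : ℝ} (hz : 0 < z)
    (h : gf L (ENNReal.ofReal z) (L / 2) ≠ ⊤) : gf L (ENNReal.ofReal z) 0 ≠ ⊤ := by
  set x := ENNReal.ofReal z with hx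
  have hx0 : x ≠ 0 := (ENNReal.ofReal_pos.2 hz).ne'
  have hxt : x ≠ ⊤ := ENNReal.ofReal_ne_top
  have hc : ENNReal.ofReal (L / 4) ≠ 0 := (ENNReal.ofReal_pos.2 (by positivity)).ne'
  -- the box `(0, L/4) × (L/2, 3L/4)` of the strip, with a single leaf in the second coordinate
  have hbox : ∀ n, (∫⁻ s in Set.Ioo 0 (L / 4), coef L n s) * ENNReal.ofReal (L / 4) ≤
      coef L (n + 1) (L / 2) := fun n => by
    have := box_le_coef (L := L) (θ := L / 2) (I := Set.Ioo 0 (L / 4))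
      (J := Set.Ioo (L / 2) (3 * L / 4)) (by linarith)
      (fun p hp => ⟨hp.1.1, by linarith [hp.2.1], by linarith [hp.1.1, hp.2.1],
        by linarith [hp.1.2, hp.2.2]⟩) n 1
    rwa [setLIntegral_coef_one (by linarith), show 3 * L / 4 - L / 2 = L / 4 by ring] at this
  have h1 : (∫⁻ s in Set.Ioo 0 (L / 4), gf L x s) * ENNReal.ofReal (L / 4) * x ≤
      gf L x (L / 2) := by
    simp only [gf]
    rw [lintegral_tsum fun n => ((measurable_coef L n).mul_const _).aemeasurable,
      ← ENNReal.tsum_mul_right, ← ENNReal.tsum_mul_right]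
    refine (ENNReal.tsum_le_tsum fun n => ?_).trans
      (ENNReal.tsum_comp_le_tsum_of_injective (add_left_injective 1) _)
    rw [lintegral_mul_const _ (measurable_coef L n), pow_succ]
    calc _ = (∫⁻ s in Set.Ioo 0 (L / 4), coef L n s) * ENNReal.ofReal (L / 4) * (x ^ n * x) := by
          ring
      _ ≤ _ := by gcongr; exact hbox n
  have hI : ∫⁻ s in Set.Ioo 0 (L / 4), gf L x s ≠ ⊤ := by
    intro ht
    rw [ht, ENNReal.top_mul hc, ENNReal.top_mul hx0, top_le_iff] at h1
    exact h h1
  have hq : gf L x (L / 4) ≠ ⊤ := by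
    intro ht
    refine hI (top_le_iff.1 ?_)
    calc ⊤ = ∫⁻ _ in Set.Ioo 0 (L / 4), gf L x (L / 4) := by
          rw [ht, setLIntegral_const, Real.volume_Ioo, sub_zero, ENNReal.top_mul hc]
      _ ≤ _ := setLIntegral_mono' measurableSet_Ioo fun s hs =>
          gf_antitone x hs.2.le (by linarith)
  have hI2 : ∫⁻ s in Set.Icc (L / 4) L, gf L x s ≠ ⊤ := by
    refine ne_top_of_le_ne_top ?_ (setLIntegral_mono' (g := fun _ => gf L x (L / 4))
      measurableSet_Icc fun s hs => gf_antitone x hs.1 hs.2)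
    rw [setLIntegral_const]
    exact ENNReal.mul_ne_top hq (by simp)
  have hI3 : ∫⁻ s in Set.Ioo 0 L, gf L x s ≠ ⊤ := by
    refine ne_top_of_le_ne_top (ENNReal.add_ne_top.2 ⟨hI, hI2⟩)
      ((lintegral_mono_set fun s hs => ?_).trans (lintegral_union_le _ _ _))
    rcases lt_or_ge s (L / 4) with hs' | hs'
    · exact Or.inl ⟨hs.1, hs'⟩
    · exact Or.inr ⟨hs', hs.2.le⟩
  rw [gf_eq_add, if_pos hL.le, stripEnd, if_pos hL.le]
  refine ENNReal.add_ne_top.2 ⟨hxt, ne_top_of_le_ne_top (ENNReal.mul_ne_top hI3 hI3) ?_⟩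
  rw [← lintegral_prod_mul (measurable_gf L x).aemeasurable (measurable_gf L x).aemeasurable,
    Measure.prod_restrict, ← Measure.volume_eq_prod]
  exact lintegral_mono_set fun p ⟨h1, h2, h3, h4⟩ => ⟨⟨h1, by linarith⟩, ⟨h2, by linarith⟩⟩

/-- The square `(L/4, L/2)²` lies in the strip of the angle `L / 2`, and on it the coefficients
are at least their values at `L / 2`. -/
theorem coef_half_supermul {L : ℝ} (hL : 0 < L) (m n : ℕ) :
    L ^ 2 / 16 * ((coef L m (L / 2)).toReal * (coef L n (L / 2)).toReal) ≤
      (coef L (m + n) (L / 2)).toReal := by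
  have hbox := box_le_coef (L := L) (θ := L / 2) (I := Set.Ioo (L / 4) (L / 2))
      (J := Set.Ioo (L / 4) (L / 2)) (by linarith)
      (fun p hp => ⟨by linarith [hp.1.1], by linarith [hp.2.1], by linarith [hp.1.1, hp.2.1],
        by linarith [hp.1.2, hp.2.2]⟩) m n
  have h := (mul_le_mul' (mul_coef_le_setLIntegral (a := L / 4) (b := L / 2) m (by linarith))
    (mul_coef_le_setLIntegral (a := L / 4) (b := L / 2) n (by linarith))).trans hbox
  have := ENNReal.toReal_mono (coef_lt_top hL (m + n) (by linarith) (by linarith)).ne h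
  rw [ENNReal.toReal_mul, ENNReal.toReal_mul, ENNReal.toReal_mul,
    ENNReal.toReal_ofReal (by linarith)] at this
  calc _ = (L / 2 - L / 4) * (coef L m (L / 2)).toReal *
        ((L / 2 - L / 4) * (coef L n (L / 2)).toReal) := by ring
    _ ≤ _ := this

theorem coef_half_pos {L : ℝ} (hL : 0 < L) (n : ℕ) : 0 < (coef L (n + 1) (L / 2)).toReal := by
  induction n with
  | zero => rw [zero_add, coef_one, if_pos (by linarith)]; simp
  | succ n ih =>
    refine lt_of_lt_of_le ?_ (coef_half_supermul hL (n + 1) 1)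
    have : 0 < (coef L 1 (L / 2)).toReal := by rw [coef_one, if_pos (by linarith)]; simp
    positivity

/-- The coefficients grow at least like any exponential below the inverse of the critical weight:
by Fekete's lemma their growth rate exists, and it is determined by the divergence above the
critical weight. -/
theorem eventually_one_le_coef_mul_pow {L : ℝ} (hL : 0 < L) {ρ : ℝ} (hρ : critWeight L < ρ) :
    ∀ᶠ n in Filter.atTop, 1 ≤ (coef L n 0).toReal * ρ ^ n := by
  have hc0 := critWeight_pos hL
  have hρ0 := hc0.trans hρ
  set c := L ^ 2 / 16 with hc
  have hcpos : 0 < c := by positivity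
  let k : ℕ → ℝ := fun n => (coef L n (L / 2)).toReal
  have hkpos : ∀ n, n ≠ 0 → 0 < k n := fun n hn => by
    obtain ⟨m, rfl⟩ := Nat.exists_eq_succ_of_ne_zero hn
    exact coef_half_pos hL m
  -- `-log (c * k n)` is subadditive; the value at `0`, where `k` vanishes, is set to `0`
  let v : ℕ → ℝ := fun n => if n = 0 then 0 else -Real.log (c * k n)
  have hsub : Subadditive v := fun m n => by
    by_cases hm : m = 0
    · simp [v, hm]
    by_cases hn : n = 0
    · simp [v, hn]
    simp only [v, hm, hn, if_false, Nat.add_eq_zero_iff, false_and]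
    have h1 := hkpos m hm
    have h2 := hkpos n hn
    rw [← neg_add, neg_le_neg_iff, ← Real.log_mul (by positivity) (by positivity)]
    refine Real.log_le_log (by positivity) ?_
    have := coef_half_supermul hL m n
    calc c * k m * (c * k n) = c * (c * (k m * k n)) := by ring
      _ ≤ _ := by gcongr
  have hzc := summable_ampl hL hc0.le le_rfl
  have hA : 0 < ampl L (critWeight L) + 1 :=
    add_pos_of_nonneg_of_pos (ampl_spec hL hc0.le le_rfl).1 one_pos
  have hkle : ∀ n, k n * critWeight L ^ n ≤ ampl L (critWeight L) + 1 := fun n => by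
    have h1 : (coef L n 0).toReal * critWeight L ^ n ≤ ampl L (critWeight L) :=
      hzc.le_tsum n fun m _ => by positivity
    have h2 : k n ≤ (coef L n 0).toReal :=
      ENNReal.toReal_mono (coef_zero_lt_top hL n).ne (coef_antitone n (by linarith) (by linarith))
    have : k n * critWeight L ^ n ≤ (coef L n 0).toReal * critWeight L ^ n := by gcongr
    linarith
  have hbdd : BddBelow (Set.range fun n => v n / n) := by
    refine ⟨-|Real.log (c * (ampl L (critWeight L) + 1))| - |Real.log (critWeight L)|, ?_⟩
    rintro _ ⟨n, rfl⟩
    by_cases hn : n = 0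
    · simp only [v, hn, if_true, zero_div]
      have := abs_nonneg (Real.log (c * (ampl L (critWeight L) + 1)))
      have := abs_nonneg (Real.log (critWeight L))
      linarith
    simp only [v, hn, if_false]
    have h1 := hkpos n hn
    have hn1 : (1 : ℝ) ≤ n := by exact_mod_cast Nat.one_le_iff_ne_zero.2 hn
    rw [le_div_iff₀ (by linarith)]
    have h2 := Real.log_le_log (by positivity) (mul_le_mul_of_nonneg_left (hkle n) hcpos.le)
    rw [← mul_assoc, Real.log_mul (by positivity) (by positivity), Real.log_pow] at h2
    have h3 := le_abs_self (Real.log (c * (ampl L (critWeight L) + 1)))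
    have h4 := neg_abs_le (Real.log (critWeight L))
    have h5 := abs_nonneg (Real.log (c * (ampl L (critWeight L) + 1)))
    nlinarith
  have hlim := hsub.tendsto_lim hbdd
  have hle : ∀ n, n ≠ 0 → c * k n ≤ Real.exp (-hsub.lim) ^ n := fun n hn => by
    have h := hsub.lim_le_div hbdd hn
    have hn1 : (0 : ℝ) < n := by exact_mod_cast Nat.pos_of_ne_zero hn
    simp only [v, hn, if_false] at h
    rw [le_div_iff₀ hn1] at h
    have h1 := hkpos n hn
    rw [← Real.exp_nat_mul, ← Real.log_le_iff_le_exp (by positivity)]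
    linarith
  -- `exp lim` is the radius of convergence at the angle `L / 2`, hence at most the critical weight
  have hrate : hsub.lim ≤ Real.log (critWeight L) := by
    by_contra! hlt
    -- a weight `exp l` strictly between the critical weight and `exp lim`
    obtain ⟨l, hl1, hl2⟩ := exists_between hlt
    have hz1 : critWeight L < Real.exp l := (Real.log_lt_iff_lt_exp hc0).1 hl1
    have htop := gf_zero_eq_top hL hz1
    refine gf_zero_ne_top_of_half hL (Real.exp_pos l) ?_ htop
    have hr : Real.exp (-hsub.lim) * Real.exp l < 1 := by
      rw [← Real.exp_add, Real.exp_lt_one_iff]; linarith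
    have hsum : Summable fun n => k n * Real.exp l ^ n := by
      refine Summable.of_nonneg_of_le (fun n => by positivity) (fun n => ?_)
        ((summable_geometric_of_lt_one (by positivity) hr).mul_left c⁻¹)
      by_cases hn : n = 0
      · simp only [k, hn, coef_zero]; simp; positivity
      · rw [inv_mul_eq_div, le_div_iff₀ hcpos, mul_pow]
        calc k n * Real.exp l ^ n * c = c * k n * Real.exp l ^ n := by ring
          _ ≤ _ := by gcongr; exact hle n hn
    have : gf L (ENNReal.ofReal (Real.exp l)) (L / 2) =
        ∑' n, ENNReal.ofReal (k n * Real.exp l ^ n) := by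
      rw [gf]
      refine tsum_congr fun n => ?_
      rw [ENNReal.ofReal_mul ENNReal.toReal_nonneg,
        ENNReal.ofReal_toReal (coef_lt_top hL n (by linarith) (by linarith)).ne,
        ENNReal.ofReal_pow (Real.exp_pos l).le]
    rw [this]
    exact hsum.tsum_ofReal_ne_top
  have hlog : Real.log (critWeight L) < Real.log ρ := Real.log_lt_log hc0 hρ
  obtain ⟨l, hl1, hl2⟩ := exists_between hlog
  have hev := hlim.eventually_lt_const (hrate.trans_lt hl1)
  have hgrow : ∀ᶠ n : ℕ in Filter.atTop, Real.log c ≤ n * (Real.log ρ - l) :=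
    (tendsto_natCast_atTop_atTop.atTop_mul_const (sub_pos.2 hl2)).eventually_ge_atTop _
  filter_upwards [hev, hgrow, Filter.eventually_ne_atTop 0] with n h1 h2 hn
  have hn1 : (0 : ℝ) < n := by exact_mod_cast Nat.pos_of_ne_zero hn
  have hk := hkpos n hn
  simp only [v, hn, if_false] at h1
  rw [div_lt_iff₀ hn1, Real.log_mul hcpos.ne' hk.ne'] at h1
  have h3 : 0 ≤ Real.log (k n * ρ ^ n) := by
    rw [Real.log_mul hk.ne' (by positivity), Real.log_pow]
    nlinarith
  have h4 : 1 ≤ k n * ρ ^ n := by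
    by_contra! hlt
    exact absurd h3 (not_le.2 (Real.log_neg (by positivity) hlt))
  have h5 : k n ≤ (coef L n 0).toReal :=
    ENNReal.toReal_mono (coef_zero_lt_top hL n).ne (coef_antitone n (by linarith) (by linarith))
  exact h4.trans (by gcongr)

/-! ### The generating function of blobs without red leaf -/

/-- `z` times the derivative of the generating function in the weight. -/
def dgf (L : ℝ) (z : ℝ≥0∞) (θ : ℝ) : ℝ≥0∞ := ∑' n : ℕ, (n : ℝ≥0∞) * (coef L n θ * z ^ n)

theorem measurable_dgf (L : ℝ) (z : ℝ≥0∞) : Measurable (dgf L z) :=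
  Measurable.tsum fun n => ((measurable_coef L n).mul_const _).const_mul _

theorem dgf_antitone {L : ℝ} (z : ℝ≥0∞) {a b : ℝ} (hab : a ≤ b) (hb : b ≤ L) :
    dgf L z b ≤ dgf L z a :=
  ENNReal.tsum_le_tsum fun n => by gcongr; exact coef_antitone n hab hb

theorem tsum_natCast_mul_coefConv (L : ℝ) (z : ℝ≥0∞) (p : ℝ × ℝ) :
    ∑' n : ℕ, (n : ℝ≥0∞) * (coefConv L n p * z ^ n) =
      gf L z p.1 * dgf L z p.2 + dgf L z p.1 * gf L z p.2 := by
  simp only [gf, dgf]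
  rw [ennreal_tsum_mul_tsum, ennreal_tsum_mul_tsum, ← ENNReal.tsum_add]
  refine tsum_congr fun n => ?_
  rw [coefConv, Finset.sum_mul, Finset.mul_sum, ← Finset.sum_add_distrib]
  refine Finset.sum_congr rfl fun ij hij => ?_
  rw [mem_antidiagonal] at hij
  rw [← hij, pow_add]; push_cast; ring

/-- The linear equation of the derivative of the generating function. -/
theorem dgf_eq_add {L : ℝ} (z : ℝ≥0∞) {θ : ℝ} (hθ : θ ≤ L) : dgf L z θ = z +
    ∫⁻ p in tri θ L, (gf L z p.1 * dgf L z p.2 + dgf L z p.1 * gf L z p.2) := by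
  rw [dgf]
  simp_rw [coef_eq L _ θ, add_mul, mul_add]
  rw [ENNReal.tsum_add, stripEnd, if_pos hθ]
  congr 1
  · rw [tsum_eq_single 1 (by intro n hn; simp [hn])]
    simp [hθ]
  · simp_rw [← lintegral_mul_const _ (measurable_coefConv L _),
      ← lintegral_const_mul _ ((measurable_coefConv L _).mul_const _)]
    rw [← lintegral_tsum
      (fun n => (((measurable_coefConv L n).mul_const _).const_mul _).aemeasurable)]
    exact lintegral_congr fun p => tsum_natCast_mul_coefConv L z p

theorem lintegral_tri_shift (L a : ℝ) {g : ℝ × ℝ → ℝ≥0∞}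
    (hg : Measurable g) : ∫⁻ p in tri (a + L) (2 * L), g p = (∫⁻ p in core L a, g p) +
      ((∫⁻ p in tri a L, g (p.1, p.2 + L)) + ∫⁻ p in tri a L, g (p.1 + L, p.2)) := by
  rw [restrict_tri_shift L a, lintegral_add_measure, lintegral_add_measure,
    lintegral_map hg (by fun_prop), lintegral_map hg (by fun_prop)]

theorem integral_tri_shift (L a : ℝ) {g : ℝ × ℝ → ℝ}
    (hg : Continuous g) : ∫ p in tri (a + L) (2 * L), g p = (∫ p in core L a, g p) +
      ((∫ p in tri a L, g (p.1, p.2 + L)) + ∫ p in tri a L, g (p.1 + L, p.2)) := by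
  have hi := integrableOn_tri_of_continuous hg (a + L) (2 * L)
  have hi' := hi
  rw [IntegrableOn, restrict_tri_shift L a, integrable_add_measure, integrable_add_measure] at hi'
  rw [restrict_tri_shift L a, integral_add_measure hi'.1 (hi'.2.1.add_measure hi'.2.2),
    integral_add_measure hi'.2.1 hi'.2.2,
    integral_map (by fun_prop) hg.aestronglyMeasurable,
    integral_map (by fun_prop) hg.aestronglyMeasurable]

/-- The generating function at angle `a + L`, extended by continuity to `a = 0`: at `a = 0` it is
the generating function of the blobs without red leaf. -/
def gfUp (L : ℝ) (z : ℝ≥0∞) (a : ℝ) : ℝ≥0∞ :=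
  ∫⁻ p in tri (a + L) (2 * L), gf L z p.1 * gf L z p.2

theorem gf_add_eq_gfUp {L : ℝ} (z : ℝ≥0∞) {a : ℝ} (ha : 0 < a) : gf L z (a + L) = gfUp L z a := by
  have : ¬ a + L ≤ L := by linarith
  rw [gf_eq_add, stripEnd, if_neg this, if_neg this, zero_add, gfUp]

theorem gfUp_antitone {L : ℝ} (z : ℝ≥0∞) {a b : ℝ} (hab : a ≤ b) : gfUp L z b ≤ gfUp L z a :=
  lintegral_mono_set fun p ⟨h1, h2, h3, h4⟩ => ⟨h1, h2, by linarith, h4⟩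

/-- In the strip above `a + L` at most one of the two coordinates exceeds `L`, so the equation of
`gfUp` is linear, with the generating function below `L` as its coefficient. -/
theorem gfUp_eq_add (L : ℝ) (z : ℝ≥0∞) (a : ℝ) :
    gfUp L z a = (∫⁻ p in core L a, gf L z p.1 * gf L z p.2) +
      ((∫⁻ p in tri a L, gf L z p.1 * gfUp L z p.2) + ∫⁻ p in tri a L, gfUp L z p.1 * gf L z p.2) := by
  have hm := measurable_gf L z
  rw [gfUp, lintegral_tri_shift L a (by fun_prop)]
  congr 2
  · exact setLIntegral_congr_fun (measurableSet_tri _ _) fun p hp => by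
      simp only; rw [gf_add_eq_gfUp z hp.2.1]
  · exact setLIntegral_congr_fun (measurableSet_tri _ _) fun p hp => by
      simp only; rw [gf_add_eq_gfUp z hp.1]

theorem core_subset (L a : ℝ) (ha : 0 ≤ a) : core L a ⊆ core L 0 :=
  fun p ⟨⟨h1, h2, h3, h4⟩, h5⟩ => ⟨⟨h1, h2, by linarith, h4⟩, h5⟩

theorem volume_core_lt_top (L a : ℝ) : volume (core L a) < ⊤ :=
  (measure_mono Set.inter_subset_left).trans_lt (volume_tri_lt_top _ _)

/-- A multiple of `dgf` is a supersolution of the linear equation of `gfUp`, which is therefore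
finite. -/
theorem gfUp_le {L : ℝ} {z : ℝ≥0∞} (hz0 : z ≠ 0) (hzt : z ≠ ⊤) {a : ℝ} (ha : 0 ≤ a)
    (ha1 : a ≤ L) :
    gfUp L z a ≤ (gf L z 0 * gf L z 0 * volume (core L 0)) / z * dgf L z a := by
  set M := (gf L z 0 * gf L z 0 * volume (core L 0)) / z with hM
  have hMz : M * z = gf L z 0 * gf L z 0 * volume (core L 0) := ENNReal.div_mul_cancel hz0 hzt
  have hcore : ∀ a, 0 ≤ a → ∫⁻ p in core L a, gf L z p.1 * gf L z p.2 ≤ M * z := fun a ha => by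
    rw [hMz, ← setLIntegral_const]
    refine (lintegral_mono_set (core_subset L a ha)).trans
      (setLIntegral_mono' (measurableSet_core L 0) fun p hp => ?_)
    exact mul_le_mul' (gf_antitone z hp.1.1.le hp.2.1) (gf_antitone z hp.1.2.1.le hp.2.2)
  have hm := measurable_gf L z
  have hd := measurable_dgf L z
  -- one step of the recursion preserves the bound; it is applied to the partial sums, then to `gf`
  have hstep : ∀ a, 0 ≤ a → a ≤ L → ∀ g : ℝ → ℝ≥0∞, Measurable g →
      (∀ t, 0 < t → t ≤ L → g (t + L) ≤ M * dgf L z t) → (∀ t, g t ≤ gf L z t) →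
      ∫⁻ p in tri (a + L) (2 * L), g p.1 * g p.2 ≤ M * dgf L z a := by
    intro a ha ha1 g hg hup hgf
    rw [lintegral_tri_shift L a (by fun_prop), dgf_eq_add z ha1, mul_add,
      lintegral_add_left (by fun_prop), mul_add]
    refine add_le_add ((lintegral_mono fun p => mul_le_mul' (hgf _) (hgf _)).trans
      (hcore a ha)) (add_le_add ?_ ?_)
    · rw [← lintegral_const_mul _ (by fun_prop)]
      refine setLIntegral_mono' (measurableSet_tri _ _) fun p hp => ?_
      calc g p.1 * g (p.2 + L) ≤ gf L z p.1 * (M * dgf L z p.2) :=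
            mul_le_mul' (hgf _) (hup _ hp.2.1 (tri_subset _ _ hp).2.2)
        _ = _ := by ring
    · rw [← lintegral_const_mul _ (by fun_prop)]
      refine setLIntegral_mono' (measurableSet_tri _ _) fun p hp => ?_
      calc g (p.1 + L) * g p.2 ≤ (M * dgf L z p.1) * gf L z p.2 :=
            mul_le_mul' (hup _ hp.1 (tri_subset _ _ hp).1.2) (hgf _)
        _ = _ := by ring
  have hpart : ∀ N t, 0 < t → t ≤ L → gfPartial L z N (t + L) ≤ M * dgf L z t := by
    intro N
    induction N with
    | zero => intro t _ _; simp [gfPartial]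
    | succ N ih =>
      intro t ht ht1
      refine (gfPartial_succ_le _ _ _ _).trans ?_
      have : ¬ t + L ≤ L := by linarith
      rw [stripEnd, if_neg this, if_neg this, zero_add]
      exact hstep t ht.le ht1 _ (measurable_gfPartial L z N) ih
        fun s => ENNReal.sum_le_tsum _
  exact hstep a ha ha1 _ hm (fun t ht ht1 => gf_le_of_partial fun N => hpart N t ht ht1)
    fun _ => le_rfl

theorem besselSol_two_mul (A : ℝ) {L : ℝ} (hL : 0 < L) :
    besselSol A (2 * L) = psi (4 * (L ^ 2 * A)) / (4 * L ^ 2) := by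
  rw [eq_div_iff (by positivity), show 4 * (L ^ 2 * A) = A * (2 * L) ^ 2 by ring,
    ← besselSol_mul_sq]
  ring

theorem toReal_setLIntegral {S : Set (ℝ × ℝ)} (hS : MeasurableSet S) {g : ℝ × ℝ → ℝ≥0∞}
    (hg : Measurable g) (hfin : ∀ p ∈ S, g p < ⊤) :
    (∫⁻ p in S, g p).toReal = ∫ p in S, (g p).toReal :=
  (integral_toReal hg.aemeasurable ((ae_restrict_iff' hS).2 (Filter.Eventually.of_forall hfin))).symm

theorem integrableOn_tri_mul {a b C : ℝ} {g h : ℝ → ℝ} (hg : Measurable g) (hh : Measurable h)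
    (hgC : ∀ s, 0 ≤ s → s ≤ b → |g s| ≤ C) (hhC : ∀ s, 0 ≤ s → s ≤ b → |h s| ≤ C) :
    IntegrableOn (fun p : ℝ × ℝ => g p.1 * h p.2) (tri a b) := by
  refine Measure.integrableOn_of_bounded (M := C * C) (volume_tri_lt_top _ _).ne
    (by fun_prop) ((ae_restrict_iff' (measurableSet_tri _ _)).2
    (Filter.Eventually.of_forall fun p hp => ?_))
  have hp' := tri_subset _ _ hp
  rw [norm_mul]
  exact mul_le_mul (hgC _ hp'.1.1 hp'.1.2) (hhC _ hp'.2.1 hp'.2.2) (norm_nonneg _)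
    ((abs_nonneg _).trans (hgC _ hp'.1.1 hp'.1.2))

/-- A bounded solution of the homogeneous linear equation vanishes as soon as there is a bounded
solution `ρ ≥ 1` of the equation with source term `1`: this `ρ` makes the integral operator a
contraction for the norm `sup |E| / ρ`. -/
theorem eq_zero_of_homogeneous {L C : ℝ} {f E ρ : ℝ → ℝ} (hf : Measurable f)
    (hρ : Measurable ρ) (hf0 : ∀ s, 0 ≤ s → s ≤ L → 0 ≤ f s) (hfC : ∀ s, 0 ≤ s → s ≤ L → |f s| ≤ C)
    (hEC : ∀ s, 0 ≤ s → s ≤ L → |E s| ≤ C) (hρC : ∀ s, 0 ≤ s → s ≤ L → |ρ s| ≤ C)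
    (hρ1 : ∀ s, 0 ≤ s → s ≤ L → 1 ≤ ρ s)
    (hρeq : ∀ a, 0 ≤ a → a ≤ L → ρ a = 1 +
      ((∫ p in tri a L, f p.1 * ρ p.2) + ∫ p in tri a L, ρ p.1 * f p.2))
    (hEeq : ∀ a, 0 ≤ a → a ≤ L → E a =
      (∫ p in tri a L, f p.1 * E p.2) + ∫ p in tri a L, E p.1 * f p.2)
    {a : ℝ} (ha : 0 ≤ a) (ha1 : a ≤ L) : E a = 0 := by
  have hL : 0 ≤ L := ha.trans ha1
  have hC1 : 1 ≤ C := (hρ1 0 le_rfl hL).trans ((le_abs_self _).trans (hρC 0 le_rfl hL))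
  set γ := 1 - C⁻¹ with hγ
  have hγ0 : 0 ≤ γ := sub_nonneg.2 (inv_le_one_of_one_le₀ hC1)
  have hγ1 : γ < 1 := sub_lt_self _ (by positivity)
  have key : ∀ n : ℕ, ∀ a, 0 ≤ a → a ≤ L → |E a| ≤ C * γ ^ n * ρ a := by
    intro n
    induction n with
    | zero =>
      intro a ha ha1
      have := hEC a ha ha1
      have := hρ1 a ha ha1
      rw [pow_zero, mul_one]
      nlinarith
    | succ n ih =>
      intro a ha ha1
      set D := C * γ ^ n
      have hD : 0 ≤ D := by positivity
      have i1 := integrableOn_tri_mul (a := a) hf hρ hfC hρC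
      have i2 := integrableOn_tri_mul (a := a) hρ hf hρC hfC
      have b1 : ‖∫ p in tri a L, f p.1 * E p.2‖ ≤ ∫ p in tri a L, D * (f p.1 * ρ p.2) := by
        refine norm_integral_le_of_norm_le (i1.const_mul D) ((ae_restrict_iff'
          (measurableSet_tri _ _)).2 (Filter.Eventually.of_forall fun p hp => ?_))
        have hp' := tri_subset _ _ hp
        rw [norm_mul, Real.norm_of_nonneg (hf0 _ hp'.1.1 hp'.1.2)]
        calc f p.1 * ‖E p.2‖ ≤ f p.1 * (D * ρ p.2) :=
              mul_le_mul_of_nonneg_left (ih _ hp'.2.1 hp'.2.2) (hf0 _ hp'.1.1 hp'.1.2)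
          _ = _ := by ring
      have b2 : ‖∫ p in tri a L, E p.1 * f p.2‖ ≤ ∫ p in tri a L, D * (ρ p.1 * f p.2) := by
        refine norm_integral_le_of_norm_le (i2.const_mul D) ((ae_restrict_iff'
          (measurableSet_tri _ _)).2 (Filter.Eventually.of_forall fun p hp => ?_))
        have hp' := tri_subset _ _ hp
        rw [norm_mul, Real.norm_of_nonneg (hf0 _ hp'.2.1 hp'.2.2)]
        calc ‖E p.1‖ * f p.2 ≤ (D * ρ p.1) * f p.2 :=
              mul_le_mul_of_nonneg_right (ih _ hp'.1.1 hp'.1.2) (hf0 _ hp'.2.1 hp'.2.2)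
          _ = _ := by ring
      rw [integral_const_mul] at b1 b2
      rw [hEeq a ha ha1]
      refine (abs_add_le _ _).trans ((add_le_add b1 b2).trans ?_)
      rw [← mul_add, show (∫ p in tri a L, f p.1 * ρ p.2) + ∫ p in tri a L, ρ p.1 * f p.2 = ρ a - 1 by
        rw [hρeq a ha ha1]; ring, pow_succ,
        show C * (γ ^ n * γ) * ρ a = D * (γ * ρ a) by simp only [D]; ring]
      refine mul_le_mul_of_nonneg_left ?_ hD
      have h1 : C⁻¹ * ρ a ≤ 1 := by
        rw [inv_mul_le_iff₀ (by positivity), mul_one]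
        exact (le_abs_self _).trans (hρC a ha ha1)
      rw [hγ]; linarith
  have hlim : Filter.Tendsto (fun n : ℕ => C * γ ^ n * ρ a) Filter.atTop (nhds 0) := by
    simpa using ((tendsto_pow_atTop_nhds_zero_of_lt_one hγ0 hγ1).const_mul C).mul_const (ρ a)
  exact abs_eq_zero.1 (le_antisymm (ge_of_tendsto' hlim fun n => key n a ha ha1) (abs_nonneg _))

theorem natCast_mul_coef_eq {L : ℝ} (hL : 0 < L) {z : ℝ} (h0 : 0 ≤ z) (n : ℕ) :
    ((n + 1 : ℕ) : ℝ≥0∞) * (coef L (n + 1) 0 * ENNReal.ofReal z ^ (n + 1)) =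
      ENNReal.ofReal (z * (((n : ℝ) + 1) * (coef L (n + 1) 0).toReal * z ^ n)) := by
  have e : z * (((n : ℝ) + 1) * (coef L (n + 1) 0).toReal * z ^ n) =
      ((n + 1 : ℕ) : ℝ) * ((coef L (n + 1) 0).toReal * z ^ (n + 1)) := by push_cast; ring
  rw [e, ENNReal.ofReal_mul (Nat.cast_nonneg _), ENNReal.ofReal_mul ENNReal.toReal_nonneg,
    ENNReal.ofReal_natCast, ENNReal.ofReal_toReal (coef_zero_lt_top hL _).ne,
    ENNReal.ofReal_pow h0]

theorem tsum_succ_mul_coef {L : ℝ} (hL : 0 < L) {z : ℝ} (h0 : 0 < z) (h1 : z < critWeight L) :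
    HasSum (fun n : ℕ => z * (((n : ℝ) + 1) * (coef L (n + 1) 0).toReal * z ^ n))
      (z / j0 (L ^ 2 * ampl L z)) := by
  have h := hasDerivAt_ampl hL h0 h1
  have h2 := h.2.1.hasSum
  rw [h.2.2] at h2
  exact h2.mul_left z

theorem dgf_at_zero {L : ℝ} (hL : 0 < L) {z : ℝ} (h0 : 0 < z) (h1 : z < critWeight L) :
    dgf L (ENNReal.ofReal z) 0 = ENNReal.ofReal (z / j0 (L ^ 2 * ampl L z)) := by
  have hs := tsum_succ_mul_coef hL h0 h1
  rw [← hs.tsum_eq, ENNReal.ofReal_tsum_of_nonneg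
    (fun n => by positivity) hs.summable, dgf, tsum_eq_zero_add' ENNReal.summable,
    Nat.cast_zero, zero_mul, zero_add]
  exact tsum_congr fun n => natCast_mul_coef_eq hL h0.le n

/-- The generating function of the blobs without red leaf. The functions `gfUp` and `f (· + L)`,
with `f` the Bessel solution, solve the same linear equation with sources differing by the constant
`f (2 * L)`, and `dgf / z` is the solution for the source `1`. -/
theorem gfUp_zero_eq {L : ℝ} (hL : 0 < L) {z : ℝ} (h0 : 0 < z) (h1 : z < critWeight L) :
    gfUp L (ENNReal.ofReal z) 0 ≠ ⊤ ∧ (gfUp L (ENNReal.ofReal z) 0).toReal =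
      z - psi (4 * (L ^ 2 * ampl L z)) / (4 * L ^ 2) / j0 (L ^ 2 * ampl L z) := by
  obtain ⟨hA0, hAw, hψ, hgf⟩ := ampl_spec hL h0.le h1.le
  set A := ampl L z
  set x := ENNReal.ofReal z with hx
  have hx0 : x ≠ 0 := (ENNReal.ofReal_pos.2 h0).ne'
  have hxt : x ≠ ⊤ := ENNReal.ofReal_ne_top
  let f := besselSol A
  have hfc : Continuous f := continuous_besselSol A
  have hf0 : ∀ s, 0 ≤ s → s ≤ L → 0 ≤ f s := fun s hs hs' =>
    besselSol_nonneg hA0 hs hs' (by rw [mul_comm]; exact hAw)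
  have hgfr : ∀ s, 0 ≤ s → s ≤ L → (gf L x s).toReal = f s := fun s hs hs' => by
    rw [hgf s hs hs', ENNReal.toReal_ofReal (hf0 s hs hs')]
  have hgft : ∀ s, 0 ≤ s → s ≤ L → gf L x s < ⊤ := fun s hs hs' => by
    rw [hgf s hs hs']; exact ENNReal.ofReal_lt_top
  have hd0 : dgf L x 0 = ENNReal.ofReal (z / j0 (L ^ 2 * A)) := dgf_at_zero hL h0 h1
  have hdt : ∀ s, 0 ≤ s → s ≤ L → dgf L x s < ⊤ := fun s hs hs' =>
    (dgf_antitone x hs hs').trans_lt (by rw [hd0]; exact ENNReal.ofReal_lt_top)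
  have hut : ∀ s, 0 ≤ s → s ≤ L → gfUp L x s < ⊤ := fun s hs hs' => by
    refine (gfUp_le hx0 hxt hs hs').trans_lt (ENNReal.mul_lt_top ?_ (hdt s hs hs'))
    exact ENNReal.div_lt_top (ENNReal.mul_lt_top (ENNReal.mul_lt_top (hgft 0 le_rfl hL.le)
      (hgft 0 le_rfl hL.le)) (volume_core_lt_top _ _)).ne hx0
  have hgm := measurable_gf L x
  have hdm := measurable_dgf L x
  have hum : Measurable (gfUp L x) :=
    (show Antitone (gfUp L x) from fun a b hab => gfUp_antitone x hab).measurable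
  let k : ℝ → ℝ := fun s => (gfUp L x s).toReal
  let ρ : ℝ → ℝ := fun s => (dgf L x s).toReal / z
  -- a solution of the homogeneous equation, which has to vanish
  let E : ℝ → ℝ := fun s => k s - f (s + L) + f (2 * L) * ρ s
  have hkm : Measurable k := hum.ennreal_toReal
  have hρm : Measurable ρ := hdm.ennreal_toReal.div_const z
  have hk0 : ∀ s, 0 ≤ k s := fun s => ENNReal.toReal_nonneg
  have hρ0 : ∀ s, 0 ≤ ρ s := fun s => by positivity
  -- a common bound
  obtain ⟨C1, hC1⟩ := (isCompact_Icc (a := (0 : ℝ)) (b := L + L)).exists_bound_of_continuousOn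
    hfc.continuousOn
  have hkC : ∀ s, 0 ≤ s → s ≤ L → |k s| ≤ k 0 := fun s hs hs' => by
    rw [abs_of_nonneg (hk0 s)]
    exact ENNReal.toReal_mono (hut 0 le_rfl hL.le).ne (gfUp_antitone x hs)
  have hρC : ∀ s, 0 ≤ s → s ≤ L → |ρ s| ≤ ρ 0 := fun s hs hs' => by
    rw [abs_of_nonneg (hρ0 s)]
    exact div_le_div_of_nonneg_right
      (ENNReal.toReal_mono (hdt 0 le_rfl hL.le).ne (dgf_antitone x hs hs')) h0.le
  have hC10 : 0 ≤ C1 := (norm_nonneg _).trans (hC1 0 ⟨le_rfl, by linarith⟩)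
  set C := C1 + k 0 + ρ 0 + |f (2 * L)| * ρ 0 with hC
  have hCpos : 0 ≤ |f (2 * L)| * ρ 0 := mul_nonneg (abs_nonneg _) (hρ0 0)
  have hfC' : ∀ s, 0 ≤ s → s ≤ L → |f s| ≤ C := fun s hs hs' => by
    have := hC1 s ⟨hs, by linarith⟩
    rw [Real.norm_eq_abs] at this
    linarith [hk0 0, hρ0 0]
  have hfC2 : ∀ s, 0 ≤ s → s ≤ L → |f (s + L)| ≤ C := fun s hs hs' => by
    have := hC1 (s + L) ⟨by linarith, by linarith⟩
    rw [Real.norm_eq_abs] at this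
    linarith [hk0 0, hρ0 0]
  have hkC' : ∀ s, 0 ≤ s → s ≤ L → |k s| ≤ C := fun s hs hs' => by
    linarith [hkC s hs hs', hρ0 0]
  have hρC' : ∀ s, 0 ≤ s → s ≤ L → |ρ s| ≤ C := fun s hs hs' => by
    linarith [hρC s hs hs', hk0 0]
  have hEC : ∀ s, 0 ≤ s → s ≤ L → |E s| ≤ C := fun s hs hs' => by
    have h2 := hC1 (s + L) ⟨by linarith, by linarith⟩
    rw [Real.norm_eq_abs] at h2
    have h3 : |f (2 * L) * ρ s| ≤ |f (2 * L)| * ρ 0 := by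
      rw [abs_mul]; exact mul_le_mul_of_nonneg_left (hρC s hs hs') (abs_nonneg _)
    have h4 : |E s| ≤ |k s| + |f (s + L)| + |f (2 * L) * ρ s| :=
      (abs_add_le _ _).trans (add_le_add (abs_sub _ _) le_rfl)
    linarith [hkC s hs hs', hρ0 0]
  -- the three equations
  have hρeq : ∀ a, 0 ≤ a → a ≤ L → ρ a = 1 +
      ((∫ p in tri a L, f p.1 * ρ p.2) + ∫ p in tri a L, ρ p.1 * f p.2) := by
    intro a ha ha1
    have h := congrArg ENNReal.toReal (dgf_eq_add x ha1)
    have hfin := hdt a ha ha1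
    rw [dgf_eq_add x ha1] at hfin
    have hfin2 := (ENNReal.add_lt_top.1 hfin).2
    rw [lintegral_add_left (by fun_prop)] at h hfin2
    have hfin3 := ENNReal.add_lt_top.1 hfin2
    rw [ENNReal.toReal_add hxt hfin2.ne, ENNReal.toReal_add hfin3.1.ne hfin3.2.ne,
      toReal_setLIntegral (measurableSet_tri _ _) (by fun_prop) (fun p hp =>
        have hp' := tri_subset _ _ hp
        ENNReal.mul_lt_top (hgft _ hp'.1.1 hp'.1.2) (hdt _ hp'.2.1 hp'.2.2)),
      toReal_setLIntegral (measurableSet_tri _ _) (by fun_prop) (fun p hp =>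
        have hp' := tri_subset _ _ hp
        ENNReal.mul_lt_top (hdt _ hp'.1.1 hp'.1.2) (hgft _ hp'.2.1 hp'.2.2)),
      hx, ENNReal.toReal_ofReal h0.le, ← hx] at h
    have e1 : ∫ p in tri a L, (gf L x p.1 * dgf L x p.2).toReal =
        z * ∫ p in tri a L, f p.1 * ρ p.2 := by
      rw [← integral_const_mul]
      refine setIntegral_congr_fun (measurableSet_tri _ _) fun p hp => ?_
      have hp' := tri_subset _ _ hp
      simp only [ENNReal.toReal_mul, hgfr _ hp'.1.1 hp'.1.2, ρ]
      field_simp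
    have e2 : ∫ p in tri a L, (dgf L x p.1 * gf L x p.2).toReal =
        z * ∫ p in tri a L, ρ p.1 * f p.2 := by
      rw [← integral_const_mul]
      refine setIntegral_congr_fun (measurableSet_tri _ _) fun p hp => ?_
      have hp' := tri_subset _ _ hp
      simp only [ENNReal.toReal_mul, hgfr _ hp'.2.1 hp'.2.2, ρ]
      field_simp
    rw [e1, e2] at h
    change (dgf L x a).toReal / z = _
    rw [h, div_eq_iff h0.ne']
    ring
  have hkeq : ∀ a, 0 ≤ a → a ≤ L → k a = (∫ p in core L a, f p.1 * f p.2) +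
      ((∫ p in tri a L, f p.1 * k p.2) + ∫ p in tri a L, k p.1 * f p.2) := by
    intro a ha ha1
    have h := congrArg ENNReal.toReal (gfUp_eq_add L x a)
    have hfin := hut a ha ha1
    rw [gfUp_eq_add L x a] at hfin
    have hfin2 := ENNReal.add_lt_top.1 hfin
    have hfin3 := ENNReal.add_lt_top.1 hfin2.2
    rw [ENNReal.toReal_add hfin2.1.ne hfin2.2.ne, ENNReal.toReal_add hfin3.1.ne hfin3.2.ne,
      toReal_setLIntegral (measurableSet_core _ _) (by fun_prop) (fun p hp =>
        ENNReal.mul_lt_top (hgft _ hp.1.1.le hp.2.1) (hgft _ hp.1.2.1.le hp.2.2)),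
      toReal_setLIntegral (measurableSet_tri _ _) (by fun_prop) (fun p hp =>
        have hp' := tri_subset _ _ hp
        ENNReal.mul_lt_top (hgft _ hp'.1.1 hp'.1.2) (hut _ hp'.2.1 hp'.2.2)),
      toReal_setLIntegral (measurableSet_tri _ _) (by fun_prop) (fun p hp =>
        have hp' := tri_subset _ _ hp
        ENNReal.mul_lt_top (hut _ hp'.1.1 hp'.1.2) (hgft _ hp'.2.1 hp'.2.2))] at h
    simp only [k]
    rw [h]
    congr 1
    · refine setIntegral_congr_fun (measurableSet_core _ _) fun p hp => ?_
      simp only [ENNReal.toReal_mul, hgfr _ hp.1.1.le hp.2.1, hgfr _ hp.1.2.1.le hp.2.2]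
    · congr 1
      · refine setIntegral_congr_fun (measurableSet_tri _ _) fun p hp => ?_
        have hp' := tri_subset _ _ hp
        simp only [ENNReal.toReal_mul, hgfr _ hp'.1.1 hp'.1.2]
      · refine setIntegral_congr_fun (measurableSet_tri _ _) fun p hp => ?_
        have hp' := tri_subset _ _ hp
        simp only [ENNReal.toReal_mul, hgfr _ hp'.2.1 hp'.2.2]
  have hfeq : ∀ a, 0 ≤ a → a ≤ L → f (a + L) = f (2 * L) + ((∫ p in core L a, f p.1 * f p.2) +
      ((∫ p in tri a L, f p.1 * f (p.2 + L)) + ∫ p in tri a L, f (p.1 + L) * f p.2)) := by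
    intro a ha ha1
    have h := integral_besselSol_mul_strip A (a := a + L) (b := 2 * L) (by linarith) (by linarith)
    rw [integral_tri_shift L a (show Continuous fun p : ℝ × ℝ => f p.1 * f p.2 by fun_prop)] at h
    simp only [f] at h ⊢
    linarith
  have hEeq : ∀ a, 0 ≤ a → a ≤ L → E a =
      (∫ p in tri a L, f p.1 * E p.2) + ∫ p in tri a L, E p.1 * f p.2 := by
    intro a ha ha1
    have hfm := hfc.measurable
    have hfm2 : Measurable fun s => f (s + L) := hfm.comp (measurable_id.add_const L)
    have i1 := integrableOn_tri_mul (a := a) hfm hkm hfC' hkC'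
    have i2 := integrableOn_tri_mul (a := a) hfm hfm2 hfC' hfC2
    have i3 := integrableOn_tri_mul (a := a) hfm hρm hfC' hρC'
    have i4 := integrableOn_tri_mul (a := a) hkm hfm hkC' hfC'
    have i5 := integrableOn_tri_mul (a := a) hfm2 hfm hfC2 hfC'
    have i6 := integrableOn_tri_mul (a := a) hρm hfm hρC' hfC'
    have e1 : ∫ p in tri a L, f p.1 * E p.2 = (∫ p in tri a L, f p.1 * k p.2) -
        (∫ p in tri a L, f p.1 * f (p.2 + L)) + f (2 * L) * ∫ p in tri a L, f p.1 * ρ p.2 := by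
      rw [← integral_const_mul, ← integral_sub i1 i2]
      refine Eq.trans ?_ (integral_add (i1.sub i2) (i3.const_mul (f (2 * L))))
      refine integral_congr_ae (Filter.Eventually.of_forall fun p => ?_)
      simp only [E]; ring
    have e2 : ∫ p in tri a L, E p.1 * f p.2 = (∫ p in tri a L, k p.1 * f p.2) -
        (∫ p in tri a L, f (p.1 + L) * f p.2) + f (2 * L) * ∫ p in tri a L, ρ p.1 * f p.2 := by
      rw [← integral_const_mul, ← integral_sub i4 i5]
      refine Eq.trans ?_ (integral_add (i4.sub i5) (i6.const_mul (f (2 * L))))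
      refine integral_congr_ae (Filter.Eventually.of_forall fun p => ?_)
      simp only [E]; ring
    rw [e1, e2]
    simp only [E]
    rw [hkeq a ha ha1, hfeq a ha ha1, hρeq a ha ha1]
    ring
  have hρ1 : ∀ s, 0 ≤ s → s ≤ L → 1 ≤ ρ s := fun s hs hs' => by
    rw [hρeq s hs hs']
    have j1 : 0 ≤ ∫ p in tri s L, f p.1 * ρ p.2 :=
      setIntegral_nonneg (measurableSet_tri _ _) fun p hp => by
        have hp' := tri_subset _ _ hp
        exact mul_nonneg (hf0 _ hp'.1.1 hp'.1.2) (hρ0 _)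
    have j2 : 0 ≤ ∫ p in tri s L, ρ p.1 * f p.2 :=
      setIntegral_nonneg (measurableSet_tri _ _) fun p hp => by
        have hp' := tri_subset _ _ hp
        exact mul_nonneg (hρ0 _) (hf0 _ hp'.2.1 hp'.2.2)
    linarith
  have hE := eq_zero_of_homogeneous hfc.measurable hρm hf0 hfC' hEC hρC' hρ1 hρeq hEeq
    le_rfl hL.le
  refine ⟨(hut 0 le_rfl hL.le).ne, ?_⟩
  have hj : 0 < j0 (L ^ 2 * A) := j0_pos (by positivity) (ampl_lt hL h0.le h1)
  have hfL : f L = z := by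
    have h : f L * L ^ 2 = psi (A * L ^ 2) := besselSol_mul_sq A L
    rw [mul_comm A, hψ, mul_comm (f L)] at h
    exact mul_left_cancel₀ (by positivity) h
  simp only [E, ρ, zero_add, hd0, hfL] at hE
  rw [ENNReal.toReal_ofReal (by positivity)] at hE
  rw [← besselSol_two_mul A hL]
  change k 0 = _
  have : f (2 * L) * (z / j0 (L ^ 2 * A) / z) = besselSol A (2 * L) / j0 (L ^ 2 * A) := by
    simp only [f]; field_simp
  rw [this] at hE
  linarith

/-! ### The generating function of the offspring weights -/

/-- The total volume of the blobs with `k` non-root cut-edges and no red leaf. -/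
def redFree (k : ℕ) : ℝ≥0∞ :=
  ∫⁻ p in tri (Real.pi / 2) (2 * (Real.pi / 2)), coefConv (Real.pi / 2) k p

/-- The coefficients of the blob generating function at red weight `x_c`. -/
def blobCoef (k : ℕ) : ℝ :=
  (redFree k).toReal + xc * (((k : ℝ) + 1) * (coef (Real.pi / 2) (k + 1) 0).toReal)

theorem half_pi_pos : 0 < Real.pi / 2 := by have := Real.pi_pos; positivity

theorem critWeight_half_pi : critWeight (Real.pi / 2) = 4 * xc := by
  rw [critWeight, xc_eq]; have := Real.pi_pos; field_simp; norm_num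

/-- The value `F(x_c; π/2)` in closed form. -/
def qv : ℝ := 4 * psi (w0 / 4) / Real.pi ^ 2

theorem qv_pos : 0 < qv := by
  have := psi_pos (w := w0 / 4) (by have := w0_pos; positivity) (by have := w0_pos; linarith)
  have := Real.pi_pos
  unfold qv; positivity

theorem qv_lt : qv < 4 * xc := by
  have hw := w0_pos
  have := psi_strictMonoOn ⟨by positivity, by linarith⟩ ⟨hw.le, le_rfl⟩
    (show w0 / 4 < w0 by linarith)
  have hpi := Real.pi_pos
  rw [xc_eq, qv, ← mul_div_assoc]
  gcongr

theorem ampl_qv : ampl (Real.pi / 2) qv = w0 / Real.pi ^ 2 := by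
  have hw := w0_pos
  have hpi := Real.pi_pos
  obtain ⟨hA, hA1, hψ, -⟩ := ampl_spec half_pi_pos qv_pos.le
    (by rw [critWeight_half_pi]; exact qv_lt.le)
  have h : (Real.pi / 2) ^ 2 * qv = psi (w0 / 4) := by unfold qv; field_simp; norm_num
  rw [h] at hψ
  have := psi_strictMonoOn.injOn ⟨by positivity, hA1⟩ ⟨by positivity, by linarith⟩ hψ
  rw [eq_div_iff (by positivity)]
  linarith

theorem tsum_redFree (z : ℝ≥0∞) : ∑' k, redFree k * z ^ k = gfUp (Real.pi / 2) z 0 := by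
  rw [gfUp, zero_add]
  simp_rw [redFree, ← lintegral_mul_const _ (measurable_coefConv _ _)]
  rw [← lintegral_tsum (fun n => ((measurable_coefConv _ n).mul_const _).aemeasurable)]
  exact lintegral_congr fun p => tsum_coefConv _ z p

theorem redFree_ne_top (k : ℕ) : redFree k ≠ ⊤ := by
  intro htop
  have h := (gfUp_zero_eq half_pi_pos qv_pos (by rw [critWeight_half_pi]; exact qv_lt)).1
  refine h (top_le_iff.1 ?_)
  rw [← tsum_redFree]
  refine le_trans ?_ (ENNReal.le_tsum k)
  rw [htop, ENNReal.top_mul (pow_ne_zero _ (ENNReal.ofReal_pos.2 qv_pos).ne')]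

theorem blobCoef_nonneg (k : ℕ) : 0 ≤ blobCoef k := by
  have := xc_pos
  unfold blobCoef; positivity

/-- The inverse function `y` of `z ↦ 4 ψ(y) / π²`: the blob generating function is explicit in
terms of it. -/
def yv (z : ℝ) : ℝ := (Real.pi / 2) ^ 2 * ampl (Real.pi / 2) z

/-- At `z = q` one has `4 * yv z = w0`, the first zero of `j0`, and the numerator vanishes: this is
why the offspring law has mass and mean one. -/
theorem hasSum_blobCoef {z : ℝ} (h0 : 0 < z) (h1 : z < 4 * xc) :
    HasSum (fun k => blobCoef k * z ^ k)
      (z + (xc - psi (4 * yv z) / Real.pi ^ 2) / j0 (yv z)) := by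
  rw [← critWeight_half_pi] at h1
  obtain ⟨hne, hval⟩ := gfUp_zero_eq half_pi_pos h0 h1
  rw [← tsum_redFree] at hne hval
  have e : ∀ k, (redFree k * ENNReal.ofReal z ^ k).toReal = (redFree k).toReal * z ^ k :=
    fun k => by rw [ENNReal.toReal_mul, ENNReal.toReal_pow, ENNReal.toReal_ofReal h0.le]
  have hs1 := (ENNReal.summable_toReal hne).hasSum
  rw [← ENNReal.tsum_toReal_eq (fun k => ENNReal.mul_ne_top (redFree_ne_top k)
    (ENNReal.pow_ne_top ENNReal.ofReal_ne_top)), hval] at hs1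
  simp_rw [e] at hs1
  have hs2 := (tsum_succ_mul_coef half_pi_pos h0 h1).mul_left (xc / z)
  have hpi := Real.pi_pos
  convert hs1.add hs2 using 1
  · funext k
    unfold blobCoef
    field_simp
  · unfold yv
    rw [show 4 * (Real.pi / 2) ^ 2 = Real.pi ^ 2 by ring]
    field_simp
    ring

theorem yv_qv : yv qv = w0 / 4 := by
  have := Real.pi_pos
  rw [yv, ampl_qv]; field_simp; ring

theorem j0_yv_pos {z : ℝ} (h0 : 0 < z) (h1 : z < 4 * xc) : 0 < j0 (yv z) := by
  rw [← critWeight_half_pi] at h1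
  exact j0_pos (mul_nonneg (by positivity) (ampl_spec half_pi_pos h0.le h1.le).1)
    (ampl_lt half_pi_pos h0.le h1)

theorem hasDerivAt_yv {z : ℝ} (h0 : 0 < z) (h1 : z < 4 * xc) :
    HasDerivAt yv (Real.pi ^ 2 / 4 / j0 (yv z)) z := by
  rw [← critWeight_half_pi] at h1
  obtain ⟨h, -, h'⟩ := hasDerivAt_ampl half_pi_pos h0 h1
  rw [h'] at h
  refine (h.const_mul ((Real.pi / 2) ^ 2)).congr_deriv ?_
  rw [yv, div_eq_mul_inv (Real.pi ^ 2 / 4)]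
  ring

theorem hasDerivAt_blobGen {z : ℝ} (h0 : 0 < z) (h1 : z < 4 * xc) :
    HasDerivAt (fun z => z + (xc - psi (4 * yv z) / Real.pi ^ 2) / j0 (yv z))
      (1 - j0 (4 * yv z) / j0 (yv z) ^ 2 + (xc - psi (4 * yv z) / Real.pi ^ 2) *
        (Real.pi ^ 2 / 4 * j1 (yv z) / j0 (yv z) ^ 3)) z := by
  have hy := hasDerivAt_yv h0 h1
  have hj := j0_yv_pos h0 h1
  have hpi := Real.pi_pos
  have h4 : HasDerivAt (fun z => psi (4 * yv z))
      (j0 (4 * yv z) * (4 * (Real.pi ^ 2 / 4 / j0 (yv z)))) z :=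
    (hasDerivAt_psi _).comp z (hy.const_mul 4)
  have hj0 : HasDerivAt (fun z => j0 (yv z)) (-j1 (yv z) * (Real.pi ^ 2 / 4 / j0 (yv z))) z :=
    (hasDerivAt_j0 _).comp z hy
  have h := (hasDerivAt_id z).add (((h4.div_const (Real.pi ^ 2)).const_sub xc).div hj0 hj.ne')
  refine h.congr_deriv ?_
  field_simp
  ring

/-- The second derivative of the blob generating function at `q`: both `x_c - ψ(4y) / π²` and
`j0 (4y)` vanish there. -/
theorem hasDerivAt_blobGen_deriv :
    HasDerivAt (fun z => 1 - j0 (4 * yv z) / j0 (yv z) ^ 2 +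
      (xc - psi (4 * yv z) / Real.pi ^ 2) * (Real.pi ^ 2 / 4 * j1 (yv z) / j0 (yv z) ^ 3))
      (Real.pi ^ 2 * j1 w0 / j0 (w0 / 4) ^ 3) qv := by
  have hy := hasDerivAt_yv qv_pos qv_lt
  have hj := j0_yv_pos qv_pos qv_lt
  have hpi := Real.pi_pos
  have hw : 4 * yv qv = w0 := by rw [yv_qv]; ring
  have hN : xc - psi (4 * yv qv) / Real.pi ^ 2 = 0 := by rw [hw, xc_eq, sub_self]
  have h4 : HasDerivAt (fun z => psi (4 * yv z))
      (j0 (4 * yv qv) * (4 * (Real.pi ^ 2 / 4 / j0 (yv qv)))) qv :=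
    (hasDerivAt_psi _).comp qv (hy.const_mul 4)
  rw [hw, j0_w0, zero_mul] at h4
  have hj4 : HasDerivAt (fun z => j0 (4 * yv z))
      (-j1 (4 * yv qv) * (4 * (Real.pi ^ 2 / 4 / j0 (yv qv)))) qv :=
    (hasDerivAt_j0 _).comp qv (hy.const_mul 4)
  have hj0 : HasDerivAt (fun z => j0 (yv z)) (-j1 (yv qv) * (Real.pi ^ 2 / 4 / j0 (yv qv))) qv :=
    (hasDerivAt_j0 _).comp qv hy
  have hW : DifferentiableAt ℝ (fun z => Real.pi ^ 2 / 4 * j1 (yv z) / j0 (yv z) ^ 3) qv := by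
    have hj1 : DifferentiableAt ℝ (fun z => j1 (yv z)) qv :=
      (differentiable_j1 _).comp qv hy.differentiableAt
    exact (hj1.const_mul _).div (hj0.differentiableAt.pow 3) (pow_ne_zero 3 hj.ne')
  have h := ((hj4.div (hj0.pow 2) (pow_ne_zero 2 hj.ne')).const_sub 1).add
    (((h4.div_const (Real.pi ^ 2)).const_sub xc).mul hW.hasDerivAt)
  refine h.congr_deriv ?_
  rw [hN, hw, j0_w0]
  have hj' : 0 < j0 (w0 / 4) := yv_qv ▸ hj
  simp only [Pi.pow_apply, yv_qv]
  field_simp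
  simp
  ring

/-! ### Moments -/

theorem hasSum_of_eq {f g : ℕ → ℝ} {a b : ℝ} (h : HasSum f a) (hf : g = f) (ha : b = a) :
    HasSum g b := by rw [hf, ha]; exact h

/-- `p_k` in terms of the blob coefficients. -/
def pv (k : ℕ) : ℝ := blobCoef k * qv ^ k / qv

theorem pv_nonneg (k : ℕ) : 0 ≤ pv k := by
  have := qv_pos
  have := blobCoef_nonneg k
  unfold pv; positivity

theorem hasSum_pv : HasSum pv 1 := by
  have h := (hasSum_blobCoef qv_pos qv_lt).div_const qv
  rw [yv_qv, show 4 * (w0 / 4) = w0 by ring, ← xc_eq, sub_self, zero_div, add_zero,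
    div_self qv_pos.ne'] at h
  exact h

theorem summable_blobCoef_abs {r : ℝ} (h0 : 0 < r) (h1 : r < 4 * xc) :
    Summable fun k => |blobCoef k| * r ^ k :=
  (hasSum_blobCoef h0 h1).summable.congr fun k => by rw [abs_of_nonneg (blobCoef_nonneg k)]

theorem hasSum_deriv_blobCoef {z : ℝ} (h0 : 0 < z) (h1 : z < 4 * xc) :
    (Summable fun n : ℕ => |((n : ℝ) + 1) * blobCoef (n + 1)| * z ^ n) ∧
    ∑' n : ℕ, ((n : ℝ) + 1) * blobCoef (n + 1) * z ^ n =
      1 - j0 (4 * yv z) / j0 (yv z) ^ 2 + (xc - psi (4 * yv z) / Real.pi ^ 2) *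
        (Real.pi ^ 2 / 4 * j1 (yv z) / j0 (yv z) ^ 3) := by
  obtain ⟨r, hr1, hr2⟩ := exists_between h1
  have h := hasDerivAt_powerSeries (summable_blobCoef_abs (h0.trans hr1) hr2)
    (z := z) (by rwa [abs_of_pos h0])
  refine ⟨by have := h.2; rwa [abs_of_pos h0] at this, ?_⟩
  refine h.1.unique ((hasDerivAt_blobGen h0 h1).congr_of_eventuallyEq ?_)
  filter_upwards [Ioo_mem_nhds h0 h1] with x hx
  exact (hasSum_blobCoef hx.1 hx.2).tsum_eq

theorem hasSum_mul_pv : HasSum (fun k : ℕ => (k : ℝ) * pv k) 1 := by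
  obtain ⟨hs, ht⟩ := hasSum_deriv_blobCoef qv_pos qv_lt
  have hs' : Summable fun n : ℕ => ((n : ℝ) + 1) * blobCoef (n + 1) * qv ^ n :=
    hs.congr fun n => by
      have := blobCoef_nonneg (n + 1)
      rw [abs_of_nonneg (by positivity)]
  have h := hs'.hasSum
  rw [ht, yv_qv, show 4 * (w0 / 4) = w0 by ring, ← xc_eq, sub_self, zero_mul, j0_w0, zero_div,
    add_zero, sub_zero] at h
  rw [← hasSum_nat_add_iff' 1]
  have hq := qv_pos
  refine hasSum_of_eq h ?_ ?_
  · funext n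
    unfold pv
    rw [pow_succ]
    push_cast
    field_simp
  · simp

/-- The second factorial moment. -/
theorem hasSum_mul_mul_pv : HasSum (fun k : ℕ => ((k : ℝ) * (k - 1)) * pv k)
    (qv * (Real.pi ^ 2 * j1 w0 / j0 (w0 / 4) ^ 3)) := by
  obtain ⟨r, hr1, hr2⟩ := exists_between qv_lt
  have hr0 := qv_pos.trans hr1
  have h := hasDerivAt_powerSeries (c := fun n : ℕ => ((n : ℝ) + 1) * blobCoef (n + 1))
    (hasSum_deriv_blobCoef hr0 hr2).1 (z := qv) (by rwa [abs_of_pos qv_pos])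
  have hd := h.1.unique (hasDerivAt_blobGen_deriv.congr_of_eventuallyEq (by
    filter_upwards [Ioo_mem_nhds qv_pos qv_lt] with x hx
    exact (hasSum_deriv_blobCoef hx.1 hx.2).2))
  have hs : Summable fun n : ℕ => ((n : ℝ) + 1) * (((n + 1 : ℕ) : ℝ) + 1) * blobCoef (n + 1 + 1) *
      qv ^ n := h.2.congr fun n => by
    have := blobCoef_nonneg (n + 1 + 1)
    have := qv_pos
    rw [abs_of_pos qv_pos, abs_of_nonneg (by positivity)]
    ring
  have h2 := hs.hasSum
  have hd' : ∑' n : ℕ, ((n : ℝ) + 1) * (((n + 1 : ℕ) : ℝ) + 1) * blobCoef (n + 1 + 1) * qv ^ n =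
      Real.pi ^ 2 * j1 w0 / j0 (w0 / 4) ^ 3 := by
    rw [← hd]
    exact tsum_congr fun n => by ring
  rw [hd'] at h2
  rw [← hasSum_nat_add_iff' 2]
  have hq := qv_pos
  refine hasSum_of_eq (h2.mul_left qv) ?_ ?_
  · funext n
    unfold pv
    push_cast
    rw [show n + 2 = n + 1 + 1 by ring, pow_succ, pow_succ]
    field_simp
    ring
  · simp [Finset.sum_range_succ]

/-- The variance: second factorial moment, minus mean, plus one. -/
theorem hasSum_sq_mul_pv : HasSum (fun k : ℕ => ((k : ℝ) - 1) ^ 2 * pv k)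
    (2 * (besselJ 1 (c0 / 2) * besselJ 1 c0) / besselJ 0 (c0 / 2) ^ 3) := by
  have h := (hasSum_mul_mul_pv.sub hasSum_mul_pv).add hasSum_pv
  refine hasSum_of_eq h ?_ ?_
  · funext k; ring
  · rw [besselJ_one_eq, besselJ_one_eq, besselJ_zero_eq, show (c0 / 2) ^ 2 / 4 = w0 / 4 by
      unfold w0; ring, show c0 ^ 2 / 4 = w0 from rfl, qv, psi]
    have hpi := Real.pi_pos
    have hw : c0 ^ 2 = 4 * w0 := by unfold w0; ring
    field_simp
    rw [hw]
    ring

/-- The blob generating function converges beyond `q`. -/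
theorem exists_exp_moment_pv : ∃ t : ℝ, 0 < t ∧ Summable fun k : ℕ => Real.exp (t * k) * pv k := by
  obtain ⟨r, hr1, hr2⟩ := exists_between qv_lt
  have hq := qv_pos
  have hr0 := hq.trans hr1
  refine ⟨Real.log (r / qv), Real.log_pos ((one_lt_div hq).2 hr1), ?_⟩
  refine ((hasSum_blobCoef hr0 hr2).summable.div_const qv).congr fun k => ?_
  rw [mul_comm (Real.log _), Real.exp_nat_mul, Real.exp_log (by positivity), pv, div_pow]
  field_simp

/-! ### Exponential decay -/

/-- If `p_k` is eventually between the `k`-th powers of any two numbers around `l`, then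
`p_k = l ^ (k + o(k))`. -/
theorem exists_isLittleO_exponent {p : ℕ → ℝ} {l : ℝ} (h0 : 0 < l) (h1 : l < 1)
    (hup : ∀ μ, l < μ → ∀ᶠ k : ℕ in Filter.atTop, p k ≤ μ ^ k)
    (hlo : ∀ μ, 0 < μ → μ < l → ∀ᶠ k : ℕ in Filter.atTop, μ ^ k ≤ p k) :
    ∃ ε : ℕ → ℝ, (ε =o[Filter.atTop] fun k : ℕ => (k : ℝ)) ∧
      ∀ᶠ k : ℕ in Filter.atTop, p k = l ^ ((k : ℝ) + ε k) := by
  have hlog : Real.log l < 0 := Real.log_neg h0 h1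
  refine ⟨fun k => Real.log (p k) / Real.log l - k, ?_, ?_⟩
  · rw [Asymptotics.isLittleO_iff]
    intro δ hδ
    have hup' := hup (l ^ (1 - δ)) (by
      calc l = l ^ (1 : ℝ) := (Real.rpow_one l).symm
        _ < l ^ (1 - δ) := Real.rpow_lt_rpow_of_exponent_gt h0 h1 (by linarith))
    have hlo' := hlo (l ^ (1 + δ)) (by positivity) (by
      calc l ^ (1 + δ) < l ^ (1 : ℝ) := Real.rpow_lt_rpow_of_exponent_gt h0 h1 (by linarith)
        _ = l := Real.rpow_one l)
    filter_upwards [hup', hlo'] with k hk1 hk2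
    have hp : 0 < p k := lt_of_lt_of_le (by positivity) hk2
    have e1 := Real.log_le_log hp hk1
    have e2 := Real.log_le_log (by positivity) hk2
    rw [Real.log_pow, Real.log_rpow h0] at e1 e2
    have f1 : (k : ℝ) * (1 - δ) ≤ Real.log (p k) / Real.log l := by
      rw [le_div_iff_of_neg hlog]; linarith
    have f2 : Real.log (p k) / Real.log l ≤ (k : ℝ) * (1 + δ) := by
      rw [div_le_iff_of_neg hlog]; linarith
    rw [Real.norm_eq_abs, Real.norm_of_nonneg (Nat.cast_nonneg k), abs_le]
    constructor <;> linarith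
  · filter_upwards [hlo (l / 2) (by positivity) (by linarith)] with k hk
    have hp : 0 < p k := lt_of_lt_of_le (by positivity) hk
    rw [add_sub_cancel, Real.rpow_def_of_pos h0, mul_div_cancel₀ _ hlog.ne, Real.exp_log hp]

/-- The upper bound holds because the blob generating function converges below `4 * xc`, the lower
bound because its part with a red leaf already has the coefficients of a series of radius
`4 * xc`. -/
theorem exists_pv_eq_rpow : ∃ ε : ℕ → ℝ, (ε =o[Filter.atTop] fun k : ℕ => (k : ℝ)) ∧
    ∀ᶠ k : ℕ in Filter.atTop, pv k = (qv / (4 * xc)) ^ ((k : ℝ) + ε k) := by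
  have hq := qv_pos
  have hx := xc_pos
  refine exists_isLittleO_exponent (by positivity) ((div_lt_one (by positivity)).2 qv_lt) ?_ ?_
  · intro μ hμ
    have hμ0 : 0 < μ := lt_trans (by positivity) hμ
    have hz : qv / μ < 4 * xc := by
      rw [div_lt_iff₀ (by positivity)] at hμ ⊢; linarith
    have h := (hasSum_blobCoef (z := qv / μ) (by positivity) hz).summable.tendsto_atTop_zero
    filter_upwards [h.eventually_le_const hq] with k hk
    rw [div_pow, mul_div_assoc', div_le_iff₀ (by positivity)] at hk
    rw [pv, div_le_iff₀ hq]
    linarith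
  · intro μ hμ0 hμ
    have hz : critWeight (Real.pi / 2) < qv / μ := by
      rw [critWeight_half_pi, lt_div_iff₀ hμ0]
      rw [lt_div_iff₀ (by positivity)] at hμ; linarith
    have h := (Filter.tendsto_add_atTop_nat 1).eventually
      (eventually_one_le_coef_mul_pow half_pi_pos hz)
    have hlarge : ∀ᶠ k : ℕ in Filter.atTop, qv * (qv / μ) / xc ≤ k :=
      tendsto_natCast_atTop_atTop.eventually_ge_atTop _
    filter_upwards [h, hlarge] with k h1 h2
    rw [div_le_iff₀ hx] at h2
    set a := (coef (Real.pi / 2) (k + 1) 0).toReal with ha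
    have ha0 : 0 ≤ a := ENNReal.toReal_nonneg
    have hc : xc * (((k : ℝ) + 1) * a) ≤ blobCoef k :=
      le_add_of_nonneg_left ENNReal.toReal_nonneg
    rw [pv, le_div_iff₀ hq]
    have h3 : 1 ≤ a * (qv / μ) * (qv / μ) ^ k := by
      calc (1 : ℝ) ≤ a * (qv / μ) ^ (k + 1) := h1
        _ = _ := by rw [pow_succ]; ring
    have h4 : μ ^ k * 1 ≤ μ ^ k * (a * (qv / μ) * (qv / μ) ^ k) := by gcongr
    have h5 : μ ^ k * (a * (qv / μ) * (qv / μ) ^ k) = a * (qv / μ) * qv ^ k := by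
      rw [div_pow]; field_simp
    calc μ ^ k * qv ≤ (a * (qv / μ) * qv ^ k) * qv := by
          rw [← h5]; rw [mul_one] at h4; gcongr
      _ = (a * qv ^ k) * (qv * (qv / μ)) := by ring
      _ ≤ (a * qv ^ k) * (k * xc) := by gcongr
      _ ≤ (a * qv ^ k) * ((k + 1) * xc) := by gcongr; linarith
      _ = xc * (((k : ℝ) + 1) * a) * qv ^ k := by ring
      _ ≤ blobCoef k * qv ^ k := by gcongr

/-! ### Sums over binary trees with angles -/

/-- An injective numbering of the binary trees. -/
def BinTree.code : BinTree → ℕ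
  | .leaf => 0
  | .node l r => Nat.pair l.code r.code + 1

theorem BinTree.code_injective : Function.Injective BinTree.code := by
  intro τ
  induction τ with
  | leaf => intro σ h; cases σ <;> simp_all [BinTree.code]
  | node l r hl hr =>
    intro σ h
    cases σ with
    | leaf => simp [BinTree.code] at h
    | node l' r' =>
      simp only [BinTree.code, Nat.add_right_cancel_iff, Nat.pair_eq_pair] at h
      rw [hl h.1, hr h.2]

instance : Countable BinTree := BinTree.code_injective.countable

/-- A binary tree is a leaf or a pair of binary trees. -/
theorem tsum_binTree (f : BinTree → ℝ≥0∞) :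
    ∑' τ, f τ = f .leaf + ∑' p : BinTree × BinTree, f (.node p.1 p.2) := by
  let e : Unit ⊕ (BinTree × BinTree) ≃ BinTree :=
    { toFun := Sum.elim (fun _ => .leaf) fun p => .node p.1 p.2
      invFun := fun τ => match τ with
        | .leaf => .inl ()
        | .node l r => .inr (l, r)
      left_inv := by rintro (_ | ⟨l, r⟩) <;> rfl
      right_inv := by rintro (_ | ⟨l, r⟩) <;> rfl }
  rw [← e.tsum_eq, Summable.tsum_sum ENNReal.summable ENNReal.summable]
  exact congrArg (· + _) (tsum_eq_single () (by simp))

instance sigmaFinite_ang : (τ : BinTree) → SigmaFinite (volume : Measure (Ang τ))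
  | .leaf => inferInstanceAs (SigmaFinite (Measure.dirac PUnit.unit))
  | .node l r =>
    have := sigmaFinite_ang l
    have := sigmaFinite_ang r
    inferInstanceAs (SigmaFinite (volume : Measure ((ℝ × ℝ) × (Ang l × Ang r))))

theorem lintegral_leaf (f : Ang .leaf → ℝ≥0∞) : ∫⁻ a, f a = f () := by
  have : ∀ g : Unit → ℝ≥0∞, ∫⁻ a, g a = g () := fun g => lintegral_dirac _ g
  exact this f

theorem lintegral_node {l r : BinTree} {f : Ang (.node l r) → ℝ≥0∞} (hf : Measurable f) :
    ∫⁻ a, f a = ∫⁻ p : ℝ × ℝ, ∫⁻ a : Ang l, ∫⁻ b : Ang r, f (p, (a, b)) := by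
  have : ∀ g : (ℝ × ℝ) × (Ang l × Ang r) → ℝ≥0∞, Measurable g →
      ∫⁻ a, g a = ∫⁻ p : ℝ × ℝ, ∫⁻ a : Ang l, ∫⁻ b : Ang r, g (p, (a, b)) := by
    intro g hg
    rw [Measure.volume_eq_prod, lintegral_prod _ hg.aemeasurable]
    refine lintegral_congr fun p => ?_
    rw [Measure.volume_eq_prod, lintegral_prod]
    exact (hg.comp measurable_prodMk_left).aemeasurable
  exact this f hf

/-- Families of functions of the angles of a binary tree, depending on the angle opposite to the
root edge on its outer side. -/
abbrev AngFun : Type := ℝ → (τ : BinTree) → Ang τ → ℝ≥0∞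

/-- Joint measurability in the outer angle and the angles of the tree. -/
def AngFun.Meas (u : AngFun) : Prop := ∀ τ, Measurable fun q : ℝ × Ang τ => u q.1 τ q.2

/-- The integral of `u` over all binary trees with angles, the outer angle being `π - θ`. -/
def AngFun.total (u : AngFun) (θ : ℝ) : ℝ≥0∞ := ∑' τ, ∫⁻ a, u (Real.pi - θ) τ a

theorem AngFun.Meas.measurable_lintegral {u : AngFun} (hu : u.Meas) (τ : BinTree) :
    Measurable fun φ => ∫⁻ a, u φ τ a :=
  (hu τ).lintegral_prod_right'

/-- The complements to `π` of the two angles at a vertex, in exchanged order: they are the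
parameters `θ` of the left and the right subtree. -/
def flip (p : ℝ × ℝ) : ℝ × ℝ := (Real.pi - p.2, Real.pi - p.1)

theorem measurePreserving_flip : MeasurePreserving flip volume volume := by
  have h : MeasurePreserving (fun x : ℝ => Real.pi - x) volume volume :=
    Measure.measurePreserving_sub_left volume Real.pi
  have h2 := h.prod h
  rw [← Measure.volume_eq_prod] at h2
  exact h2.comp Measure.measurePreserving_swap

/-- The recursion at the root vertex. -/
theorem AngFun.total_eq {ι : Type*} (T : Finset ι) {u : AngFun} {θ : ℝ} {f g : ι → AngFun}
    {S : Set (ℝ × ℝ)} (hS : MeasurableSet S) (hf : ∀ i, (f i).Meas) (hg : ∀ i, (g i).Meas)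
    (hu : ∀ l r p a b, u (Real.pi - θ) (.node l r) (p, (a, b)) =
      S.indicator 1 (flip p) * ∑ i ∈ T, f i p.2 l a * g i p.1 r b) :
    u.total θ = u (Real.pi - θ) .leaf () +
      ∫⁻ p in S, ∑ i ∈ T, (f i).total p.1 * (g i).total p.2 := by
  have hm : ∀ l r, Measurable fun a : Ang (.node l r) => u (Real.pi - θ) (.node l r) a := by
    intro l r
    have : Measurable fun q : (ℝ × ℝ) × (Ang l × Ang r) =>
        S.indicator (1 : ℝ × ℝ → ℝ≥0∞) (flip q.1) *
          ∑ i ∈ T, f i q.1.2 l q.2.1 * g i q.1.1 r q.2.2 := by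
      refine Measurable.mul ?_ ?_
      · exact (measurable_one.indicator hS).comp (measurePreserving_flip.measurable.comp measurable_fst)
      · refine Finset.measurable_sum _ fun i _ => Measurable.mul ?_ ?_
        · exact (hf i l).comp ((measurable_snd.comp measurable_fst).prodMk
            (measurable_fst.comp measurable_snd))
        · exact (hg i r).comp ((measurable_fst.comp measurable_fst).prodMk
            (measurable_snd.comp measurable_snd))
    have e : (fun q : (ℝ × ℝ) × (Ang l × Ang r) => u (Real.pi - θ) (.node l r) q) = _ :=
      funext fun q => hu l r q.1 q.2.1 q.2.2
    rw [← e] at this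
    exact this
  rw [AngFun.total, tsum_binTree, lintegral_leaf]
  congr 1
  have h1 : ∀ l r, ∫⁻ a, u (Real.pi - θ) (.node l r) a = ∫⁻ p in S, ∑ i ∈ T,
      (∫⁻ a, f i (Real.pi - p.1) l a) * ∫⁻ b, g i (Real.pi - p.2) r b := by
    intro l r
    rw [lintegral_node (hm l r), ← lintegral_indicator hS,
      ← measurePreserving_flip.lintegral_comp (Measurable.indicator ?_ hS)]
    · refine lintegral_congr fun p => ?_
      simp_rw [hu]
      have hbm : ∀ i, Measurable fun b => g i p.1 r b := fun i =>
        (hg i r).comp measurable_prodMk_left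
      have ham : ∀ i, Measurable fun a => f i p.2 l a := fun i =>
        (hf i l).comp measurable_prodMk_left
      have e : ∀ a, ∫⁻ b, S.indicator 1 (flip p) * ∑ i ∈ T, f i p.2 l a * g i p.1 r b =
          S.indicator 1 (flip p) * ∑ i ∈ T, f i p.2 l a * ∫⁻ b, g i p.1 r b := by
        intro a
        rw [lintegral_const_mul _ (Finset.measurable_sum _ fun i _ => (hbm i).const_mul _),
          lintegral_finsetSum _ fun i _ => (hbm i).const_mul _]
        exact congrArg _ (Finset.sum_congr rfl fun i _ => lintegral_const_mul _ (hbm i))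
      simp_rw [e]
      rw [lintegral_const_mul _ (Finset.measurable_sum _ fun i _ => (ham i).mul_const _),
        lintegral_finsetSum _ fun i _ => (ham i).mul_const _,
        Finset.sum_congr rfl fun i _ => lintegral_mul_const _ (ham i)]
      by_cases hp : flip p ∈ S
      · rw [Set.indicator_of_mem hp, Set.indicator_of_mem hp]
        simp [flip]
      · rw [Set.indicator_of_notMem hp, Set.indicator_of_notMem hp, zero_mul]
    · refine Finset.measurable_sum _ fun i _ => Measurable.mul ?_ ?_
      · exact ((hf i).measurable_lintegral l).comp (measurable_const.sub measurable_fst)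
      · exact ((hg i).measurable_lintegral r).comp (measurable_const.sub measurable_snd)
  simp_rw [h1]
  rw [← lintegral_tsum]
  · refine lintegral_congr fun p => ?_
    rw [Summable.tsum_finsetSum fun i _ => ENNReal.summable]
    refine Finset.sum_congr rfl fun i _ => ?_
    rw [AngFun.total, AngFun.total, ← ENNReal.tsum_mul_right, ENNReal.tsum_prod']
    exact tsum_congr fun l => ENNReal.tsum_mul_left (a := ∫⁻ a, f i (Real.pi - p.1) l a)
      (f := fun r => ∫⁻ b, g i (Real.pi - p.2) r b)
  · intro q
    refine (Finset.measurable_sum _ fun i _ => Measurable.mul ?_ ?_).aemeasurable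
    · exact ((hf i).measurable_lintegral q.1).comp (measurable_const.sub measurable_fst)
    · exact ((hg i).measurable_lintegral q.2).comp (measurable_const.sub measurable_snd)

/-! ### Trees with a prescribed statistic -/

open Classical in
/-- The weight `w τ` on the event that `P` holds and the statistic `s` takes the value `ξ`. -/
def statFun {X : Type*} (w : BinTree → ℝ≥0∞) (P : ℝ → (τ : BinTree) → Ang τ → Prop)
    (s : ℝ → (τ : BinTree) → Ang τ → X) (ξ : X) : AngFun :=
  fun φ τ a => if P φ τ a ∧ s φ τ a = ξ then w τ else 0

theorem statFun_meas {X : Type*} (w : BinTree → ℝ≥0∞) {P : ℝ → (τ : BinTree) → Ang τ → Prop}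
    {s : ℝ → (τ : BinTree) → Ang τ → X}
    (hP : ∀ τ, MeasurableSet {q : ℝ × Ang τ | P q.1 τ q.2})
    (hs : ∀ τ ξ, MeasurableSet {q : ℝ × Ang τ | s q.1 τ q.2 = ξ}) (ξ : X) :
    (statFun w P s ξ).Meas :=
  fun τ => Measurable.ite ((hP τ).inter (hs τ ξ)) measurable_const measurable_const

open Classical in
/-- A product of two events, decomposed according to an injectively indexed pair of values. -/
theorem sum_ite_mul_ite {ι X Y : Type*} (T : Finset ι) {u : ι → X} {v : ι → Y}
    (h : Set.InjOn (fun i => (u i, v i)) T) (P Q : Prop) (x : X) (y : Y) (c d : ℝ≥0∞) :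
    ∑ i ∈ T, (if P ∧ x = u i then c else 0) * (if Q ∧ y = v i then d else 0) =
      if (P ∧ Q) ∧ ∃ i ∈ T, x = u i ∧ y = v i then c * d else 0 := by
  split_ifs with h'
  · obtain ⟨⟨hP, hQ⟩, i, hi, hx, hy⟩ := h'
    rw [Finset.sum_eq_single_of_mem i hi]
    · simp [hP, hQ, hx, hy]
    · intro j hjT hj
      by_contra hne
      refine hj (h hjT hi ?_)
      simp only [mul_ite, ite_mul, zero_mul, mul_zero] at hne
      split_ifs at hne with h1 h2 <;> simp_all
  · refine Finset.sum_eq_zero fun i hi => ?_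
    by_contra hne
    refine h' ?_
    simp only [mul_ite, ite_mul, zero_mul, mul_zero] at hne
    split_ifs at hne with h1 h2
    · exact ⟨⟨h2.1, h1.1⟩, i, hi, h2.2, h1.2⟩
    all_goals simp_all

open Classical in
/-- The recursion at the root vertex for a statistic whose value at a tree is determined by its
values at the two subtrees. -/
theorem total_statFun_eq {ι X : Type*} (T : Finset ι) {u v : ι → X}
    (hinj : Set.InjOn (fun i => (u i, v i)) T) {w : BinTree → ℝ≥0∞}
    (hw : ∀ l r, w (.node l r) = w l * w r) {P : ℝ → (τ : BinTree) → Ang τ → Prop}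
    {s : ℝ → (τ : BinTree) → Ang τ → X}
    (hP : ∀ τ, MeasurableSet {q : ℝ × Ang τ | P q.1 τ q.2})
    (hs : ∀ τ ξ, MeasurableSet {q : ℝ × Ang τ | s q.1 τ q.2 = ξ})
    {S : Set (ℝ × ℝ)} (hS : MeasurableSet S) {θ : ℝ} {ξ : X}
    (hnode : ∀ l r p a b, (P (Real.pi - θ) (.node l r) (p, (a, b)) ∧
      s (Real.pi - θ) (.node l r) (p, (a, b)) = ξ) ↔
      flip p ∈ S ∧ (P p.2 l a ∧ P p.1 r b) ∧ ∃ i ∈ T, s p.2 l a = u i ∧ s p.1 r b = v i) :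
    (statFun w P s ξ).total θ =
      (if P (Real.pi - θ) .leaf () ∧ s (Real.pi - θ) .leaf () = ξ then w .leaf else 0) +
      ∫⁻ p in S, ∑ i ∈ T, (statFun w P s (u i)).total p.1 * (statFun w P s (v i)).total p.2 := by
  rw [AngFun.total_eq T hS (fun i => statFun_meas w hP hs (u i))
    (fun i => statFun_meas w hP hs (v i))]
  · rfl
  · intro l r p a b
    simp only [statFun]
    rw [sum_ite_mul_ite T hinj, ← hw]
    by_cases hp : flip p ∈ S
    · rw [Set.indicator_of_mem hp, Pi.one_apply, one_mul]
      exact if_congr (by rw [hnode, and_iff_right hp]) rfl rfl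
    · rw [Set.indicator_of_notMem hp, zero_mul, if_neg]
      rw [hnode]
      exact fun h => hp h.1

theorem total_statFun_eq_tsum {X : Type*} {P : ℝ → (τ : BinTree) → Ang τ → Prop}
    {s : ℝ → (τ : BinTree) → Ang τ → X}
    (hP : ∀ τ, MeasurableSet {q : ℝ × Ang τ | P q.1 τ q.2})
    (hs : ∀ τ ξ, MeasurableSet {q : ℝ × Ang τ | s q.1 τ q.2 = ξ}) (w : BinTree → ℝ≥0∞) (ξ : X)
    (θ : ℝ) : (statFun w P s ξ).total θ =
      ∑' τ, w τ * volume {a | P (Real.pi - θ) τ a ∧ s (Real.pi - θ) τ a = ξ} := by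
  refine tsum_congr fun τ => ?_
  have hm : MeasurableSet {a | P (Real.pi - θ) τ a ∧ s (Real.pi - θ) τ a = ξ} :=
    ((hP τ).inter (hs τ ξ)).preimage measurable_prodMk_left
  rw [← lintegral_indicator_const hm]
  refine lintegral_congr fun a => ?_
  unfold statFun
  split_ifs with h
  · exact (Set.indicator_of_mem (s := {a | P (Real.pi - θ) τ a ∧ s (Real.pi - θ) τ a = ξ}) h
      (fun _ => w τ)).symm
  · exact (Set.indicator_of_notMem (s := {a | P (Real.pi - θ) τ a ∧ s (Real.pi - θ) τ a = ξ})
      h (fun _ => w τ)).symm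

/-! ### Measurability of the statistics -/

theorem measurableSet_allowed (τ : BinTree) : MeasurableSet {q : ℝ × Ang τ | Allowed q.1 τ q.2} := by
  induction τ with
  | leaf => exact MeasurableSet.univ
  | node l r hl hr =>
    have h1 : Measurable fun q : ℝ × ((ℝ × ℝ) × (Ang l × Ang r)) => (q.2.1.2, q.2.2.1) := by fun_prop
    have h2 : Measurable fun q : ℝ × ((ℝ × ℝ) × (Ang l × Ang r)) => (q.2.1.1, q.2.2.2) := by fun_prop
    have h3 : MeasurableSet {q : ℝ × ((ℝ × ℝ) × (Ang l × Ang r)) | 0 < q.2.1.1 ∧ q.2.1.1 < Real.pi ∧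
        0 < q.2.1.2 ∧ q.2.1.2 < Real.pi ∧ Real.pi < q.2.1.1 + q.2.1.2 ∧
        q.2.1.1 + q.2.1.2 < q.1 + Real.pi} := by measurability
    have h4 := (h3.inter (hl.preimage h1)).inter (hr.preimage h2)
    have e : {q : ℝ × ((ℝ × ℝ) × (Ang l × Ang r)) | Allowed q.1 (.node l r) q.2} =
        {q : ℝ × ((ℝ × ℝ) × (Ang l × Ang r)) | 0 < q.2.1.1 ∧ q.2.1.1 < Real.pi ∧
        0 < q.2.1.2 ∧ q.2.1.2 < Real.pi ∧ Real.pi < q.2.1.1 + q.2.1.2 ∧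
        q.2.1.1 + q.2.1.2 < q.1 + Real.pi} ∩
        (fun q : ℝ × ((ℝ × ℝ) × (Ang l × Ang r)) => (q.2.1.2, q.2.2.1)) ⁻¹'
          {q | Allowed q.1 l q.2} ∩
        (fun q : ℝ × ((ℝ × ℝ) × (Ang l × Ang r)) => (q.2.1.1, q.2.2.2)) ⁻¹'
          {q | Allowed q.1 r q.2} := by
      ext ⟨φ, ⟨α, β⟩, a, b⟩
      simp only [Set.mem_inter_iff, Set.mem_preimage, Set.mem_ofPred_eq, Allowed]
      tauto
    rw [← e] at h4
    exact h4

theorem measurableSet_isCut {Y : Type*} [MeasurableSpace Y] {f g : Y → ℝ} (hf : Measurable f)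
    (hg : Measurable g) : MeasurableSet {y | IsCut (f y) (g y)} :=
  (measurableSet_le measurable_const hf).inter (measurableSet_le measurable_const hg)

theorem measurableSet_noCut (τ : BinTree) : MeasurableSet {q : ℝ × Ang τ | NoCut q.1 τ q.2} := by
  induction τ with
  | leaf => exact MeasurableSet.univ
  | node l r hl hr =>
    have h1 : Measurable fun q : ℝ × ((ℝ × ℝ) × (Ang l × Ang r)) => (q.2.1.2, q.2.2.1) := by fun_prop
    have h2 : Measurable fun q : ℝ × ((ℝ × ℝ) × (Ang l × Ang r)) => (q.2.1.1, q.2.2.2) := by fun_prop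
    have h3 : MeasurableSet {q : ℝ × ((ℝ × ℝ) × (Ang l × Ang r)) |
        IsCut q.1 (2 * Real.pi - q.2.1.1 - q.2.1.2)} :=
      measurableSet_isCut (by fun_prop) (by fun_prop)
    have h4 := (h3.compl.inter (hl.preimage h1)).inter (hr.preimage h2)
    have e : {q : ℝ × ((ℝ × ℝ) × (Ang l × Ang r)) | NoCut q.1 (.node l r) q.2} =
        {q : ℝ × ((ℝ × ℝ) × (Ang l × Ang r)) |
          IsCut q.1 (2 * Real.pi - q.2.1.1 - q.2.1.2)}ᶜ ∩
        (fun q : ℝ × ((ℝ × ℝ) × (Ang l × Ang r)) => (q.2.1.2, q.2.2.1)) ⁻¹'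
          {q | NoCut q.1 l q.2} ∩
        (fun q : ℝ × ((ℝ × ℝ) × (Ang l × Ang r)) => (q.2.1.1, q.2.2.2)) ⁻¹'
          {q | NoCut q.1 r q.2} := by
      ext ⟨φ, ⟨α, β⟩, a, b⟩
      simp only [Set.mem_inter_iff, Set.mem_preimage, Set.mem_ofPred_eq, NoCut, Set.mem_compl_iff]
      tauto
    rw [← e] at h4
    exact h4

theorem measurable_redCount (τ : BinTree) : Measurable fun q : ℝ × Ang τ => redCount q.1 τ q.2 := by
  induction τ with
  | leaf =>
    exact Measurable.ite (measurableSet_le measurable_const measurable_fst) measurable_const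
      measurable_const
  | node l r hl hr =>
    have h1 : Measurable fun q : ℝ × ((ℝ × ℝ) × (Ang l × Ang r)) => (q.2.1.2, q.2.2.1) := by fun_prop
    have h2 : Measurable fun q : ℝ × ((ℝ × ℝ) × (Ang l × Ang r)) => (q.2.1.1, q.2.2.2) := by fun_prop
    exact (hl.comp h1).add (hr.comp h2)

theorem measurable_cutCount (τ : BinTree) : Measurable fun q : ℝ × Ang τ => cutCount q.1 τ q.2 := by
  induction τ with
  | leaf =>
    exact Measurable.ite (measurableSet_le measurable_const measurable_fst) measurable_const
      measurable_const
  | node l r hl hr =>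
    have h1 : Measurable fun q : ℝ × ((ℝ × ℝ) × (Ang l × Ang r)) => (q.2.1.2, q.2.2.1) := by fun_prop
    have h2 : Measurable fun q : ℝ × ((ℝ × ℝ) × (Ang l × Ang r)) => (q.2.1.1, q.2.2.2) := by fun_prop
    exact (hl.comp h1).add (hr.comp h2)

/-! ### Counting by leaves -/

theorem numLeaves_pos (τ : BinTree) : 0 < τ.numLeaves := by
  induction τ with
  | leaf => exact one_pos
  | node l r hl hr => exact Nat.add_pos_left hl _

/-- At the root vertex, the angle conditions describe the triangle `θ < s + t < π`. -/
theorem allowed_node_iff (θ : ℝ) (l r : BinTree) (p : ℝ × ℝ) (a : Ang l) (b : Ang r) :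
    Allowed (Real.pi - θ) (.node l r) (p, (a, b)) ↔
      flip p ∈ tri θ Real.pi ∧ Allowed p.2 l a ∧ Allowed p.1 r b := by
  obtain ⟨α, β⟩ := p
  simp only [Allowed, tri, flip, Set.mem_ofPred_eq]
  constructor
  · rintro ⟨h1, h2, h3, h4, h5, h6, h7, h8⟩
    exact ⟨⟨by linarith, by linarith, by linarith, by linarith⟩, h7, h8⟩
  · rintro ⟨⟨h1, h2, h3, h4⟩, h7, h8⟩
    exact ⟨by linarith, by linarith, by linarith, by linarith, by linarith, by linarith, h7, h8⟩

theorem measurableSet_numLeaves (τ : BinTree) (n : ℕ) :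
    MeasurableSet {_q : ℝ × Ang τ | τ.numLeaves = n} := MeasurableSet.const _

theorem total_leaves_eq_tsum (n : ℕ) (θ : ℝ) :
    (statFun 1 Allowed (fun _ τ _ => τ.numLeaves) n).total θ =
      ∑' τ, volume {a | Allowed (Real.pi - θ) τ a ∧ τ.numLeaves = n} := by
  rw [total_statFun_eq_tsum measurableSet_allowed measurableSet_numLeaves]
  simp

theorem stripEnd_of_le {L θ : ℝ} (h : θ ≤ L) : stripEnd L θ = L := if_pos h

/-- The volume of the allowed angle assignments of the trees with `n` leaves besides the root. -/
theorem total_leaves (n : ℕ) {θ : ℝ} (h0 : 0 ≤ θ) (h1 : θ ≤ Real.pi) :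
    (statFun 1 Allowed (fun _ τ _ => τ.numLeaves) n).total θ = coef Real.pi n θ := by
  induction n using Nat.strong_induction_on generalizing θ with
  | _ n ih =>
    rw [total_statFun_eq (antidiagonal n) (u := Prod.fst) (v := Prod.snd) (fun _ _ _ _ h => h)
      (by simp) measurableSet_allowed measurableSet_numLeaves (measurableSet_tri θ Real.pi),
      coef_eq, stripEnd_of_le h1]
    · congr 1
      · simp [Allowed, BinTree.numLeaves, h1, eq_comm]
      · refine setLIntegral_congr_fun (measurableSet_tri θ Real.pi) fun p hp => ?_
        obtain ⟨hp1, hp2, hp3, hp4⟩ := hp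
        -- every tree has a leaf, so only smaller sizes contribute
        have hz : ∀ s, (statFun 1 Allowed (fun _ τ _ => τ.numLeaves) 0).total s = 0 := by
          intro s
          rw [total_leaves_eq_tsum]
          simp [(numLeaves_pos _).ne']
        refine Finset.sum_congr rfl fun ij hij => ?_
        rw [mem_antidiagonal] at hij
        rcases Nat.eq_zero_or_pos ij.1 with hi | hi
        · rw [hi, hz, coef_zero, zero_mul, zero_mul]
        rcases Nat.eq_zero_or_pos ij.2 with hj | hj
        · rw [hj, hz, coef_zero, mul_zero, mul_zero]
        rw [ih ij.1 (by omega) hp1.le (by linarith), ih ij.2 (by omega) hp2.le (by linarith)]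
    · intro l r p a b
      rw [allowed_node_iff]
      simp only [BinTree.numLeaves, and_assoc, Prod.exists, mem_antidiagonal]
      constructor
      · rintro ⟨h1, h2, h3, h4⟩
        exact ⟨h1, h2, h3, _, _, h4, rfl, rfl⟩
      · rintro ⟨h1, h2, h3, i, j, h4, rfl, rfl⟩
        exact ⟨h1, h2, h3, h4⟩

/-- The generating function of the trees with angles is the one of the convolution recursion on
`[0, π]`. -/
theorem genF_eq_gf (x : ℝ) {θ : ℝ} (h0 : 0 ≤ θ) (h1 : θ ≤ Real.pi) :
    genF x θ = gf Real.pi (ENNReal.ofReal x) θ := by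
  rw [gf, genF]
  simp_rw [← total_leaves _ h0 h1, total_leaves_eq_tsum, ← ENNReal.tsum_mul_right]
  rw [ENNReal.tsum_comm]
  refine tsum_congr fun τ => ?_
  rw [tsum_eq_single τ.numLeaves]
  · simp [angleSet, mul_comm]
  · intro n hn
    simp [hn.symm]

/-- With `A = w0 / π²`, the value at `π / 2` is that of `psi` at `A (π / 2)² = w0 / 4`. -/
theorem qc_eq : qc = qv := by
  have hpi := Real.pi_pos
  have hw := w0_pos
  rw [qc, genF_eq_gf _ (by positivity) (by linarith), xc_eq,
    gf_eq_besselSol hpi hw.le le_rfl (by positivity) (by linarith), ENNReal.toReal_ofReal]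
  · have := besselSol_mul_sq (w0 / Real.pi ^ 2) (Real.pi / 2)
    rw [qv, eq_div_iff (by positivity)]
    rw [show w0 / Real.pi ^ 2 * (Real.pi / 2) ^ 2 = w0 / 4 by field_simp; norm_num] at this
    rw [← this]; ring
  · refine besselSol_nonneg (L := Real.pi) (by positivity) (by positivity) (by linarith) ?_
    rw [div_mul_cancel₀ _ (by positivity)]

theorem genF_xc_zero : genF xc 0 = ENNReal.ofReal (w0 / Real.pi ^ 2) := by
  have hpi := Real.pi_pos
  rw [genF_eq_gf _ le_rfl hpi.le, xc_eq, gf_eq_besselSol hpi w0_pos.le le_rfl le_rfl hpi.le,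
    besselSol_zero]

/-! ### Convolutions with red leaves -/

/-- The weight of the blob patterns with `n` leaves, of which `r` in prescribed positions are red:
a red leaf shifts the angle by `L`, and two red leaves are impossible. -/
def coefRed (L : ℝ) : ℕ → ℕ → ℝ → ℝ≥0∞
  | 0, n, θ => coef L n θ
  | 1, n, θ => if θ ≤ L then 0 else coef L n (θ - L)
  | _ + 2, _, _ => 0

/-- The convolution of `coefRed L r₁ i` and `coefRed L r₂ j` over the strip `a + L < s + t < 2 L`,
for any `r₁ + r₂ = r`. -/
def convRed (L : ℝ) : ℕ → ℕ → ℕ → ℝ → ℝ≥0∞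
  | 0, i, j, a => ∫⁻ p in tri (a + L) (2 * L), coef L i p.1 * coef L j p.2
  | 1, i, j, a => ∫⁻ p in tri a L, coef L i p.1 * coef L j p.2
  | _ + 2, _, _, _ => 0

theorem measurable_coefRed (L : ℝ) (r n : ℕ) : Measurable (coefRed L r n) := by
  match r with
  | 0 => exact measurable_coef L n
  | 1 =>
    exact Measurable.ite measurableSet_Iic measurable_const
      ((measurable_coef L n).comp (measurable_id.sub measurable_const))
  | r + 2 => exact measurable_const

theorem coefRed_zero_right (L : ℝ) (r : ℕ) (θ : ℝ) : coefRed L r 0 θ = 0 := by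
  match r with
  | 0 => exact coef_zero L θ
  | 1 => simp [coefRed, coef_zero]
  | r + 2 => rfl

theorem coefRed_of_le {L θ : ℝ} (h : θ ≤ L) {r : ℕ} (hr : r ≠ 0) (n : ℕ) : coefRed L r n θ = 0 := by
  match r with
  | 0 => exact absurd rfl hr
  | 1 => simp [coefRed, h]
  | r + 2 => rfl

/-- A coordinate of the strip that carries a red leaf exceeds `L`, which cannot happen for both
coordinates. The weight of a red leaf in a strip `a + L < s + t < 2 L` does not depend on the
subtree to which it belongs. -/
theorem lintegral_coefRed_mul (L a : ℝ) (r₁ r₂ i j : ℕ) :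
    ∫⁻ p in tri (a + L) (2 * L), coefRed L r₁ i p.1 * coefRed L r₂ j p.2 =
      convRed L (r₁ + r₂) i j a := by
  have hm : Measurable fun p : ℝ × ℝ => coefRed L r₁ i p.1 * coefRed L r₂ j p.2 :=
    ((measurable_coefRed L r₁ i).comp measurable_fst).mul
      ((measurable_coefRed L r₂ j).comp measurable_snd)
  have hzero : ∀ {S : Set (ℝ × ℝ)} {f : ℝ × ℝ → ℝ≥0∞}, MeasurableSet S → (∀ p ∈ S, f p = 0) →
      ∫⁻ p in S, f p = 0 := fun hS h => by
    rw [setLIntegral_congr_fun hS h, lintegral_zero]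
  match r₁, r₂ with
  | 0, 0 => rfl
  | 0, 1 =>
    rw [lintegral_tri_shift L a hm, hzero (measurableSet_core L a) ?_, zero_add]
    · refine (congrArg₂ (· + ·) (setLIntegral_congr_fun (measurableSet_tri a L) fun p hp => ?_)
        (hzero (measurableSet_tri a L) fun p hp => ?_)).trans (add_zero _)
      · have : ¬ p.2 + L ≤ L := by have := hp.2.1; linarith
        simp [coefRed, this]
      · have : p.2 ≤ L := by have := hp.1; have := hp.2.2.2; linarith
        simp [coefRed, this]
    · intro p hp
      simp [coefRed, hp.2.2]
  | 1, 0 =>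
    rw [lintegral_tri_shift L a hm, hzero (measurableSet_core L a) ?_, zero_add]
    · refine (congrArg₂ (· + ·) (hzero (measurableSet_tri a L) fun p hp => ?_)
        (setLIntegral_congr_fun (measurableSet_tri a L) fun p hp => ?_)).trans (zero_add _)
      rotate_left
      · have : ¬ p.1 + L ≤ L := by have := hp.1; linarith
        simp [coefRed, this]
      · have : p.1 ≤ L := by have := hp.2.1; have := hp.2.2.2; linarith
        simp [coefRed, this]
    · intro p hp
      simp [coefRed, hp.2.1]
  | 1, 1 =>
    refine hzero (measurableSet_tri _ _) fun p hp => ?_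
    rcases le_or_gt p.1 L with h | h
    · simp [coefRed, h]
    · have : p.2 ≤ L := by have := hp.2.2.2; linarith
      simp [coefRed, this]
  | r + 2, r₂ =>
    rw [show r + 2 + r₂ = r + r₂ + 2 by ring]
    simp [coefRed, convRed]
  | 0, r + 2 => simp [coefRed, convRed]
  | 1, r + 2 =>
    rw [show 1 + (r + 2) = r + 1 + 2 by ring]
    simp [coefRed, convRed]

/-- The convolution over the strip of the recursion for `coef`. -/
def stripRed (L : ℝ) (r i j : ℕ) (θ : ℝ) : ℝ≥0∞ :=
  if θ ≤ L then (if r = 0 then ∫⁻ p in tri θ L, coef L i p.1 * coef L j p.2 else 0)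
  else convRed L r i j (θ - L)

theorem lintegral_strip_coefRed_mul (L θ : ℝ) (r₁ r₂ i j : ℕ) :
    ∫⁻ p in tri θ (stripEnd L θ), coefRed L r₁ i p.1 * coefRed L r₂ j p.2 =
      stripRed L (r₁ + r₂) i j θ := by
  rcases le_or_gt θ L with h | h
  · rw [stripEnd_of_le h, stripRed, if_pos h]
    split_ifs with hr
    · obtain ⟨rfl, rfl⟩ : r₁ = 0 ∧ r₂ = 0 := by omega
      rfl
    · have : ∀ p ∈ tri θ L, coefRed L r₁ i p.1 * coefRed L r₂ j p.2 = 0 := by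
        rintro p ⟨h1, h2, h3, h4⟩
        by_cases hr1 : r₁ = 0
        · rw [coefRed_of_le (r := r₂) (by linarith) (by omega), mul_zero]
        · rw [coefRed_of_le (by linarith) hr1, zero_mul]
      rw [setLIntegral_congr_fun (measurableSet_tri θ L) this, lintegral_zero]
  · rw [stripRed, if_neg h.not_ge, ← lintegral_coefRed_mul, stripEnd,
      if_neg h.not_ge, sub_add_cancel]

theorem sum_lintegral_coef_mul (L : ℝ) (n : ℕ) (S : Set (ℝ × ℝ)) :
    ∑ ij ∈ antidiagonal n, ∫⁻ p in S, coef L ij.1 p.1 * coef L ij.2 p.2 =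
      ∫⁻ p in S, coefConv L n p := by
  unfold coefConv
  rw [lintegral_finsetSum]
  exact fun ij _ => ((measurable_coef L ij.1).comp measurable_fst).mul
      ((measurable_coef L ij.2).comp measurable_snd)

theorem sum_convRed_zero (L : ℝ) (n : ℕ) (a : ℝ) : ∑ ij ∈ antidiagonal n, convRed L 0 ij.1 ij.2 a =
    ∫⁻ p in tri (a + L) (2 * L), coefConv L n p := sum_lintegral_coef_mul L n _

theorem sum_convRed_one {L a : ℝ} (h : a ≤ L) (n : ℕ) :
    coef L n a = (if n = 1 then 1 else 0) + ∑ ij ∈ antidiagonal n, convRed L 1 ij.1 ij.2 a := by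
  rw [coef_eq, stripEnd_of_le h]
  simp only [h, and_true]
  exact congrArg _ (sum_lintegral_coef_mul L n _).symm

/-- The recursion for `coefRed`. -/
theorem coefRed_eq {L θ : ℝ} (h1 : θ ≤ 2 * L) (r n : ℕ) :
    coefRed L r n θ = (if n = 1 then coefRed L r 1 θ else 0) +
      ∑ ij ∈ antidiagonal n, stripRed L r ij.1 ij.2 θ := by
  unfold stripRed
  match r with
  | 0 =>
    rcases le_or_gt θ L with h | h
    · simp only [h, if_true, sum_lintegral_coef_mul, coefRed, coef_one]
      rw [coef_eq, stripEnd_of_le h]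
      simp [h]
    · simp only [h.not_ge, if_false, sum_convRed_zero, coefRed, coef_one, sub_add_cancel]
      rw [coef_eq, stripEnd]
      simp [h.not_ge]
  | 1 =>
    rcases le_or_gt θ L with h | h
    · simp [h, coefRed]
    · simp only [h.not_ge, if_false, coefRed]
      rw [sum_convRed_one (by linarith)]
      simp [coef_one, show θ - L ≤ L by linarith]
  | r + 2 => simp [coefRed, convRed]

/-! ### The weights of the blobs -/

/-- Shift of the summation indices, for a summand vanishing at the new indices. -/
theorem sum_antidiagonal_add (r₁ r₂ k : ℕ) {f : ℕ → ℕ → ℝ≥0∞} (h₁ : ∀ i j, i < r₁ → f i j = 0)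
    (h₂ : ∀ i j, j < r₂ → f i j = 0) :
    ∑ ij ∈ antidiagonal k, f (ij.1 + r₁) (ij.2 + r₂) =
      ∑ ij ∈ antidiagonal (k + (r₁ + r₂)), f ij.1 ij.2 := by
  induction r₁ generalizing f with
  | zero =>
    induction r₂ generalizing f with
    | zero => rfl
    | succ r₂ ih =>
      rw [show k + (0 + (r₂ + 1)) = k + (0 + r₂) + 1 by ring, Finset.Nat.sum_antidiagonal_succ',
        h₂ _ _ (Nat.succ_pos _), zero_add, ← ih (f := fun i j => f i (j + 1)) (by simp)
        (fun i j hj => h₂ _ _ (by omega))]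
      rfl
  | succ r₁ ih =>
    rw [show k + (r₁ + 1 + r₂) = k + (r₁ + r₂) + 1 by ring, Finset.Nat.sum_antidiagonal_succ,
      h₁ _ _ (Nat.succ_pos _), zero_add, ← ih (f := fun i j => f (i + 1) j)
      (fun i j hj => h₁ _ _ (by omega)) (fun i j hj => h₂ _ _ hj)]
    rfl

/-- Vandermonde's identity, summed against a weight that depends only on the sizes. -/
theorem sum_choose_mul_choose (r k : ℕ) (C : ℕ → ℕ → ℝ≥0∞) :
    ∑ x ∈ antidiagonal r ×ˢ antidiagonal k,
      (((x.2.1 + x.1.1).choose x.1.1 * (x.2.2 + x.1.2).choose x.1.2 : ℕ) : ℝ≥0∞) *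
        C (x.2.1 + x.1.1) (x.2.2 + x.1.2) =
      ((k + r).choose r : ℝ≥0∞) * ∑ ij ∈ antidiagonal (k + r), C ij.1 ij.2 := by
  rw [Finset.sum_product]
  have h : ∀ x ∈ antidiagonal r, ∑ y ∈ antidiagonal k,
      (((y.1 + x.1).choose x.1 * (y.2 + x.2).choose x.2 : ℕ) : ℝ≥0∞) * C (y.1 + x.1) (y.2 + x.2) =
      ∑ ij ∈ antidiagonal (k + r), ((ij.1.choose x.1 * ij.2.choose x.2 : ℕ) : ℝ≥0∞) *
        C ij.1 ij.2 := by
    intro x hx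
    rw [mem_antidiagonal] at hx
    rw [← hx]
    exact sum_antidiagonal_add x.1 x.2 k
      (f := fun i j => ((i.choose x.1 * j.choose x.2 : ℕ) : ℝ≥0∞) * C i j)
      (fun i j hi => by simp [Nat.choose_eq_zero_of_lt hi])
      (fun i j hj => by simp [Nat.choose_eq_zero_of_lt hj])
  rw [Finset.sum_congr rfl h, Finset.sum_comm, Finset.mul_sum]
  refine Finset.sum_congr rfl fun ij hij => ?_
  rw [mem_antidiagonal] at hij
  rw [← Finset.sum_mul, ← hij, Nat.add_choose_eq]
  push_cast
  rfl

/-- The angle conditions of a tree whose only cut-edges are leaf edges: the root edge is not a cut-edge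
unless it ends at a leaf. -/
def BlobCond (φ : ℝ) (τ : BinTree) (a : Ang τ) : Prop := Allowed φ τ a ∧ NoCut φ τ a

/-- The numbers of red leaves and of cut-edges. -/
def leafCounts (φ : ℝ) (τ : BinTree) (a : Ang τ) : ℕ × ℕ := (redCount φ τ a, cutCount φ τ a)

theorem measurableSet_blobCond (τ : BinTree) : MeasurableSet {q : ℝ × Ang τ | BlobCond q.1 τ q.2} :=
  (measurableSet_allowed τ).inter (measurableSet_noCut τ)

theorem measurableSet_leafCounts (τ : BinTree) (ξ : ℕ × ℕ) :
    MeasurableSet {q : ℝ × Ang τ | leafCounts q.1 τ q.2 = ξ} :=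
  ((measurable_redCount τ).prodMk (measurable_cutCount τ)) (measurableSet_singleton ξ)

theorem leafCounts_ne_zero (φ : ℝ) (τ : BinTree) (a : Ang τ) :
    0 < redCount φ τ a + cutCount φ τ a := by
  induction τ generalizing φ with
  | leaf => simp only [redCount, cutCount]; split_ifs <;> simp
  | node l r hl hr =>
    obtain ⟨⟨α, β⟩, a, b⟩ := a
    have := hl β a
    simp only [redCount, cutCount]
    omega

theorem isCut_iff (θ : ℝ) (p : ℝ × ℝ) : IsCut (Real.pi - θ) (2 * Real.pi - p.1 - p.2) ↔
    θ ≤ Real.pi / 2 ∧ Real.pi / 2 ≤ (flip p).1 + (flip p).2 := by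
  simp only [IsCut, flip]
  constructor <;> rintro ⟨h1, h2⟩ <;> constructor <;> linarith

/-- At the root vertex, the angle conditions with no cut-edge at the root describe the strip of the
recursion for `coef`. -/
theorem allowed_notCut_node_iff (θ : ℝ) (l r : BinTree) (p : ℝ × ℝ) (a : Ang l)
    (b : Ang r) : (Allowed (Real.pi - θ) (.node l r) (p, (a, b)) ∧
      ¬ IsCut (Real.pi - θ) (2 * Real.pi - p.1 - p.2)) ↔
      flip p ∈ tri θ (stripEnd (Real.pi / 2) θ) ∧ Allowed p.2 l a ∧ Allowed p.1 r b := by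
  have hpi := Real.pi_pos
  rw [allowed_node_iff, isCut_iff, stripEnd, show 2 * (Real.pi / 2) = Real.pi by ring]
  split_ifs with h
  · simp only [h, true_and, not_le, tri, Set.mem_ofPred_eq]
    constructor
    · rintro ⟨⟨⟨h1, h2, h3, h4⟩, h5⟩, h6⟩
      exact ⟨⟨h1, h2, h3, h6⟩, h5⟩
    · rintro ⟨⟨h1, h2, h3, h4⟩, h5⟩
      exact ⟨⟨⟨h1, h2, h3, by linarith⟩, h5⟩, h4⟩
  · simp [h]

theorem total_blob_zero (θ : ℝ) : (statFun 1 BlobCond leafCounts (0, 0)).total θ = 0 := by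
  rw [total_statFun_eq_tsum measurableSet_blobCond measurableSet_leafCounts]
  refine ENNReal.tsum_eq_zero.2 fun τ => ?_
  have : {a | BlobCond (Real.pi - θ) τ a ∧ leafCounts (Real.pi - θ) τ a = (0, 0)} = ∅ := by
    refine Set.eq_empty_of_forall_notMem fun a ha => ?_
    have h := leafCounts_ne_zero (Real.pi - θ) τ a
    have h2 := ha.2
    simp only [leafCounts, Prod.mk.injEq] at h2
    omega
  rw [this, measure_empty, mul_zero]

theorem injOn_counts (T : Finset ((ℕ × ℕ) × (ℕ × ℕ))) :
    Set.InjOn (fun x : (ℕ × ℕ) × (ℕ × ℕ) => ((x.1.1, x.2.1), (x.1.2, x.2.2))) T := by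
  rintro ⟨⟨a, b⟩, c, d⟩ - ⟨⟨a', b'⟩, c', d'⟩ - h
  simp_all

theorem exists_counts_iff (r k : ℕ) (x y : ℕ × ℕ) :
    (∃ i ∈ antidiagonal r ×ˢ antidiagonal k, x = (i.1.1, i.2.1) ∧ y = (i.1.2, i.2.2)) ↔
      x.1 + y.1 = r ∧ x.2 + y.2 = k := by
  constructor
  · rintro ⟨⟨⟨a, b⟩, c, d⟩, hi, rfl, rfl⟩
    simpa using hi
  · intro h
    exact ⟨((x.1, y.1), (x.2, y.2)), by simpa using h, rfl, rfl⟩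

/-- The volume of the trees satisfying `BlobCond`, with `r` red leaves and `k` leaves on cut-edges.
The binomial coefficient counts the positions of the red leaves: all of them have the same weight. -/
theorem total_blob (r k : ℕ) {θ : ℝ} (h0 : 0 ≤ θ) (h1 : θ ≤ Real.pi) :
    (statFun 1 BlobCond leafCounts (r, k)).total θ =
      ((k + r).choose r : ℝ≥0∞) * coefRed (Real.pi / 2) r (k + r) θ := by
  have hpi := Real.pi_pos
  induction hn : k + r using Nat.strong_induction_on generalizing r k θ with
  | _ n ih =>
    subst hn
    rw [total_statFun_eq (antidiagonal r ×ˢ antidiagonal k) (u := fun x => (x.1.1, x.2.1))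
      (v := fun x => (x.1.2, x.2.2)) (injOn_counts _) (by simp) measurableSet_blobCond
      measurableSet_leafCounts (measurableSet_tri θ (stripEnd (Real.pi / 2) θ))]
    · rw [coefRed_eq (by linarith), mul_add]
      congr 1
      · by_cases hkr : k + r = 1
        · rw [if_pos hkr]
          have hcases : (k = 1 ∧ r = 0) ∨ (k = 0 ∧ r = 1) := by omega
          have hle : Real.pi / 2 ≤ Real.pi - θ ↔ θ ≤ Real.pi / 2 := by
            constructor <;> intro h <;> linarith
          rcases hcases with ⟨rfl, rfl⟩ | ⟨rfl, rfl⟩ <;> by_cases hθ : θ ≤ Real.pi / 2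
          all_goals
            have hθ' : θ - Real.pi / 2 ≤ Real.pi / 2 := by linarith
            simp [BlobCond, Allowed, NoCut, leafCounts, redCount, cutCount, hle, hθ, hθ', coefRed,
              coef_one]
        · rw [if_neg hkr, mul_zero, if_neg]
          rintro ⟨-, h⟩
          simp only [leafCounts, redCount, cutCount, Prod.mk.injEq] at h
          split_ifs at h <;> omega
      · rw [← sum_choose_mul_choose r k fun i j => stripRed (Real.pi / 2) r i j θ]
        have hm : ∀ x : (ℕ × ℕ) × (ℕ × ℕ), Measurable fun p : ℝ × ℝ =>
            coefRed (Real.pi / 2) x.1.1 (x.2.1 + x.1.1) p.1 *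
            coefRed (Real.pi / 2) x.1.2 (x.2.2 + x.1.2) p.2 := fun x =>
          ((measurable_coefRed _ _ _).comp measurable_fst).mul
            ((measurable_coefRed _ _ _).comp measurable_snd)
        have e : ∀ p ∈ tri θ (stripEnd (Real.pi / 2) θ),
            ∑ i ∈ antidiagonal r ×ˢ antidiagonal k,
              (statFun 1 BlobCond leafCounts (i.1.1, i.2.1)).total p.1 *
                (statFun 1 BlobCond leafCounts (i.1.2, i.2.2)).total p.2 =
            ∑ x ∈ antidiagonal r ×ˢ antidiagonal k,
              (((x.2.1 + x.1.1).choose x.1.1 * (x.2.2 + x.1.2).choose x.1.2 : ℕ) : ℝ≥0∞) *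
              (coefRed (Real.pi / 2) x.1.1 (x.2.1 + x.1.1) p.1 *
                coefRed (Real.pi / 2) x.1.2 (x.2.2 + x.1.2) p.2) := by
          rintro p ⟨hp1, hp2, hp3, hp4⟩
          have hp5 : stripEnd (Real.pi / 2) θ ≤ Real.pi := by unfold stripEnd; split_ifs <;> linarith
          refine Finset.sum_congr rfl fun x hx => ?_
          obtain ⟨⟨r₁, r₂⟩, k₁, k₂⟩ := x
          simp only [Finset.mem_product, mem_antidiagonal] at hx
          simp only
          rcases Nat.eq_zero_or_pos (k₁ + r₁) with hi | hi
          · obtain ⟨rfl, rfl⟩ : k₁ = 0 ∧ r₁ = 0 := by omega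
            rw [total_blob_zero, coefRed_zero_right]
            simp
          rcases Nat.eq_zero_or_pos (k₂ + r₂) with hj | hj
          · obtain ⟨rfl, rfl⟩ : k₂ = 0 ∧ r₂ = 0 := by omega
            rw [total_blob_zero, coefRed_zero_right]
            simp
          rw [ih (k₁ + r₁) (by omega) r₁ k₁ hp1.le (by linarith) rfl,
            ih (k₂ + r₂) (by omega) r₂ k₂ hp2.le (by linarith) rfl]
          push_cast
          ring
        rw [setLIntegral_congr_fun (measurableSet_tri _ _) e,
          lintegral_finsetSum _ fun x _ => (hm x).const_mul _]
        refine Finset.sum_congr rfl fun x hx => ?_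
        rw [lintegral_const_mul _ (hm x), lintegral_strip_coefRed_mul]
        simp only [Finset.mem_product, mem_antidiagonal] at hx
        rw [hx.1]
    · intro l r' p a b
      rw [exists_counts_iff]
      have h := allowed_notCut_node_iff θ l r' p a b
      obtain ⟨α, β⟩ := p
      simp only [BlobCond, NoCut, leafCounts, redCount, cutCount, Prod.mk.injEq] at h ⊢
      tauto

theorem measurableSet_blobSet (r k : ℕ) (τ : BinTree) : MeasurableSet (blobSet r k τ) := by
  match τ with
  | .leaf => exact MeasurableSet.const _
  | .node l r' =>
    have h1 : Measurable fun q : (ℝ × ℝ) × (Ang l × Ang r') => (q.1.2, q.2.1) := by fun_prop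
    have h2 : Measurable fun q : (ℝ × ℝ) × (Ang l × Ang r') => (q.1.1, q.2.2) := by fun_prop
    have h3 : MeasurableSet {q : (ℝ × ℝ) × (Ang l × Ang r') | Allowed Real.pi (.node l r') q} :=
      (measurableSet_allowed (.node l r')).preimage measurable_prodMk_left
    have h4 : MeasurableSet {q : (ℝ × ℝ) × (Ang l × Ang r') |
        Real.pi / 2 ≤ 2 * Real.pi - q.1.1 - q.1.2} :=
      measurableSet_le measurable_const (by fun_prop)
    have h5 := ((measurable_redCount l).comp h1).add ((measurable_redCount r').comp h2)
      (measurableSet_singleton r)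
    have h6 := ((measurable_cutCount l).comp h1).add ((measurable_cutCount r').comp h2)
      (measurableSet_singleton k)
    exact h3.inter (h4.inter (((measurableSet_noCut l).preimage h1).inter
      (((measurableSet_noCut r').preimage h2).inter (h5.inter h6))))

/-- The total weight of the blobs with `r` red leaves and `k` cut-edges besides the root. -/
theorem tsum_blobSet (r k : ℕ) : ∑' τ, volume (blobSet r k τ) =
    (if r = 1 ∧ k = 0 then 1 else 0) + ((k + r).choose r : ℝ≥0∞) *
      ∑ ij ∈ antidiagonal (k + r), convRed (Real.pi / 2) r ij.1 ij.2 0 := by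
  have hpi := Real.pi_pos
  let u : AngFun := fun _ τ a => (blobSet r k τ).indicator 1 a
  -- the boundary `s + t = π / 2`, included in the definition of a blob, is negligible
  let S : Set (ℝ × ℝ) := {p | 0 < p.1 ∧ 0 < p.2 ∧ Real.pi / 2 ≤ p.1 + p.2 ∧
    p.1 + p.2 < 2 * (Real.pi / 2)}
  have hS : MeasurableSet S := by unfold S; measurability
  have hu : ∑' τ, volume (blobSet r k τ) = u.total 0 :=
    tsum_congr fun τ => (lintegral_indicator_one (measurableSet_blobSet r k τ)).symm
  have hM := fun ξ => statFun_meas 1 measurableSet_blobCond measurableSet_leafCounts ξ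
  rw [hu, AngFun.total_eq (antidiagonal r ×ˢ antidiagonal k) hS
    (f := fun x => statFun 1 BlobCond leafCounts (x.1.1, x.2.1))
    (g := fun x => statFun 1 BlobCond leafCounts (x.1.2, x.2.2))
    (fun x => hM _) (fun x => hM _)]
  · congr 1
    · split_ifs with h
      · exact Set.indicator_of_mem (show () ∈ blobSet r k .leaf from h) _
      · exact Set.indicator_of_notMem (show () ∉ blobSet r k .leaf from h) _
    · rw [← sum_choose_mul_choose r k fun i j => convRed (Real.pi / 2) r i j 0]
      have hm : ∀ x : (ℕ × ℕ) × (ℕ × ℕ), Measurable fun p : ℝ × ℝ =>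
          coefRed (Real.pi / 2) x.1.1 (x.2.1 + x.1.1) p.1 *
          coefRed (Real.pi / 2) x.1.2 (x.2.2 + x.1.2) p.2 := fun x =>
        ((measurable_coefRed _ _ _).comp measurable_fst).mul
          ((measurable_coefRed _ _ _).comp measurable_snd)
      have e : ∀ p ∈ S, ∑ i ∈ antidiagonal r ×ˢ antidiagonal k,
            (statFun 1 BlobCond leafCounts (i.1.1, i.2.1)).total p.1 *
              (statFun 1 BlobCond leafCounts (i.1.2, i.2.2)).total p.2 =
          ∑ x ∈ antidiagonal r ×ˢ antidiagonal k,
            (((x.2.1 + x.1.1).choose x.1.1 * (x.2.2 + x.1.2).choose x.1.2 : ℕ) : ℝ≥0∞) *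
            (coefRed (Real.pi / 2) x.1.1 (x.2.1 + x.1.1) p.1 *
              coefRed (Real.pi / 2) x.1.2 (x.2.2 + x.1.2) p.2) := by
        rintro p ⟨hp1, hp2, hp3, hp4⟩
        refine Finset.sum_congr rfl fun x hx => ?_
        rw [total_blob _ _ hp1.le (by linarith), total_blob _ _ hp2.le (by linarith)]
        push_cast
        ring
      rw [setLIntegral_congr_fun hS e, restrict_tri_closed,
        lintegral_finsetSum _ fun x _ => (hm x).const_mul _]
      refine Finset.sum_congr rfl fun x hx => ?_
      have h := lintegral_coefRed_mul (Real.pi / 2) 0 x.1.1 x.1.2 (x.2.1 + x.1.1)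
        (x.2.2 + x.1.2)
      rw [zero_add] at h
      rw [lintegral_const_mul _ (hm x), h]
      simp only [Finset.mem_product, mem_antidiagonal] at hx
      rw [hx.1]
  · intro l r' p a b
    simp only [statFun]
    rw [sum_ite_mul_ite _ (injOn_counts _)]
    have h := allowed_node_iff 0 l r' p a b
    rw [sub_zero] at h
    have hmem : (p, (a, b)) ∈ blobSet r k (.node l r') ↔ flip p ∈ S ∧
        (BlobCond p.2 l a ∧ BlobCond p.1 r' b) ∧ ∃ i ∈ antidiagonal r ×ˢ antidiagonal k,
          leafCounts p.2 l a = (i.1.1, i.2.1) ∧ leafCounts p.1 r' b = (i.1.2, i.2.2) := by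
      rw [exists_counts_iff]
      obtain ⟨α, β⟩ := p
      have hS : flip (α, β) ∈ S ↔ flip (α, β) ∈ tri 0 Real.pi ∧
          Real.pi / 2 ≤ 2 * Real.pi - α - β := by
        simp only [S, tri, flip, Set.mem_ofPred_eq]
        constructor
        · rintro ⟨h1, h2, h3, h4⟩
          exact ⟨⟨h1, h2, by linarith, by linarith⟩, by linarith⟩
        · rintro ⟨⟨h1, h2, h3, h4⟩, h5⟩
          exact ⟨h1, h2, by linarith, by linarith⟩
      rw [hS]
      have e : ((α, β), (a, b)) ∈ blobSet r k (.node l r') ↔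
        Allowed Real.pi (.node l r') ((α, β), (a, b)) ∧
        Real.pi / 2 ≤ 2 * Real.pi - α - β ∧ NoCut β l a ∧ NoCut α r' b ∧
        redCount β l a + redCount α r' b = r ∧ cutCount β l a + cutCount α r' b = k := Iff.rfl
      rw [e, h]
      simp only [BlobCond, leafCounts]
      tauto
    by_cases hp : flip p ∈ S
    · rw [Set.indicator_of_mem hp, Pi.one_apply, one_mul]
      rw [and_iff_right hp] at hmem
      split_ifs with h'
      · rw [Pi.one_apply, Pi.one_apply, one_mul]
        exact Set.indicator_of_mem (hmem.2 h') _
      · exact Set.indicator_of_notMem (fun h2 => h' (hmem.1 h2)) _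
    · rw [Set.indicator_of_notMem hp, zero_mul]
      exact Set.indicator_of_notMem (fun h' => hp (hmem.1 h').1) _

theorem blobWeight_zero (k : ℕ) : blobWeight 0 k = (redFree k).toReal := by
  rw [blobWeight, tsum_blobSet, sum_convRed_zero]
  simp [redFree]

theorem blobWeight_one (k : ℕ) :
    blobWeight 1 k = ((k : ℝ) + 1) * (coef (Real.pi / 2) (k + 1) 0).toReal := by
  rw [blobWeight, tsum_blobSet, sum_convRed_one half_pi_pos.le]
  rcases Nat.eq_zero_or_pos k with rfl | hk
  · simp
  · simp [hk.ne', ENNReal.toReal_mul, ENNReal.toReal_add]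

theorem offspring_eq (k : ℕ) : offspring k = pv k := by
  rw [offspring, pv, blobWeight_zero, blobWeight_one, qc_eq, blobCoef, zpow_sub₀ qv_pos.ne']
  simp [mul_div_assoc]

/-! ### Weights of bicolored trees -/

mutual
/-- An injective numbering of the bicolored trees. -/
def BiTree.code : BiTree → ℕ
  | .red => 0
  | .black ds => BiTree.codeList ds + 1
/-- An injective numbering of the lists of bicolored trees. -/
def BiTree.codeList : List BiTree → ℕ
  | [] => 0
  | d :: ds => Nat.pair d.code (BiTree.codeList ds) + 1
end

mutual
theorem BiTree.eq_of_code_eq : ∀ d e : BiTree, d.code = e.code → d = e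
  | .red, .red, _ => rfl
  | .red, .black _, h => by simp [BiTree.code] at h
  | .black _, .red, h => by simp [BiTree.code] at h
  | .black ds, .black es, h => by
    simp only [BiTree.code, Nat.add_right_cancel_iff] at h
    rw [BiTree.eq_of_codeList_eq ds es h]
theorem BiTree.eq_of_codeList_eq : ∀ ds es : List BiTree,
    BiTree.codeList ds = BiTree.codeList es → ds = es
  | [], [], _ => rfl
  | [], _ :: _, h => by simp [BiTree.codeList] at h
  | _ :: _, [], h => by simp [BiTree.codeList] at h
  | d :: ds, e :: es, h => by
    simp only [BiTree.codeList, Nat.add_right_cancel_iff, Nat.pair_eq_pair] at h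
    rw [BiTree.eq_of_code_eq d e h.1, BiTree.eq_of_codeList_eq ds es h.2]
end

instance : Countable BiTree :=
  Function.Injective.countable (f := BiTree.code) fun d e h => BiTree.eq_of_code_eq d e h

instance : MeasurableSpace (List BiTree) := ⊤

instance : DiscreteMeasurableSpace BiTree := ⟨fun _ => trivial⟩

instance : DiscreteMeasurableSpace (List BiTree) := ⟨fun _ => trivial⟩

/-- Whether a bicolored tree is a red leaf. -/
def BiTree.isRed : BiTree → Bool
  | .red => true
  | .black _ => false

/-- The number of red leaves in a list of children. -/
def reds (ds : List BiTree) : ℕ := ds.countP BiTree.isRed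

theorem reds_append (ds es : List BiTree) : reds (ds ++ es) = reds ds + reds es :=
  List.countP_append

/-- The weight of the blobs with a given pattern of `n` non-root leaves, `r` of them being red and
the other ones cut-edges. -/
def patternWeight (r n : ℕ) : ℝ≥0∞ :=
  match r with
  | 0 => redFree n
  | 1 => coef (Real.pi / 2) n 0
  | _ + 2 => 0

theorem patternWeight_eq (r n : ℕ) : patternWeight r n = (if r = 1 ∧ n = 1 then 1 else 0) +
    ∑ ij ∈ antidiagonal n, convRed (Real.pi / 2) r ij.1 ij.2 0 := by
  match r with
  | 0 => rw [sum_convRed_zero]; simp [patternWeight, redFree]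
  | 1 => rw [patternWeight, sum_convRed_one half_pi_pos.le]; simp
  | r + 2 => simp [patternWeight, convRed]

mutual
/-- The weight of a bicolored tree: `x` for each red leaf and the weight of the pattern for each
black vertex. -/
def mass (x : ℝ≥0∞) : BiTree → ℝ≥0∞
  | .red => x
  | .black ds => patternWeight (reds ds) ds.length * massList x ds
/-- The product of the weights of the trees of a list. -/
def massList (x : ℝ≥0∞) : List BiTree → ℝ≥0∞
  | [] => 1
  | d :: ds => mass x d * massList x ds
end

theorem massList_append (x : ℝ≥0∞) (ds es : List BiTree) :
    massList x (ds ++ es) = massList x ds * massList x es := by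
  induction ds with
  | nil => simp [massList]
  | cons d ds ih => rw [List.cons_append, massList, massList, ih, mul_assoc]

theorem measurable_kids (τ : BinTree) : Measurable fun q : ℝ × Ang τ => kids q.1 τ q.2 := by
  induction τ with
  | leaf =>
    exact Measurable.ite (measurableSet_isCut measurable_fst measurable_const) measurable_const
      measurable_const
  | node l r hl hr =>
    have h1 : Measurable fun q : ℝ × ((ℝ × ℝ) × (Ang l × Ang r)) => (q.2.1.2, q.2.2.1) := by fun_prop
    have h2 : Measurable fun q : ℝ × ((ℝ × ℝ) × (Ang l × Ang r)) => (q.2.1.1, q.2.2.2) := by fun_prop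
    have h3 : MeasurableSet {q : ℝ × ((ℝ × ℝ) × (Ang l × Ang r)) |
        IsCut q.1 (2 * Real.pi - q.2.1.1 - q.2.1.2)} :=
      measurableSet_isCut (by fun_prop) (by fun_prop)
    have h4 := (hl.comp h1).prodMk (hr.comp h2)
    have h5 := (Measurable.of_discrete (f := fun y : List BiTree × List BiTree => y.1 ++ y.2)).comp h4
    have h6 := (Measurable.of_discrete (f := fun y : List BiTree × List BiTree =>
      [BiTree.black (y.1 ++ y.2)])).comp h4
    exact Measurable.ite h3 h6 h5

theorem measurableSet_kids (τ : BinTree) (ds : List BiTree) :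
    MeasurableSet {q : ℝ × Ang τ | kids q.1 τ q.2 = ds} :=
  measurable_kids τ (measurableSet_singleton ds)

theorem kids_ne_nil (φ : ℝ) (τ : BinTree) (a : Ang τ) : kids φ τ a ≠ [] := by
  induction τ generalizing φ with
  | leaf => unfold kids; split_ifs <;> simp
  | node l r hl hr =>
    obtain ⟨⟨α, β⟩, a, b⟩ := a
    have := hl β a
    rw [kids]
    split_ifs <;> simp [this]

theorem one_lt_length_append_kids (φ ψ : ℝ) (l r : BinTree) (a : Ang l) (b : Ang r) :
    1 < (kids φ l a ++ kids ψ r b).length := by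
  have h1 := List.length_pos_iff.2 (kids_ne_nil φ l a)
  have h2 := List.length_pos_iff.2 (kids_ne_nil ψ r b)
  rw [List.length_append]
  omega

/-! ### The law of the list of children -/

/-- The total weight of the trees whose list of children is `ds`. -/
abbrev kidsFun (x : ℝ≥0∞) (ds : List BiTree) : AngFun :=
  statFun (fun τ => x ^ τ.numLeaves) Allowed kids ds

theorem total_kids_eq_tsum (x : ℝ≥0∞) (ds : List BiTree) (θ : ℝ) : (kidsFun x ds).total θ =
    ∑' τ : BinTree, x ^ τ.numLeaves *
      volume {a | Allowed (Real.pi - θ) τ a ∧ kids (Real.pi - θ) τ a = ds} :=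
  total_statFun_eq_tsum measurableSet_allowed measurableSet_kids _ _ _

theorem total_kids_nil (x : ℝ≥0∞) (θ : ℝ) : (kidsFun x []).total θ = 0 := by
  rw [total_kids_eq_tsum]
  simp [kids_ne_nil]

theorem injOn_splits (ds : List BiTree) : Set.InjOn
    (fun ij : ℕ × ℕ => (ds.take ij.1, ds.drop ij.1)) (antidiagonal ds.length : Finset (ℕ × ℕ)) := by
  rintro ⟨i, j⟩ hi ⟨i', j'⟩ hi' h
  simp only [Finset.mem_coe, mem_antidiagonal, Prod.mk.injEq] at hi hi' h
  have h1 := congrArg List.length h.1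
  rw [List.length_take, List.length_take] at h1
  ext <;> simp only <;> omega

theorem exists_split_iff (ds x y : List BiTree) :
    (∃ ij ∈ antidiagonal ds.length, x = ds.take ij.1 ∧ y = ds.drop ij.1) ↔ x ++ y = ds := by
  constructor
  · rintro ⟨ij, -, rfl, rfl⟩
    exact List.take_append_drop _ _
  · rintro rfl
    exact ⟨(x.length, y.length), by simp, by simp, by simp⟩

/-- The property of a tree `d` that the trees with the single child `d` have the expected weight. -/
def SingleChild (x : ℝ≥0∞) (d : BiTree) : Prop := ∀ θ, 0 ≤ θ → θ ≤ Real.pi →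
  (kidsFun x [d]).total θ = coefRed (Real.pi / 2) (reds [d]) 1 θ * mass x d

/-- The integral over a set of angles at the root vertex splits according to the children behind the
left edge. -/
theorem lintegral_splits (x : ℝ≥0∞) (ds : List BiTree) {S : Set (ℝ × ℝ)} (hS : MeasurableSet S)
    (h : ∀ p ∈ S, ∀ ij ∈ antidiagonal ds.length,
      (kidsFun x (ds.take ij.1)).total p.1 * (kidsFun x (ds.drop ij.1)).total p.2 =
        (coefRed (Real.pi / 2) (reds (ds.take ij.1)) ij.1 p.1 * massList x (ds.take ij.1)) *
        (coefRed (Real.pi / 2) (reds (ds.drop ij.1)) ij.2 p.2 * massList x (ds.drop ij.1))) :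
    ∫⁻ p in S, ∑ ij ∈ antidiagonal ds.length,
        (kidsFun x (ds.take ij.1)).total p.1 * (kidsFun x (ds.drop ij.1)).total p.2 =
      (∑ ij ∈ antidiagonal ds.length, ∫⁻ p in S,
        coefRed (Real.pi / 2) (reds (ds.take ij.1)) ij.1 p.1 *
        coefRed (Real.pi / 2) (reds (ds.drop ij.1)) ij.2 p.2) * massList x ds := by
  have hm : ∀ ij : ℕ × ℕ, Measurable fun p : ℝ × ℝ =>
      coefRed (Real.pi / 2) (reds (ds.take ij.1)) ij.1 p.1 *
        coefRed (Real.pi / 2) (reds (ds.drop ij.1)) ij.2 p.2 := fun ij =>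
    ((measurable_coefRed _ _ _).comp measurable_fst).mul
      ((measurable_coefRed _ _ _).comp measurable_snd)
  rw [Finset.sum_mul, setLIntegral_congr_fun hS fun p hp => Finset.sum_congr rfl (h p hp)]
  have e : ∀ ij : ℕ × ℕ, massList x ds = massList x (ds.take ij.1) * massList x (ds.drop ij.1) :=
    fun ij => by rw [← massList_append, List.take_append_drop]
  simp_rw [← lintegral_mul_const _ (hm _)]
  rw [← lintegral_finsetSum _ fun ij _ => (hm ij).mul_const _]
  refine lintegral_congr fun p => Finset.sum_congr rfl fun ij _ => ?_
  rw [e ij]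
  ring

theorem reds_take_add_drop (ds : List BiTree) (i : ℕ) :
    reds (ds.take i) + reds (ds.drop i) = reds ds := by
  rw [← reds_append, List.take_append_drop]

/-- The weight of the trees with list of children `ds`, if this is known for single children. -/
theorem total_kids_list {x : ℝ≥0∞} (ds : List BiTree) (hds : ∀ d ∈ ds, SingleChild x d) {θ : ℝ}
    (h0 : 0 ≤ θ) (h1 : θ ≤ Real.pi) : (kidsFun x ds).total θ =
      coefRed (Real.pi / 2) (reds ds) ds.length θ * massList x ds := by
  have hpi := Real.pi_pos
  induction hn : ds.length using Nat.strong_induction_on generalizing ds θ with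
  | _ n ih =>
    match ds, hds, hn with
    | [], _, hn =>
      rw [← hn, total_kids_nil, List.length_nil, coefRed_zero_right, zero_mul]
    | [d], hds, hn =>
      rw [hds d (by simp) θ h0 h1, ← hn]
      simp [massList]
    -- two children or more: the root edge is not a cut-edge and the list splits at the root vertex
    | d :: d' :: ds', hds, hn =>
      generalize hD : d :: d' :: ds' = ds at hds hn
      have hlen : 1 < ds.length := by rw [← hD]; simp
      subst hn
      rw [total_statFun_eq (antidiagonal ds.length) (u := fun ij => ds.take ij.1)
        (v := fun ij => ds.drop ij.1) (injOn_splits ds) (fun l r => pow_add _ _ _)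
        measurableSet_allowed measurableSet_kids
        (measurableSet_tri θ (stripEnd (Real.pi / 2) θ)), if_neg, zero_add,
        lintegral_splits x ds (measurableSet_tri _ _), coefRed_eq (by linarith), if_neg hlen.ne',
        zero_add]
      · congr 1
        refine Finset.sum_congr rfl fun ij _ => ?_
        rw [lintegral_strip_coefRed_mul, reds_take_add_drop]
      · rintro p ⟨hp1, hp2, hp3, hp4⟩ ⟨i, j⟩ hij
        have hp5 : stripEnd (Real.pi / 2) θ ≤ Real.pi := by unfold stripEnd; split_ifs <;> linarith
        simp only [mem_antidiagonal] at hij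
        simp only
        rcases Nat.eq_zero_or_pos i with rfl | hi
        · rw [List.take_zero, total_kids_nil, coefRed_zero_right]
          simp
        rcases Nat.eq_zero_or_pos j with rfl | hj
        · rw [List.drop_eq_nil_of_le (by omega), total_kids_nil, coefRed_zero_right]
          simp
        have e1 : (ds.take i).length = i := by rw [List.length_take]; omega
        have e2 : (ds.drop i).length = j := by rw [List.length_drop]; omega
        rw [ih i (by omega) (ds.take i) (fun d hd => hds d (List.mem_of_mem_take hd)) hp1.le
            (by linarith) e1,
          ih j (by omega) (ds.drop i) (fun d hd => hds d (List.mem_of_mem_drop hd)) hp2.le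
            (by linarith) e2]
      · rintro ⟨-, h⟩
        have := congrArg List.length h
        have hle : (kids (Real.pi - θ) .leaf ()).length = 1 := by
          simp only [kids]
          split_ifs <;> rfl
        rw [hle] at this
        omega
      · intro l r p a b
        rw [exists_split_iff]
        have h := allowed_notCut_node_iff θ l r p a b
        obtain ⟨α, β⟩ := p
        simp only at h
        have hk : kids (Real.pi - θ) (.node l r) ((α, β), (a, b)) = ds ↔
            ¬ IsCut (Real.pi - θ) (2 * Real.pi - α - β) ∧ kids β l a ++ kids α r b = ds := by
          rw [kids]
          split_ifs with hc
          · simp only [hc, not_true_eq_false, false_and, iff_false]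
            intro h'
            rw [← h'] at hlen
            simp at hlen
          · simp [hc]
        rw [hk, ← and_assoc, h]
        tauto

theorem singleChild_red (x : ℝ≥0∞) : SingleChild x .red := by
  intro θ h0 h1
  have hpi := Real.pi_pos
  rw [total_statFun_eq (∅ : Finset ℕ) (u := fun _ => []) (v := fun _ => []) (by simp)
    (fun l r => pow_add _ _ _) measurableSet_allowed measurableSet_kids MeasurableSet.empty]
  · have hc : IsCut (Real.pi - θ) Real.pi ↔ θ ≤ Real.pi / 2 := by
      unfold IsCut
      constructor
      · rintro ⟨h, -⟩; linarith
      · intro h; constructor <;> linarith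
    by_cases hθ : θ ≤ Real.pi / 2
    · simp [kids, hc, hθ, reds, BiTree.isRed, coefRed]
    · simp [kids, hc, hθ, reds, BiTree.isRed, coefRed, Allowed, BinTree.numLeaves, coef_one, mass,
        show θ - Real.pi / 2 ≤ Real.pi / 2 by linarith]
  · intro l r p a b
    obtain ⟨α, β⟩ := p
    simp only [Set.mem_empty_iff_false, false_and, iff_false]
    rintro ⟨-, h⟩
    rw [kids] at h
    split_ifs at h
    · simp at h
    · have := one_lt_length_append_kids β α l r a b
      rw [h] at this
      simp at this

/-- A cut-edge at the root separates the next blob, whose total weight is computed in the strip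
`π/2 < s + t < π`. -/
theorem singleChild_black {x : ℝ≥0∞} (es : List BiTree) (hes : ∀ d ∈ es, SingleChild x d) :
    SingleChild x (.black es) := by
  intro θ h0 h1
  have hpi := Real.pi_pos
  have hleaf : IsCut (Real.pi - θ) Real.pi ↔ θ ≤ Real.pi / 2 := by
    unfold IsCut
    constructor
    · rintro ⟨h, -⟩; linarith
    · intro h; constructor <;> linarith
  have hr : reds [.black es] = 0 := rfl
  set S : Set (ℝ × ℝ) := tri θ Real.pi ∩ {p | θ ≤ Real.pi / 2 ∧ Real.pi / 2 ≤ p.1 + p.2} with hSdef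
  have hS : MeasurableSet S := by
    refine (measurableSet_tri _ _).inter ((MeasurableSet.const _).inter ?_)
    exact measurableSet_le measurable_const (measurable_fst.add measurable_snd)
  rw [total_statFun_eq (antidiagonal es.length) (u := fun ij => es.take ij.1)
    (v := fun ij => es.drop ij.1) (injOn_splits es) (fun l r => pow_add _ _ _)
    measurableSet_allowed measurableSet_kids hS, lintegral_splits x es hS, hr, coefRed, coef_one,
    mass]
  · by_cases hθ : θ ≤ Real.pi / 2
    · have hrestr : volume.restrict S = volume.restrict (tri (0 + Real.pi / 2) (2 * (Real.pi / 2))) := by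
        rw [zero_add]
        rcases hθ.lt_or_eq with hlt | heq
        · rw [← restrict_tri_closed]
          refine congrArg _ (Set.ext fun p => ?_)
          simp only [hSdef, tri, Set.mem_inter_iff, Set.mem_ofPred_eq]
          constructor
          · rintro ⟨⟨h1, h2, h3, h4⟩, -, h5⟩
            exact ⟨h1, h2, h5, by linarith⟩
          · rintro ⟨h1, h2, h3, h4⟩
            exact ⟨⟨h1, h2, by linarith, by linarith⟩, hθ, h3⟩
        · refine congrArg _ (Set.ext fun p => ?_)
          simp only [hSdef, tri, Set.mem_inter_iff, Set.mem_ofPred_eq]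
          constructor
          · rintro ⟨⟨h1, h2, h3, h4⟩, -, h5⟩
            exact ⟨h1, h2, by linarith, by linarith⟩
          · rintro ⟨h1, h2, h3, h4⟩
            exact ⟨⟨h1, h2, by linarith, by linarith⟩, hθ, h3.le⟩
      rw [hrestr, if_pos hθ, one_mul, patternWeight_eq, add_mul]
      congr 1
      -- the leaf behind a cut-edge is the trivial blob
      · have hiff : (reds es = 1 ∧ es.length = 1) ↔ es = [.red] := by
          constructor
          · rintro ⟨h2, h3⟩
            obtain ⟨d, rfl⟩ := List.length_eq_one_iff.1 h3
            cases d
            · rfl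
            · simp [reds, BiTree.isRed] at h2
          · rintro rfl
            simp [reds, BiTree.isRed]
        by_cases h : es = [.red]
        · rw [if_pos (hiff.2 h), h]
          simp [Allowed, kids, hleaf, hθ, BinTree.numLeaves, massList, mass]
        · rw [if_neg (fun h' => h (hiff.1 h')), zero_mul, if_neg]
          rintro ⟨-, h'⟩
          simp only [kids, hleaf, hθ, if_true, List.cons.injEq, BiTree.black.injEq, and_true] at h'
          exact h h'.symm
      · congr 1
        refine Finset.sum_congr rfl fun ij _ => ?_
        rw [lintegral_coefRed_mul, reds_take_add_drop]
    · have hempty : S = ∅ := by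
        refine Set.eq_empty_of_forall_notMem fun p hp => hθ hp.2.1
      rw [hempty, if_neg hθ]
      simp [kids, hleaf, hθ]
  · rintro p ⟨⟨hp1, hp2, hp3, hp4⟩, -⟩ ⟨i, j⟩ hij
    simp only [mem_antidiagonal] at hij
    have e1 : (es.take i).length = i := by rw [List.length_take]; omega
    have e2 : (es.drop i).length = j := by rw [List.length_drop]; omega
    simp only
    rw [total_kids_list (es.take i) (fun d hd => hes d (List.mem_of_mem_take hd)) hp1.le
        (by linarith), e1,
      total_kids_list (es.drop i) (fun d hd => hes d (List.mem_of_mem_drop hd)) hp2.le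
        (by linarith), e2]
  · intro l r p a b
    rw [exists_split_iff]
    have h := allowed_node_iff θ l r p a b
    have hc := isCut_iff θ p
    obtain ⟨α, β⟩ := p
    simp only at h hc
    have hk : kids (Real.pi - θ) (.node l r) ((α, β), (a, b)) = [.black es] ↔
        IsCut (Real.pi - θ) (2 * Real.pi - α - β) ∧ kids β l a ++ kids α r b = es := by
      rw [kids]
      split_ifs with hc
      · simp [hc]
      · simp only [hc, false_and, iff_false]
        intro h'
        have := one_lt_length_append_kids β α l r a b
        rw [h'] at this
        simp at this
    rw [hk, h, hc]
    simp only [hSdef, Set.mem_inter_iff, Set.mem_ofPred_eq]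
    tauto

theorem singleChild (x : ℝ≥0∞) (d : BiTree) : SingleChild x d :=
  BiTree.rec (motive_1 := SingleChild x) (motive_2 := fun ds => ∀ d ∈ ds, SingleChild x d)
    (singleChild_red x) (fun es h => singleChild_black es h) (by simp)
    (fun d ds h1 h2 => by simpa using ⟨h1, h2⟩) d

/-- The total weight of the trees with list of children `ds`: it only depends on the positions of
the red leaves through their number, and the subtrees of the black children contribute a product. -/
theorem total_kids (x : ℝ≥0∞) (ds : List BiTree) {θ : ℝ} (h0 : 0 ≤ θ) (h1 : θ ≤ Real.pi) :
    (kidsFun x ds).total θ = coefRed (Real.pi / 2) (reds ds) ds.length θ * massList x ds :=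
  total_kids_list ds (fun d _ => singleChild x d) h0 h1

/-! ### The law of the blob tree -/

theorem measurable_sigmaMk_ang (τ : BinTree) : Measurable (Sigma.mk τ : Ang τ → LabTree) := by
  intro s hs
  exact MeasurableSpace.measurableSet_iInf.1 hs τ

theorem measurable_blobTree : Measurable blobTree := by
  intro s _
  refine MeasurableSpace.measurableSet_iInf.2 fun τ => ?_
  have h : Measurable fun a : Ang τ => kids Real.pi τ a :=
    (measurable_kids τ).comp measurable_prodMk_left
  exact h (MeasurableSet.of_discrete (s := BiTree.black ⁻¹' s))

theorem boltzmann_apply (x : ℝ) {s : Set LabTree} (hs : MeasurableSet s) :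
    boltzmann x 0 s = (genF x 0)⁻¹ * ∑' τ : BinTree, ENNReal.ofReal x ^ τ.numLeaves *
      volume (Sigma.mk τ ⁻¹' s ∩ angleSet 0 τ) := by
  rw [boltzmann, Measure.smul_apply, smul_eq_mul, Measure.sum_apply _ hs]
  congr 1
  refine tsum_congr fun τ => ?_
  rw [Measure.smul_apply, smul_eq_mul, Measure.map_apply (measurable_sigmaMk_ang τ) hs,
    Measure.restrict_apply (measurable_sigmaMk_ang τ hs)]

theorem genF_xc_ne_zero : genF xc 0 ≠ 0 := by
  rw [genF_xc_zero]
  have := w0_pos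
  have := Real.pi_pos
  exact (ENNReal.ofReal_pos.2 (by positivity)).ne'

theorem genF_xc_ne_top : genF xc 0 ≠ ⊤ := by
  rw [genF_xc_zero]
  exact ENNReal.ofReal_ne_top

instance isProbabilityMeasure_boltzmann : IsProbabilityMeasure (boltzmann xc 0) := by
  refine ⟨?_⟩
  rw [boltzmann_apply xc MeasurableSet.univ]
  simp only [Set.preimage_univ, Set.univ_inter]
  exact ENNReal.inv_mul_cancel genF_xc_ne_zero genF_xc_ne_top

theorem boltzmann_map_red : (boltzmann xc 0).map blobTree {BiTree.red} = 0 := by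
  rw [Measure.map_apply measurable_blobTree (measurableSet_singleton _)]
  have : blobTree ⁻¹' {BiTree.red} = ∅ := Set.eq_empty_of_forall_notMem fun t ht => by
    simp [blobTree] at ht
  rw [this, measure_empty]

theorem boltzmann_map_black (ds : List BiTree) :
    (boltzmann xc 0).map blobTree {BiTree.black ds} = (genF xc 0)⁻¹ *
      (coefRed (Real.pi / 2) (reds ds) ds.length 0 * massList (ENNReal.ofReal xc) ds) := by
  rw [Measure.map_apply measurable_blobTree (measurableSet_singleton _),
    boltzmann_apply xc (measurable_blobTree (measurableSet_singleton _)),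
    ← total_kids _ _ le_rfl Real.pi_pos.le, total_kids_eq_tsum]
  congr 1
  refine tsum_congr fun τ => ?_
  congr 2
  ext a
  simp [angleSet, blobTree, and_comm]

/-! ### Galton–Watson weights -/

mutual
/-- An injective numbering of the plane trees. -/
def PlaneTree.code : PlaneTree → ℕ
  | .node cs => PlaneTree.codeList cs
/-- An injective numbering of the lists of plane trees. -/
def PlaneTree.codeList : List PlaneTree → ℕ
  | [] => 0
  | c :: cs => Nat.pair c.code (PlaneTree.codeList cs) + 1
end

mutual
theorem PlaneTree.eq_of_code_eq : ∀ s t : PlaneTree, s.code = t.code → s = t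
  | .node cs, .node ds, h => by
    simp only [PlaneTree.code] at h
    rw [PlaneTree.eq_of_codeList_eq cs ds h]
theorem PlaneTree.eq_of_codeList_eq : ∀ cs ds : List PlaneTree,
    PlaneTree.codeList cs = PlaneTree.codeList ds → cs = ds
  | [], [], _ => rfl
  | [], _ :: _, h => by simp [PlaneTree.codeList] at h
  | _ :: _, [], h => by simp [PlaneTree.codeList] at h
  | c :: cs, d :: ds, h => by
    simp only [PlaneTree.codeList, Nat.add_right_cancel_iff, Nat.pair_eq_pair] at h
    rw [PlaneTree.eq_of_code_eq c d h.1, PlaneTree.eq_of_codeList_eq cs ds h.2]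
end

instance : Countable PlaneTree :=
  Function.Injective.countable (f := PlaneTree.code) fun s t h => PlaneTree.eq_of_code_eq s t h

mutual
/-- The probability of a plane tree when all vertices have offspring law `ν`. -/
def gw (ν : PMF ℕ) : PlaneTree → ℝ≥0∞
  | .node cs => ν cs.length * gwList ν cs
/-- The probability of a list of plane trees with offspring law `ν`. -/
def gwList (ν : PMF ℕ) : List PlaneTree → ℝ≥0∞
  | [] => 1
  | c :: cs => gw ν c * gwList ν cs
end

/-- The probability of a plane tree whose ancestor has the offspring law `ν₀`. -/
def gwRoot (ν₀ ν : PMF ℕ) : PlaneTree → ℝ≥0∞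
  | .node cs => ν₀ cs.length * gwList ν cs

mutual
/-- The vertices of a plane tree, as words of the Ulam tree, with their numbers of children. -/
def addr : PlaneTree → List (List ℕ × ℕ)
  | .node cs => ([], cs.length) :: addrFrom 0 cs
/-- The vertices of a list of plane trees hanging above the letters `i`, `i + 1`, …. -/
def addrFrom (i : ℕ) : List PlaneTree → List (List ℕ × ℕ)
  | [] => []
  | c :: cs => (addr c).map (fun p => (i :: p.1, p.2)) ++ addrFrom (i + 1) cs
end

mutual
theorem codes_iff : ∀ (κ : List ℕ → ℕ) (t : PlaneTree), Codes κ t ↔ ∀ p ∈ addr t, κ p.1 = p.2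
  | κ, .node cs => by
    rw [Codes, addr, List.forall_mem_cons, codesFrom_iff κ 0 cs]
theorem codesFrom_iff : ∀ (κ : List ℕ → ℕ) (i : ℕ) (cs : List PlaneTree),
    CodesFrom κ i cs ↔ ∀ p ∈ addrFrom i cs, κ p.1 = p.2
  | κ, i, [] => by simp [CodesFrom, addrFrom]
  | κ, i, c :: cs => by
    rw [CodesFrom, addrFrom, List.forall_mem_append, codes_iff _ c, codesFrom_iff κ (i + 1) cs,
      List.forall_mem_map]
end

theorem exists_of_mem_addrFrom (i : ℕ) (cs : List PlaneTree) (p : List ℕ × ℕ)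
    (hp : p ∈ addrFrom i cs) : ∃ j w, i ≤ j ∧ p.1 = j :: w := by
  induction cs generalizing i with
  | nil => simp [addrFrom] at hp
  | cons c cs ih =>
    rw [addrFrom, List.mem_append, List.mem_map] at hp
    rcases hp with ⟨q, -, rfl⟩ | hp
    · exact ⟨i, q.1, le_rfl, rfl⟩
    · obtain ⟨j, w, hj, h⟩ := ih (i + 1) hp
      exact ⟨j, w, by omega, h⟩

mutual
theorem nodup_addr : ∀ t : PlaneTree, ((addr t).map Prod.fst).Nodup
  | .node cs => by
    rw [addr, List.map_cons, List.nodup_cons]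
    refine ⟨fun h => ?_, nodup_addrFrom 0 cs⟩
    obtain ⟨p, hp, hp'⟩ := List.mem_map.1 h
    obtain ⟨j, w, -, h'⟩ := exists_of_mem_addrFrom 0 cs p hp
    rw [h'] at hp'
    exact absurd hp' (by simp)
theorem nodup_addrFrom : ∀ (i : ℕ) (cs : List PlaneTree), ((addrFrom i cs).map Prod.fst).Nodup
  | _, [] => by simp [addrFrom]
  | i, c :: cs => by
    have h1 := nodup_addr c
    have h2 := nodup_addrFrom (i + 1) cs
    rw [addrFrom, List.map_append, List.nodup_append]
    refine ⟨?_, h2, ?_⟩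
    · rw [List.map_map, show (Prod.fst ∘ fun p : List ℕ × ℕ => (i :: p.1, p.2)) =
        (fun w => i :: w) ∘ Prod.fst from rfl, ← List.map_map]
      exact h1.map (List.cons_injective)
    · intro x hx y hy hxy
      obtain ⟨p, hp, rfl⟩ := List.mem_map.1 hx
      obtain ⟨q, -, rfl⟩ := List.mem_map.1 hp
      obtain ⟨p', hp', rfl⟩ := List.mem_map.1 hy
      obtain ⟨j, w, hj, h⟩ := exists_of_mem_addrFrom (i + 1) cs p' hp'
      rw [h] at hxy
      simp only [List.cons.injEq] at hxy
      omega
end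

mutual
theorem prod_addr (ν : PMF ℕ) : ∀ t : PlaneTree, ((addr t).map fun p => ν p.2).prod = gw ν t
  | .node cs => by rw [addr, List.map_cons, List.prod_cons, prod_addrFrom ν 0 cs, gw]
theorem prod_addrFrom (ν : PMF ℕ) : ∀ (i : ℕ) (cs : List PlaneTree),
    ((addrFrom i cs).map fun p => ν p.2).prod = gwList ν cs
  | _, [] => by simp [addrFrom, gwList]
  | i, c :: cs => by
    rw [addrFrom, List.map_append, List.prod_append, prod_addrFrom ν (i + 1) cs, gwList,
      ← prod_addr ν c, List.map_map]
    rfl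
end

/-- Prescribing the offspring numbers of finitely many distinct words is a cylinder event. -/
theorem offspringLaw_forall_mem (ν₀ ν : PMF ℕ) (l : List (List ℕ × ℕ))
    (hl : (l.map Prod.fst).Nodup) : offspringLaw ν₀ ν {κ | ∀ p ∈ l, κ p.1 = p.2} =
      (l.map fun p => (if p.1 = [] then ν₀ else ν) p.2).prod := by
  classical
  have hl' : l.Nodup := hl.of_map
  have hinj : ∀ p ∈ l, ∀ p' ∈ l, p.1 = p'.1 → p = p' := fun p hp p' hp' h =>
    List.inj_on_of_nodup_map hl hp hp' h
  have hset : {κ : List ℕ → ℕ | ∀ p ∈ l, κ p.1 = p.2} =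
      Set.pi ((l.toFinset.image Prod.fst : Finset (List ℕ)) : Set (List ℕ))
        (fun w => {n | ∀ p ∈ l, p.1 = w → n = p.2}) := by
    ext κ
    simp only [Set.mem_pi, Finset.coe_image, Set.mem_image, Finset.mem_coe, List.mem_toFinset,
      Set.mem_ofPred_eq]
    constructor
    · rintro h w - p hp rfl
      exact h p hp
    · intro h p hp
      exact h p.1 ⟨p, hp, rfl⟩ p hp rfl
  rw [hset, offspringLaw, Measure.infinitePi_pi _ (fun _ _ => MeasurableSet.of_discrete),
    Finset.prod_image (fun p hp p' hp' h => hinj p (List.mem_toFinset.1 hp) p'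
      (List.mem_toFinset.1 hp') h), List.prod_toFinset _ hl']
  refine congrArg List.prod (List.map_congr_left fun p hp => ?_)
  have : {n | ∀ p' ∈ l, p'.1 = p.1 → n = p'.2} = {p.2} := by
    ext n
    simp only [Set.mem_ofPred_eq, Set.mem_singleton_iff]
    constructor
    · intro h
      exact h p hp rfl
    · rintro rfl p' hp' h
      rw [hinj p' hp' p hp h]
  rw [this]
  exact PMF.toMeasure_apply_singleton _ _ (measurableSet_singleton _)

/-- The probability that the offspring numbers generate a given tree. -/
theorem offspringLaw_codes (ν₀ ν : PMF ℕ) (t : PlaneTree) :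
    offspringLaw ν₀ ν {κ | Codes κ t} = gwRoot ν₀ ν t := by
  simp_rw [codes_iff]
  rw [offspringLaw_forall_mem ν₀ ν _ (nodup_addr t)]
  obtain ⟨cs⟩ := t
  rw [addr, List.map_cons, List.prod_cons, gwRoot, ← prod_addrFrom ν 0 cs, if_pos rfl]
  congr 2
  refine List.map_congr_left fun p hp => ?_
  obtain ⟨j, w, -, h⟩ := exists_of_mem_addrFrom 0 cs p hp
  rw [if_neg (by simp [h])]

mutual
theorem codes_unique : ∀ (κ : List ℕ → ℕ) (s t : PlaneTree), Codes κ s → Codes κ t → s = t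
  | κ, .node cs, .node ds, h, h' => by
    rw [Codes] at h h'
    rw [codesFrom_unique κ 0 cs ds (h.1.symm.trans h'.1) h.2 h'.2]
theorem codesFrom_unique : ∀ (κ : List ℕ → ℕ) (i : ℕ) (cs ds : List PlaneTree),
    cs.length = ds.length → CodesFrom κ i cs → CodesFrom κ i ds → cs = ds
  | _, _, [], [], _, _, _ => rfl
  | _, _, [], _ :: _, h, _, _ => by simp at h
  | _, _, _ :: _, [], h, _, _ => by simp at h
  | κ, i, c :: cs, d :: ds, h, h1, h2 => by
    rw [CodesFrom] at h1 h2
    rw [codes_unique _ c d h1.1 h2.1, codesFrom_unique κ (i + 1) cs ds (by simpa using h) h1.2 h2.2]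
end

theorem measurableSet_codes (t : PlaneTree) : MeasurableSet {κ | Codes κ t} := by
  simp_rw [codes_iff]
  have : {κ : List ℕ → ℕ | ∀ p ∈ addr t, κ p.1 = p.2} =
      ⋂ p ∈ {p | p ∈ addr t}, {κ | κ p.1 = p.2} := by ext κ; simp
  rw [this]
  refine MeasurableSet.biInter (List.finite_toSet _).countable fun p _ => ?_
  exact measurableSet_eq_fun (measurable_pi_apply p.1) measurable_const

/-- If the weights of the finite trees sum to one, the Galton–Watson tree is almost surely finite. -/
theorem ae_exists_codes {ν₀ ν : PMF ℕ} (h : ∑' t, gwRoot ν₀ ν t = 1) :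
    ∀ᵐ κ ∂(offspringLaw ν₀ ν), ∃ t : PlaneTree, Codes κ t := by
  have hprob : IsProbabilityMeasure (offspringLaw ν₀ ν) := by
    unfold offspringLaw; infer_instance
  have hU : {κ : List ℕ → ℕ | ∃ t : PlaneTree, Codes κ t} = ⋃ t, {κ | Codes κ t} := by ext; simp
  have hm : MeasurableSet {κ : List ℕ → ℕ | ∃ t : PlaneTree, Codes κ t} := by
    rw [hU]; exact MeasurableSet.iUnion measurableSet_codes
  refine (mem_ae_iff_prob_eq_one hm).2 ?_
  rw [hU, measure_iUnion]
  · simp_rw [offspringLaw_codes, h]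
  · intro s t hst
    refine Set.disjoint_left.2 fun κ h1 h2 => hst (codes_unique κ s t h1 h2)
  · exact measurableSet_codes

/-! ### The bicolored Galton–Watson tree -/

theorem tsum_list {α : Type*} (f : List α → ℝ≥0∞) :
    ∑' l, f l = f [] + ∑' a, ∑' l, f (a :: l) := by
  let e : Unit ⊕ (α × List α) ≃ List α :=
    { toFun := Sum.elim (fun _ => []) fun p => p.1 :: p.2
      invFun := fun l => match l with
        | [] => .inl ()
        | a :: l => .inr (a, l)
      left_inv := by rintro (_ | ⟨a, l⟩) <;> rfl
      right_inv := by rintro (_ | ⟨a, l⟩) <;> rfl }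
  rw [← e.tsum_eq, Summable.tsum_sum ENNReal.summable ENNReal.summable, ENNReal.tsum_prod']
  exact congrArg (· + _) (tsum_eq_single () (by simp))

theorem tsum_planeTree (f : PlaneTree → ℝ≥0∞) : ∑' t, f t = ∑' cs, f (.node cs) := by
  let e : List PlaneTree ≃ PlaneTree :=
    { toFun := .node
      invFun := fun t => match t with
        | .node cs => cs
      left_inv := fun _ => rfl
      right_inv := by rintro ⟨cs⟩; rfl }
  exact (e.tsum_eq f).symm

section

variable (ρ : ℕ → unitInterval)

theorem redListLaw_nil_apply (ds : List BiTree) :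
    redListLaw ρ [] ds = if ds = [] then 1 else 0 := by
  rw [redListLaw, PMF.pure_apply]
  split_ifs <;> rfl

theorem redListLaw_cons_nil (c : PlaneTree) (cs : List PlaneTree) :
    redListLaw ρ (c :: cs) [] = 0 := by
  simp [redListLaw, PMF.bind_apply, PMF.map_apply]

theorem redListLaw_cons_cons (c : PlaneTree) (cs : List PlaneTree) (d : BiTree)
    (ds : List BiTree) :
    redListLaw ρ (c :: cs) (d :: ds) = redLaw ρ c d * redListLaw ρ cs ds := by
  classical
  rw [redListLaw, PMF.bind_apply, tsum_eq_single d]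
  · rw [PMF.map_apply, tsum_eq_single ds]
    · simp
    · intro ds' h
      rw [if_neg]
      simpa using h.symm
  · intro d' h
    rw [PMF.map_apply, ENNReal.tsum_eq_zero.2, mul_zero]
    intro ds'
    rw [if_neg]
    intro h'
    simp only [List.cons.injEq] at h'
    exact h h'.1.symm

theorem length_eq_of_redListLaw_ne_zero (cs : List PlaneTree) (ds : List BiTree)
    (h : redListLaw ρ cs ds ≠ 0) : cs.length = ds.length := by
  induction cs generalizing ds with
  | nil =>
    rw [redListLaw_nil_apply] at h
    by_cases hds : ds = []
    · rw [hds]; rfl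
    · simp [hds] at h
  | cons c cs ih =>
    cases ds with
    | nil => exact absurd (redListLaw_cons_nil ρ c cs) h
    | cons d ds =>
      rw [redListLaw_cons_cons] at h
      rw [List.length_cons, List.length_cons, ih ds (right_ne_zero_of_mul h)]

/-- The probability of obtaining `es` from a list `ds` of `k` children by adding a red leaf. -/
def markProb (k : ℕ) (ds es : List BiTree) : ℝ≥0∞ :=
  ((markLaw k (ρ k)).map fun m => BiTree.black (insertRed ds m)) (.black es)

open Classical in
theorem markProb_eq (k : ℕ) (ds es : List BiTree) : markProb ρ k ds es =
    (if es = ds then ENNReal.ofReal (1 - (ρ k : ℝ)) else 0) +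
      ∑ i : Fin (k + 1), if es = ds.insertIdx i .red then
        ENNReal.ofReal ((ρ k : ℝ) / ((k : ℝ) + 1)) else 0 := by
  rw [markProb, PMF.map_apply, tsum_fintype, Fintype.sum_option]
  simp [markLaw, insertRed]

theorem redLaw_node_red (cs : List PlaneTree) : redLaw ρ (.node cs) .red = 0 := by
  simp [redLaw, PMF.bind_apply, PMF.map_apply]

theorem redLaw_node_black (cs : List PlaneTree) (es : List BiTree) :
    redLaw ρ (.node cs) (.black es) = ∑' ds, redListLaw ρ cs ds * markProb ρ cs.length ds es := by
  rw [redLaw, PMF.bind_apply]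
  rfl

variable (ν : PMF ℕ)

/-- The law of the bicolored Galton–Watson tree. -/
def vertexLaw (d : BiTree) : ℝ≥0∞ := ∑' t, gw ν t * redLaw ρ t d

theorem vertexLaw_red : vertexLaw ρ ν .red = 0 := by
  rw [vertexLaw, tsum_planeTree]
  simp [redLaw_node_red]

/-- The trees above distinct children are independent. -/
theorem tsum_gwList_mul_redListLaw (ds : List BiTree) :
    ∑' cs, gwList ν cs * redListLaw ρ cs ds = (ds.map (vertexLaw ρ ν)).prod := by
  induction ds with
  | nil =>
    rw [tsum_list]
    simp [redListLaw_nil_apply, redListLaw_cons_nil, gwList]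
  | cons d ds ih =>
    rw [tsum_list, List.map_cons, List.prod_cons, ← ih, vertexLaw, ← ENNReal.tsum_mul_right]
    simp only [redListLaw_nil_apply, redListLaw_cons_cons, gwList]
    rw [if_neg (by simp), mul_zero, zero_add]
    refine tsum_congr fun c => ?_
    rw [← ENNReal.tsum_mul_left]
    exact tsum_congr fun cs => by ring

theorem tsum_length_mul_gwList_mul_redListLaw (f : ℕ → ℝ≥0∞) (ds : List BiTree) :
    ∑' cs, f cs.length * gwList ν cs * redListLaw ρ cs ds =
      f ds.length * (ds.map (vertexLaw ρ ν)).prod := by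
  rw [← tsum_gwList_mul_redListLaw, ← ENNReal.tsum_mul_left]
  refine tsum_congr fun cs => ?_
  by_cases h : redListLaw ρ cs ds = 0
  · simp [h]
  · rw [length_eq_of_redListLaw_ne_zero ρ cs ds h, mul_assoc]

theorem vertexLaw_black (es : List BiTree) : vertexLaw ρ ν (.black es) =
    ∑' ds : List BiTree, ν ds.length * markProb ρ ds.length ds es *
      (ds.map (vertexLaw ρ ν)).prod := by
  rw [vertexLaw, tsum_planeTree]
  simp_rw [redLaw_node_black, gw, ← ENNReal.tsum_mul_left]
  rw [ENNReal.tsum_comm]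
  refine tsum_congr fun ds => ?_
  rw [← tsum_length_mul_gwList_mul_redListLaw ρ ν (fun k => ν k * markProb ρ k ds es)]
  exact tsum_congr fun cs => by ring

theorem red_mem_iff (ds : List BiTree) : BiTree.red ∈ ds ↔ reds ds ≠ 0 := by
  rw [reds, ← Nat.pos_iff_ne_zero, List.countP_pos_iff]
  constructor
  · exact fun h => ⟨_, h, rfl⟩
  · rintro ⟨d, hd, h⟩
    cases d
    · exact hd
    · simp [BiTree.isRed] at h

theorem prod_vertexLaw_eq_zero {ds : List BiTree} (h : reds ds ≠ 0) :
    (ds.map (vertexLaw ρ ν)).prod = 0 := by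
  refine List.prod_eq_zero (List.mem_map.2 ⟨.red, (red_mem_iff ds).2 h, vertexLaw_red ρ ν⟩)

theorem insertIdx_eq_append {α : Type*} (x : α) (l : List α) {i : ℕ} (h : i ≤ l.length) :
    l.insertIdx i x = l.take i ++ x :: l.drop i := by
  induction l generalizing i with
  | nil =>
    obtain rfl : i = 0 := by simpa using h
    rfl
  | cons y l ih =>
    cases i with
    | zero => rfl
    | succ i => simp [ih (by simpa using h)]

theorem reds_insertIdx (ds : List BiTree) {i : ℕ} (h : i ≤ ds.length) :
    reds (ds.insertIdx i .red) = reds ds + 1 := by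
  rw [reds, (List.perm_insertIdx _ ds h).countP_eq]
  exact List.countP_cons_of_pos rfl

/-- The law of the bicolored tree at a vertex without red leaf. -/
theorem vertexLaw_black_of_reds_zero {es : List BiTree} (h : reds es = 0) :
    vertexLaw ρ ν (.black es) = ν es.length * ENNReal.ofReal (1 - (ρ es.length : ℝ)) *
      (es.map (vertexLaw ρ ν)).prod := by
  classical
  have hz : ∀ ds : List BiTree, markProb ρ ds.length ds es =
      if es = ds then ENNReal.ofReal (1 - (ρ ds.length : ℝ)) else 0 := by
    intro ds
    rw [markProb_eq, Finset.sum_eq_zero, add_zero]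
    intro i _
    refine if_neg fun he => ?_
    rw [he, reds_insertIdx ds (by omega)] at h
    exact absurd h (Nat.succ_ne_zero _)
  rw [vertexLaw_black, tsum_eq_single es]
  · rw [hz, if_pos rfl]
  · intro ds hds
    rw [hz, if_neg hds.symm, mul_zero, zero_mul]

/-- The law of the bicolored tree at a vertex with one red leaf: the place of the red leaf and the
other children are determined. -/
theorem vertexLaw_black_of_reds_one {a b : List BiTree} (ha : reds a = 0) (hb : reds b = 0) :
    vertexLaw ρ ν (.black (a ++ .red :: b)) = ν (a ++ b).length *
      ENNReal.ofReal ((ρ (a ++ b).length : ℝ) / (((a ++ b).length : ℝ) + 1)) *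
      ((a ++ b).map (vertexLaw ρ ν)).prod := by
  classical
  have hmem : BiTree.red ∉ a := fun h => (red_mem_iff a).1 h ha
  have hmem2 : BiTree.red ∉ b := fun h => (red_mem_iff b).1 h hb
  have hins : ∀ (ds : List BiTree), reds ds = 0 → ∀ i, i ≤ ds.length →
      (a ++ .red :: b = ds.insertIdx i .red ↔ ds = a ++ b ∧ i = a.length) := by
    intro ds hds i hi
    rw [insertIdx_eq_append _ ds hi, List.append_cons_inj_of_notMem hmem hmem2]
    constructor
    · rintro ⟨rfl, -, rfl⟩
      exact ⟨(List.take_append_drop _ _).symm, by rw [List.length_take]; omega⟩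
    · rintro ⟨rfl, rfl⟩
      simp
  have hself : ∀ ds : List BiTree, reds ds = 0 → a ++ .red :: b ≠ ds := by
    rintro ds hds rfl
    exact (red_mem_iff _).1 (by simp) hds
  rw [vertexLaw_black, tsum_eq_single (a ++ b)]
  · have hab : reds (a ++ b) = 0 := by rw [reds_append, ha, hb]
    rw [markProb_eq, if_neg (hself _ hab), zero_add,
      Finset.sum_eq_single (⟨a.length, by simp⟩ : Fin ((a ++ b).length + 1))]
    · rw [if_pos ((hins _ hab _ (by simp)).2 ⟨rfl, rfl⟩)]
    · intro i _ hi
      refine if_neg fun he => hi (Fin.ext ?_)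
      exact ((hins _ hab _ (by omega)).1 he).2
    · simp
  · intro ds hds
    by_cases hr : reds ds = 0
    · rw [markProb_eq, if_neg (hself ds hr), Finset.sum_eq_zero]
      · simp
      · intro i _
        exact if_neg fun he => hds ((hins ds hr i (by omega)).1 he).1
    · rw [prod_vertexLaw_eq_zero ρ ν hr, mul_zero]

theorem vertexLaw_black_of_one_lt_reds {es : List BiTree} (h : 1 < reds es) :
    vertexLaw ρ ν (.black es) = 0 := by
  classical
  rw [vertexLaw_black]
  refine ENNReal.tsum_eq_zero.2 fun ds => ?_
  by_cases hr : reds ds = 0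
  · rw [markProb_eq, if_neg, Finset.sum_eq_zero]
    · simp
    · intro i _
      refine if_neg fun he => ?_
      rw [he, reds_insertIdx ds (by omega)] at h
      omega
    · rintro rfl
      omega
  · rw [prod_vertexLaw_eq_zero ρ ν hr, mul_zero]

/-- The relation between the offspring law with red leaves and the weights of the blob patterns. -/
structure Matches (X Q : ℝ≥0∞) : Prop where
  unmarked : ∀ k, ν k * ENNReal.ofReal (1 - (ρ k : ℝ)) = redFree k * Q ^ k * Q⁻¹
  marked : ∀ k, ν k * ENNReal.ofReal ((ρ k : ℝ) / ((k : ℝ) + 1)) =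
    X * coef (Real.pi / 2) (k + 1) 0 * Q ^ k * Q⁻¹

variable {ρ ν}

theorem prod_vertexLaw {X Q : ℝ≥0∞} {ds : List BiTree}
    (hds : ∀ d ∈ ds, d ≠ .red → vertexLaw ρ ν d = mass X d * Q⁻¹) (h : reds ds = 0) :
    (ds.map (vertexLaw ρ ν)).prod = massList X ds * Q⁻¹ ^ ds.length := by
  induction ds with
  | nil => simp [massList]
  | cons d ds ih =>
    have hd : d ≠ .red := by
      rintro rfl
      exact (red_mem_iff _).1 (by simp) h
    have hr : reds ds = 0 := by
      by_contra hne
      exact (red_mem_iff _).1 (List.mem_cons_of_mem d ((red_mem_iff ds).2 hne)) h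
    rw [List.map_cons, List.prod_cons, hds d (by simp) hd,
      ih (fun d' hd' => hds d' (List.mem_cons_of_mem d hd')) hr, massList, List.length_cons,
      pow_succ]
    ring

theorem exists_eq_append_of_reds_eq_one {es : List BiTree} (h : reds es = 1) :
    ∃ a b, es = a ++ .red :: b ∧ reds a = 0 ∧ reds b = 0 := by
  obtain ⟨a, b, rfl⟩ := List.append_of_mem ((red_mem_iff es).2 (by omega))
  refine ⟨a, b, rfl, ?_⟩
  rw [reds_append] at h
  have : reds (.red :: b) = reds b + 1 := List.countP_cons_of_pos rfl
  omega

/-- The law of the bicolored Galton–Watson tree is the weight of the blob trees, up to the factor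
`1 / Q`. -/
theorem vertexLaw_eq {X Q : ℝ≥0∞} (hQ0 : Q ≠ 0) (hQ : Q ≠ ⊤) (hm : Matches ρ ν X Q)
    (d : BiTree) : d ≠ .red → vertexLaw ρ ν d = mass X d * Q⁻¹ := by
  have hQn : ∀ n : ℕ, Q ^ n * Q⁻¹ ^ n = 1 := fun n => by
    rw [← mul_pow, ENNReal.mul_inv_cancel hQ0 hQ, one_pow]
  refine BiTree.rec (motive_1 := fun d => d ≠ .red → vertexLaw ρ ν d = mass X d * Q⁻¹)
    (motive_2 := fun ds => ∀ d ∈ ds, d ≠ .red → vertexLaw ρ ν d = mass X d * Q⁻¹)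
    (fun h => absurd rfl h) ?_ (by simp) (fun d ds h1 h2 => by simpa using ⟨h1, h2⟩) d
  intro es hes _
  rw [mass]
  obtain h | h | h : reds es = 0 ∨ reds es = 1 ∨ 1 < reds es := by omega
  · rw [vertexLaw_black_of_reds_zero ρ ν h, prod_vertexLaw hes h, hm.unmarked, h, patternWeight]
    calc _ = redFree es.length * massList X es * Q⁻¹ * (Q ^ es.length * Q⁻¹ ^ es.length) := by ring
      _ = _ := by rw [hQn, mul_one]
  · obtain ⟨a, b, rfl, ha, hb⟩ := exists_eq_append_of_reds_eq_one h
    have hab : reds (a ++ b) = 0 := by rw [reds_append, ha, hb]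
    have hsub : ∀ d ∈ a ++ b, d ≠ .red → vertexLaw ρ ν d = mass X d * Q⁻¹ := fun d hd =>
      hes d (by
        rw [List.mem_append] at hd ⊢
        exact hd.imp id (List.mem_cons_of_mem _))
    rw [vertexLaw_black_of_reds_one ρ ν ha hb, prod_vertexLaw hsub hab, hm.marked, h, patternWeight,
      massList_append, massList_append, massList, mass]
    have hlen : (a ++ .red :: b).length = (a ++ b).length + 1 := by simp; omega
    rw [hlen]
    set n := (a ++ b).length
    calc _ = coef (Real.pi / 2) (n + 1) 0 * (massList X a * (X * massList X b)) * Q⁻¹ *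
          (Q ^ n * Q⁻¹ ^ n) := by ring
      _ = _ := by rw [hQn, mul_one]
  · rw [vertexLaw_black_of_one_lt_reds ρ ν h]
    obtain ⟨r, hr⟩ : ∃ r, reds es = r + 2 := ⟨reds es - 2, by omega⟩
    rw [hr]
    simp [patternWeight]

theorem redRootLaw_node_black (cs : List PlaneTree) (ds : List BiTree) :
    redRootLaw ρ (.node cs) (.black ds) = redListLaw ρ cs ds := by
  classical
  rw [redRootLaw, PMF.map_apply, tsum_eq_single ds]
  · simp
  · intro ds' h
    rw [if_neg]
    simpa using h.symm

theorem redRootLaw_node_red (cs : List PlaneTree) : redRootLaw ρ (.node cs) .red = 0 := by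
  simp [redRootLaw, PMF.map_apply]

theorem tsum_gwRoot_mul_red (ν₀ : PMF ℕ) : ∑' t, gwRoot ν₀ ν t * redRootLaw ρ t .red = 0 := by
  rw [tsum_planeTree]
  simp [redRootLaw_node_red]

theorem tsum_gwRoot_mul_black {X Q A : ℝ≥0∞} (hQ0 : Q ≠ 0) (hQ : Q ≠ ⊤) (hm : Matches ρ ν X Q)
    {ν₀ : PMF ℕ} (h₀ : ∀ k, ν₀ k = A⁻¹ * (coef (Real.pi / 2) k 0 * Q ^ k)) (ds : List BiTree) :
    ∑' t, gwRoot ν₀ ν t * redRootLaw ρ t (.black ds) =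
      A⁻¹ * (coefRed (Real.pi / 2) (reds ds) ds.length 0 * massList X ds) := by
  rw [tsum_planeTree]
  simp_rw [redRootLaw_node_black, gwRoot]
  rw [tsum_length_mul_gwList_mul_redListLaw]
  by_cases h : reds ds = 0
  · have hQn : Q ^ ds.length * Q⁻¹ ^ ds.length = 1 := by
      rw [← mul_pow, ENNReal.mul_inv_cancel hQ0 hQ, one_pow]
    rw [prod_vertexLaw (fun d _ => vertexLaw_eq hQ0 hQ hm d) h, h₀, h, coefRed]
    calc _ = A⁻¹ * (coef (Real.pi / 2) ds.length 0 * massList X ds) *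
          (Q ^ ds.length * Q⁻¹ ^ ds.length) := by ring
      _ = _ := by rw [hQn, mul_one]
  · rw [prod_vertexLaw_eq_zero ρ ν h, coefRed_of_le half_pi_pos.le h, zero_mul, mul_zero, mul_zero]

/-- The law of the blob tree is the mixture of the laws of the bicolored trees over the weights of
the finite Galton–Watson trees. -/
theorem boltzmann_map_singleton {Q : ℝ≥0∞} (hQ0 : Q ≠ 0) (hQ : Q ≠ ⊤)
    (hm : Matches ρ ν (ENNReal.ofReal xc) Q) {ν₀ : PMF ℕ}
    (h₀ : ∀ k, ν₀ k = (genF xc 0)⁻¹ * (coef (Real.pi / 2) k 0 * Q ^ k)) (d : BiTree) :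
    (boltzmann xc 0).map blobTree {d} = ∑' t, gwRoot ν₀ ν t * redRootLaw ρ t d := by
  cases d with
  | red => rw [boltzmann_map_red, tsum_gwRoot_mul_red]
  | black ds => rw [boltzmann_map_black, tsum_gwRoot_mul_black hQ0 hQ hm h₀]

/-- The finite trees carry the whole mass, because the law of the blob tree has mass one. -/
theorem tsum_gwRoot {Q : ℝ≥0∞} (hQ0 : Q ≠ 0) (hQ : Q ≠ ⊤)
    (hm : Matches ρ ν (ENNReal.ofReal xc) Q) {ν₀ : PMF ℕ}
    (h₀ : ∀ k, ν₀ k = (genF xc 0)⁻¹ * (coef (Real.pi / 2) k 0 * Q ^ k)) :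
    ∑' t, gwRoot ν₀ ν t = 1 := by
  have hprob : IsProbabilityMeasure ((boltzmann xc 0).map blobTree) :=
    Measure.isProbabilityMeasure_map measurable_blobTree.aemeasurable
  have h1 : ∑' d, (boltzmann xc 0).map blobTree {d} = 1 := by
    rw [← measure_univ (μ := (boltzmann xc 0).map blobTree), ← Set.iUnion_of_singleton,
      measure_iUnion (fun a b hab => by simpa using hab) fun d => measurableSet_singleton d]
  simp_rw [boltzmann_map_singleton hQ0 hQ hm h₀] at h1
  rw [ENNReal.tsum_comm] at h1
  simp_rw [ENNReal.tsum_mul_left, PMF.tsum_coe, mul_one] at h1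
  exact h1

end

/-! ### The offspring laws -/

/-- The weight `xc * blobWeight 1 k * q ^ (k - 1)` of the blobs with a red leaf. -/
def redPart (k : ℕ) : ℝ :=
  xc * (((k : ℝ) + 1) * (coef (Real.pi / 2) (k + 1) 0).toReal) * qv ^ k / qv

theorem redPart_nonneg (k : ℕ) : 0 ≤ redPart k := by
  have := xc_pos
  have := qv_pos
  unfold redPart; positivity

theorem pv_eq (k : ℕ) : pv k = (redFree k).toReal * qv ^ k / qv + redPart k := by
  unfold pv blobCoef redPart; ring

theorem redPart_le (k : ℕ) : redPart k ≤ pv k := by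
  have := qv_pos
  rw [pv_eq]
  exact le_add_of_nonneg_left (by positivity)

theorem redProb_eq (k : ℕ) : redProb k = redPart k / pv k := by
  rw [redProb, offspring_eq, blobWeight_one, qc_eq, redPart, zpow_sub₀ qv_pos.ne', zpow_natCast, zpow_one]
  ring

theorem redProb_mem (k : ℕ) : redProb k ∈ unitInterval := by
  rw [redProb_eq]
  exact ⟨div_nonneg (redPart_nonneg k) (pv_nonneg k), div_le_one_of_le₀ (redPart_le k) (pv_nonneg k)⟩

/-- If `pv k` vanishes, then so does `redPart k`, and both sides are zero. -/
theorem pv_mul_redProb (k : ℕ) : pv k * redProb k = redPart k := by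
  rw [redProb_eq]
  rcases eq_or_ne (pv k) 0 with h | h
  · rw [h, zero_mul]
    exact le_antisymm (redPart_nonneg k) (h ▸ redPart_le k)
  · exact mul_div_cancel₀ _ h

/-- The root offspring law in terms of `coef (π / 2) k 0`, the weight of the blob patterns with one
prescribed red leaf; the normalization is the value of `ampl` at `q`. -/
theorem rootOffspring_eq (k : ℕ) : rootOffspring k =
    (coef (Real.pi / 2) k 0).toReal * qv ^ k / (w0 / Real.pi ^ 2) := by
  have hq := qv_pos
  have hx := xc_pos
  have hw := w0_pos
  have hpi := Real.pi_pos
  have e : ∀ j : ℕ, offspring j * redProb j / ((j : ℝ) + 1) =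
      xc / qv ^ 2 * ((coef (Real.pi / 2) (j + 1) 0).toReal * qv ^ (j + 1)) := by
    intro j
    rw [offspring_eq, pv_mul_redProb, redPart]
    field_simp
    ring
  match k with
  | 0 => rw [rootOffspring, coef_zero]; simp
  | k + 1 =>
    have hs : ∑' j : ℕ, (coef (Real.pi / 2) (j + 1) 0).toReal * qv ^ (j + 1) = w0 / Real.pi ^ 2 := by
      rw [← ampl_qv, ampl, (summable_ampl half_pi_pos hq.le
        (by rw [critWeight_half_pi]; exact qv_lt.le)).tsum_eq_zero_add, coef_zero]
      simp
    rw [rootOffspring]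
    simp_rw [e]
    rw [tsum_mul_left, hs, mul_div_mul_left _ _ (by positivity)]

theorem gf_qv : gf (Real.pi / 2) (ENNReal.ofReal qv) 0 = genF xc 0 := by
  have h := (ampl_spec half_pi_pos qv_pos.le (by rw [critWeight_half_pi]; exact qv_lt.le)).2.2.2 0
    le_rfl half_pi_pos.le
  rw [h, besselSol_zero, ampl_qv, genF_xc_zero]

/-- The offspring law `p`. -/
def offspringPMF : PMF ℕ :=
  ⟨fun k => ENNReal.ofReal (pv k), by
    rw [ENNReal.summable.hasSum_iff, ← ENNReal.ofReal_tsum_of_nonneg pv_nonneg hasSum_pv.summable,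
      hasSum_pv.tsum_eq, ENNReal.ofReal_one]⟩

theorem offspringPMF_apply (k : ℕ) : offspringPMF k = ENNReal.ofReal (pv k) := rfl

/-- The root offspring law `p^•`. -/
def rootPMF : PMF ℕ :=
  ⟨fun k => (genF xc 0)⁻¹ * (coef (Real.pi / 2) k 0 * ENNReal.ofReal qv ^ k), by
    rw [ENNReal.summable.hasSum_iff, ENNReal.tsum_mul_left]
    change (genF xc 0)⁻¹ * gf (Real.pi / 2) (ENNReal.ofReal qv) 0 = 1
    rw [gf_qv, ENNReal.inv_mul_cancel genF_xc_ne_zero genF_xc_ne_top]⟩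

theorem rootPMF_apply (k : ℕ) :
    rootPMF k = (genF xc 0)⁻¹ * (coef (Real.pi / 2) k 0 * ENNReal.ofReal qv ^ k) := rfl

theorem toReal_rootPMF (k : ℕ) : (rootPMF k).toReal = rootOffspring k := by
  have hw := w0_pos
  have hpi := Real.pi_pos
  rw [rootPMF_apply, rootOffspring_eq, genF_xc_zero, ENNReal.toReal_mul, ENNReal.toReal_inv,
    ENNReal.toReal_ofReal (by positivity), ENNReal.toReal_mul, ENNReal.toReal_pow,
    ENNReal.toReal_ofReal qv_pos.le]
  ring

/-- The probabilities `r_k` of a red leaf. -/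
def redUnit (k : ℕ) : unitInterval := ⟨redProb k, redProb_mem k⟩

theorem matches_offspring :
    Matches redUnit offspringPMF (ENNReal.ofReal xc) (ENNReal.ofReal qv) := by
  have hq := qv_pos
  have hx := xc_pos
  constructor
  · intro k
    rw [offspringPMF_apply, ← ENNReal.ofReal_mul (pv_nonneg k)]
    have : pv k * (1 - (redUnit k : ℝ)) = (redFree k).toReal * qv ^ k * qv⁻¹ := by
      rw [mul_sub, mul_one, show (redUnit k : ℝ) = redProb k from rfl, pv_mul_redProb, pv_eq]
      ring
    rw [this, ENNReal.ofReal_mul (by positivity), ENNReal.ofReal_mul (by positivity),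
      ENNReal.ofReal_toReal (redFree_ne_top k), ENNReal.ofReal_pow hq.le,
      ENNReal.ofReal_inv_of_pos hq]
  · intro k
    rw [offspringPMF_apply, ← ENNReal.ofReal_mul (pv_nonneg k)]
    have : pv k * ((redUnit k : ℝ) / ((k : ℝ) + 1)) =
        xc * (coef (Real.pi / 2) (k + 1) 0).toReal * qv ^ k * qv⁻¹ := by
      rw [← mul_div_assoc, show (redUnit k : ℝ) = redProb k from rfl, pv_mul_redProb, redPart]
      field_simp
    rw [this, ENNReal.ofReal_mul (by positivity), ENNReal.ofReal_mul (by positivity),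
      ENNReal.ofReal_mul hx.le, ENNReal.ofReal_toReal (coef_zero_lt_top half_pi_pos _).ne,
      ENNReal.ofReal_pow hq.le, ENNReal.ofReal_inv_of_pos hq]

theorem tsum_gwRoot_eq_one : ∑' t, gwRoot rootPMF offspringPMF t = 1 :=
  tsum_gwRoot (ENNReal.ofReal_pos.2 qv_pos).ne' ENNReal.ofReal_ne_top matches_offspring
    rootPMF_apply

/-- The law of the Galton–Watson tree on finite plane trees. -/
def gwPMF : PMF PlaneTree :=
  ⟨gwRoot rootPMF offspringPMF, by rw [ENNReal.summable.hasSum_iff, tsum_gwRoot_eq_one]⟩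

/-- The blob tree and the Galton–Watson tree with added red leaves have the same law. -/
theorem boltzmann_map_blobTree :
    (boltzmann xc 0).map blobTree = (gwPMF.bind (redRootLaw redUnit)).toMeasure := by
  refine Measure.ext_of_singleton fun d => ?_
  rw [PMF.toMeasure_apply_singleton _ _ (measurableSet_singleton d), PMF.bind_apply]
  exact boltzmann_map_singleton (ENNReal.ofReal_pos.2 qv_pos).ne' ENNReal.ofReal_ne_top
    matches_offspring rootPMF_apply d

end

end BlobTree

theorem mainTheorem9 :
    -- `p = offspring` is a probability measure with mean one and variance `σ²`
    ((∀ k, 0 ≤ offspring k) ∧ HasSum offspring 1) ∧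
    HasSum (fun k : ℕ => (k : ℝ) * offspring k) 1 ∧
    HasSum (fun k : ℕ => ((k : ℝ) - 1) ^ 2 * offspring k)
      (2 * (besselJ 1 (c0 / 2) * besselJ 1 c0) / besselJ 0 (c0 / 2) ^ 3) ∧
    -- exponential moments, and `p_k = (q / (4 x_c))^(k + o(k))`
    (∃ t : ℝ, 0 < t ∧ Summable fun k : ℕ => Real.exp (t * k) * offspring k) ∧
    (0 < qc / (4 * xc) ∧ qc / (4 * xc) < 1 ∧
      ∃ ε : ℕ → ℝ, (ε =o[Filter.atTop] fun k : ℕ => (k : ℝ)) ∧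
        ∀ᶠ k : ℕ in Filter.atTop, offspring k = (qc / (4 * xc)) ^ ((k : ℝ) + ε k)) ∧
    -- the blob tree as a modified Galton--Watson tree with added red leaves
    ∃ (ν₀ ν : PMF ℕ) (ρ : ℕ → unitInterval),
      (∀ k, (ν₀ k).toReal = rootOffspring k) ∧ (∀ k, (ν k).toReal = offspring k) ∧ (∀ k, (ρ k : ℝ) = redProb k) ∧
      (∀ᵐ κ ∂(offspringLaw ν₀ ν), ∃ t : PlaneTree, Codes κ t) ∧
      ∃ G : PMF PlaneTree, (∀ t, G t = offspringLaw ν₀ ν {κ | Codes κ t}) ∧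
        Measurable blobTree ∧
        (boltzmann xc 0).map blobTree = (G.bind (redRootLaw ρ)).toMeasure := by
  have hoff : offspring = pv := funext offspring_eq
  rw [hoff, qc_eq]
  have hq := qv_pos
  have hx := xc_pos
  refine ⟨⟨pv_nonneg, hasSum_pv⟩, hasSum_mul_pv, hasSum_sq_mul_pv, exists_exp_moment_pv,
    ⟨by positivity, (div_lt_one (by positivity)).2 qv_lt, exists_pv_eq_rpow⟩,
    rootPMF, offspringPMF, redUnit, toReal_rootPMF, fun k => ENNReal.toReal_ofReal (pv_nonneg k),
    fun k => rfl, ae_exists_codes tsum_gwRoot_eq_one, gwPMF,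
    fun t => (offspringLaw_codes rootPMF offspringPMF t).symm, measurable_blobTree,
    boltzmann_map_blobTree⟩
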